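/- **Notation.** For a vector field $X$ and a scalar function $h$ write $Xh:=(Dh)X$, iterate by $f^{i}h:=f(f^{i-1}h)$ and $\Delta_1\cdots\Delta_kh:=\Delta_1(\Delta_2(\cdots(\Delta_kh)))$, and put $[X,Y]:=(DY)X-(DX)Y$. $|\cdot|$ is the Euclidean norm, $\mathbb R^+=[0,\infty)$, and $\mathrm{cl}$, $\mathrm{int}$, $\partial$ denote closure, interior and boundary. A function $V:\mathbb R^m\to\mathbb R^+$ is positive definite if $V(0)=0$ and $V>0$ elsewhere, and proper if $V(z)\to\infty$ as $|z|\to\infty$. **The system.** Let $a,\beta,\gamma,\delta:\mathbb R^n\to\mathbb R^n$ be $C^\infty$ vector fields with $a(0)=0$, and consider $\dot z=f(z)+u\,g(z)$, $z=(x,y)\in\mathbb R^n\times\mathbb R$, $u\in\mathbb R$, with $$f(x,y)=\begin{pmatrix}a(x)+y\beta(x)+y^2\gamma(x)+y^3\delta(x)\\0\end{pmatrix},\qquad g(x,y)=\begin{pmatrix}0\\1\end{pmatrix}.$$ Let $W:\mathbb R^n\to\mathbb R^+$ be $C^\infty$, positive definite and proper. Define the following subsets of $\mathbb R^n\setminus\{0\}$: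 - $E_1=\{aW<0\}$; - $E_2=\{aW\le0,\ \beta W\ne0\}$; - $E_3=\{aW=\beta W=0,\ \gamma W<0\}$; - $E_4=\{aW=\beta W=\gamma W=0,\ \delta W\neq0\}$; - $E_5=\{aW=\beta W=\gamma W=\delta W=[[a,\gamma],a]W=0,\ [a,\delta]W\ne0\}$. Assume that $E_1\cup E_2\cup E_3\cup E_4\cup E_5=\mathbb R^n\setminus\{0\}$, that every $E_i$ is nonempty with $0\in\mathrm{cl}\,E_i$, and that $$\mathrm{cl}(E_1\cup E_2)\cap \mathrm{cl}(E_3\cup E_4\cup E_5)=\partial E_1,\quad \mathrm{int}\,E_3\ne\varnothing,\quad \mathrm{cl}(E_4\cup E_5)\subset\partial E_3,\quad \mathrm{int}(E_4\cup E_5)=\varnothing,\quad (E_4\cup E_5)\cap\partial E_1=\varnothing.$$ **Claim.** The function $V(x,y):=W(x)+y^2$ satisfies conditions (A) and (B) below, and the system is BSDF-SGAS as defined in (C). **Lie algebraic notions.** Let $\lambda_{1,0}:=f$ and, for $\kappa\ge2$ and $1\le j\le\kappa-1$, let $\lambda_{\kappa,j}$ be the sum, over all $r_1,\dots,r_j\in\mathbb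 N_0$ with $r_1+\dots+r_j=\kappa-j-1$, of the left-nested bracket that starts with $[f,g]$, is then bracketed on the right $r_j$ times with $f$, then once with $g$, then $r_{j-1}$ times with $f$, and so on, ending with $r_1$ times $f$. Let $L\{f,g\}$ be the linear span of all $\lambda_{\kappa,j}$. An element of $L\{f,g\}$ has order $\kappa$ if it is the sum of a nonzero combination of the fields $\lambda_{\kappa,j}$ and a combination of fields $\lambda_{i,j}$ with $i<\kappa$. It has order $\kappa$ and $g$-order $l$ if moreover only fields $\lambda_{i,l}$ occur. For $z\in\mathbb R^{n+1}$ and integers $N,M\geq 1$, $q\geq 0$, consider the following implications, in which $\Delta_p\in L\{f,g\}$ and $k\geq 1$ are arbitrary: - $\mathcal V_{\le N}(z)$: if $(gV)(z)=0$, then $(\Delta_1\cdots\Delta_kV)(z)=0$ whenever the orders of the $\Delta_p$ have sum $\le N$. - $\mathcal V_{M,q}(z)$: if $(gV)(z)=0$, then $(\Delta_1\cdots\Delta_kV)(z)=0$ whenever the orders of the $\Delta_p$ have sum $M$ and their $g$-orders have sum $q$. **(A)** $f,g,V$ are $C^\infty$, $f(0)=0$, $V$ is positive definite and proper, and for every $z\ne0$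 one of the following holds: 1. $(gV)(z)\ne0$; 2. $(gV)(z)=0$ implies $(fV)(z)<0$; 3. there is an integer $N\ge1$ such that $\mathcal V_{\le N}(z)$ holds and either $(f^{N+1}V)(z)<0$, or $(f^{N+1}V)(z)\le0$ together with one of - (i) there is an odd $j\in\{1,\dots,N\}$ with $(\lambda_{N+1,j}V)(z)\neq0$ such that $\mathcal V_{N+1,q}(z)$ holds for all positive even $q<j$; - (ii) $N>2$ is odd and there is an odd $j\in\{1,\dots,N-2\}$ with $(\lambda_{N+1,j}V)(z)\ne0$ such that $\mathcal V_{N+1,q}(z)$ holds for all even $q$ with $j<q<N$; - (iii) $N$ is even and $(\lambda_{N+1,N}V)(z)<0$. **(B)** (A) holds; there are continuous $\theta:\mathbb R^{n+1}\to\mathbb R^+$ and $\xi:\mathbb R^+\to\mathbb R^+$ with $|(fV)(z)+\theta(z)|\le\xi(|z|)\,|(gV)(z)|$ for all $z$; and for every $z\neq 0$ the alternatives in (A) hold with (ii) and (iii) replaced by - (ii') $N>2$ is odd, $(\lambda_{N+1,N}V)(z)\ne0$, and $\mathcal V_{N+1,q}(z)$ holds for all $q\in\{0,\dots,N-1\}$;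 - (iii') $N$ is even, $(\lambda_{N+1,N}V)(z)<0$, and $\mathcal V_{N+1,q}(z)$ holds for all $q\in\{0,\dots,N-1\}$. **(C)** The system is BSDF-SGAS (semi-globally asymptotically stabilizable by bounded sampled-data feedback) if for every $R>0$ and every partition $0=T_1<T_2<\cdots$ with $T_\nu\to\infty$ and $T_{\nu+1}-T_\nu$ bounded there are a neighborhood $\Omega$ of $0$ containing the closed ball of radius $R$ about $0$, and a map $k:\mathbb R^+\times\Omega\to\mathbb R$, with $k(\cdot,z)$ measurable and essentially bounded for each $z\in\Omega$, such that: - for every $\pi(0)\in\Omega$ the sampled-data closed loop $\dot\pi=f(\pi)+k(t,\pi(T_i))\,g(\pi)$, $t\in[T_i,T_{i+1})$, has a trajectory on $[0,\infty)$ (with $\pi(T_i)\in\Omega$ for all $i$); - for every $\varepsilon>0$ there is $\delta_0>0$ such that these trajectories satisfy $|\pi(t)|\le\varepsilon$ for all $t\ge0$ if $|\pi(0)|\le\delta_0$; - $\pi(t)\to0$ as $t\to\infty$ for every such trajectory; - there are $C>0$ and $\tau>0$ with $|k(t,z)|\le C$ for all $z\in\Omega$ and $t\in[0,\tau]$. 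-/

import Mathlib

open Set Filter Topology MeasureTheory
open scoped ContDiff

noncomputable section

namespace SampledData

section Lie

variable {E : Type*} [NormedAddCommGroup E] [NormedSpace ℝ E]

/-- The derivative `X h = (D h) X` of a scalar function `h` along a vector field `X`. -/
def lieD (X : E → E) (h : E → ℝ) : E → ℝ := fun x => fderiv ℝ h x (X x)

/-- The iterated derivative `f ^ i h`, with `f ^ i h = f (f ^ (i - 1) h)`. -/
def lieDIter (f : E → E) (h : E → ℝ) (i : ℕ) : E → ℝ := (lieD f)^[i] h

/-- `Δ₁ (Δ₂ (⋯ (Δ_k V)))`. -/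
def lieWord {k : ℕ} (Δ : Fin k → E → E) (V : E → ℝ) : E → ℝ :=
  (List.ofFn Δ).foldr lieD V

/-- The bracket `[X, Y] = X Y - Y X`, i.e. `x ↦ (D Y) X - (D X) Y`. -/
def brk (X Y : E → E) : E → E := VectorField.lieBracket ℝ X Y

/-- `nested f g X [r₁, …, r_j]`: starting from `X`, bracket on the right with `g` and then `r₁`
times with `f`, then with `g` and then `r₂` times with `f`, and so on. -/
def nested (f g : E → E) : (E → E) → List ℕ → (E → E)
  | X, [] => X
  | X, r :: rs => nested f g ((fun Z => brk Z f)^[r] (brk X g)) rs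

/-- The vector fields `λ_{κ, j}`: for `1 ≤ j < κ`, the sum over all
`r₁ + ⋯ + r_j = κ - j - 1` of the left-nested brackets
`[…[[f, g], f], …, f], g], f, …], g], f], …, f]` with `j` occurrences of `g` (the `p`-th one
being followed by `r_p` brackets with `f`; the order in which the `r_p` are numbered does not
affect the sum). For `κ = 1`, `j = 0` there is only the empty tuple, and the value is `f`. -/
def lam (f g : E → E) (κ j : ℕ) : E → E :=
  ∑ r ∈ Finset.Nat.antidiagonalTuple j (κ - j - 1), nested f g f (List.ofFn r)

/-- The linear span `L{f, g}` of the `λ_{κ, j}`, `κ ≥ 1`, `0 ≤ j ≤ κ - 1`. -/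
def lieSpan (f g : E → E) : Submodule ℝ (E → E) :=
  Submodule.span ℝ {Δ | ∃ κ j : ℕ, 1 ≤ κ ∧ j ≤ κ - 1 ∧ Δ = lam f g κ j}

/-- `Δ ∈ L{f, g}` has order `κ`: it is a nonzero element of the span of the `λ_{κ, j}` up to terms
`λ_{i, j}` with `i < κ`. -/
def HasOrder (f g : E → E) (Δ : E → E) (κ : ℕ) : Prop :=
  Δ ∈ lieSpan f g ∧ ∃ Δ₁ Δ₂ : E → E, Δ = Δ₁ + Δ₂ ∧ Δ₁ ≠ 0 ∧
    Δ₁ ∈ Submodule.span ℝ {X | ∃ j : ℕ, 1 ≤ κ ∧ j ≤ κ - 1 ∧ X = lam f g κ j} ∧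
    Δ₂ ∈ Submodule.span ℝ {X | ∃ i j : ℕ, 1 ≤ i ∧ i < κ ∧ j ≤ i - 1 ∧ X = lam f g i j}

/-- `Δ ∈ L{f, g}` has order `κ` and involves `g` exactly `l` times: as `HasOrder`, with
generators `λ_{i, l}` only. -/
def HasOrders (f g : E → E) (Δ : E → E) (κ l : ℕ) : Prop :=
  Δ ∈ lieSpan f g ∧ ∃ Δ₁ Δ₂ : E → E, Δ = Δ₁ + Δ₂ ∧ Δ₁ ≠ 0 ∧
    Δ₁ ∈ Submodule.span ℝ {X | 1 ≤ κ ∧ l ≤ κ - 1 ∧ X = lam f g κ l} ∧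
    Δ₂ ∈ Submodule.span ℝ {X | ∃ i : ℕ, 1 ≤ i ∧ i < κ ∧ l ≤ i - 1 ∧ X = lam f g i l}

/-- If `(g V)(x) = 0`, then `(Δ₁ ⋯ Δ_k V)(x) = 0` for all `k ≥ 1` and all `Δ_p ∈ L{f, g}` whose
orders have sum at most `N`. -/
def VanishUpTo (f g : E → E) (V : E → ℝ) (x : E) (N : ℕ) : Prop :=
  lieD g V x = 0 →
    ∀ (k : ℕ) (Δ : Fin k → E → E) (o : Fin k → ℕ), 1 ≤ k →
      (∀ p, HasOrder f g (Δ p) (o p)) → ∑ p, o p ≤ N → lieWord Δ V x = 0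

/-- If `(g V)(x) = 0`, then `(Δ₁ ⋯ Δ_k V)(x) = 0` for all `k ≥ 1` and all `Δ_p ∈ L{f, g}` whose
orders have sum `M` and whose orders in `g` have sum `q`. -/
def VanishAt (f g : E → E) (V : E → ℝ) (x : E) (M q : ℕ) : Prop :=
  lieD g V x = 0 →
    ∀ (k : ℕ) (Δ : Fin k → E → E) (o l : Fin k → ℕ), 1 ≤ k →
      (∀ p, HasOrders f g (Δ p) (o p) (l p)) → ∑ p, o p = M → ∑ p, l p = q →
        lieWord Δ V x = 0

/-- First alternative: an odd `j ∈ {1, …, N}` with `(λ_{N+1, j} V)(x) ≠ 0`, and vanishing for all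
positive even `q < j` (an empty condition unless `j > 2`). -/
def AltOddLow (f g : E → E) (V : E → ℝ) (x : E) (N : ℕ) : Prop :=
  ∃ j : ℕ, Odd j ∧ 1 ≤ j ∧ j ≤ N ∧ lieD (lam f g (N + 1) j) V x ≠ 0 ∧
    ∀ q : ℕ, Even q → 0 < q → q < j → VanishAt f g V x (N + 1) q

/-- Second alternative: `N > 2` is odd and there is an odd `j ∈ {1, …, N - 2}` with
`(λ_{N+1, j} V)(x) ≠ 0`, and vanishing for all even `q` with `j < q < N`. -/
def AltOddHigh (f g : E → E) (V : E → ℝ) (x : E) (N : ℕ) : Prop :=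
  Odd N ∧ 2 < N ∧ ∃ j : ℕ, Odd j ∧ 1 ≤ j ∧ j ≤ N - 2 ∧ lieD (lam f g (N + 1) j) V x ≠ 0 ∧
    ∀ q : ℕ, Even q → j < q → q < N → VanishAt f g V x (N + 1) q

/-- Third alternative: `N` is even and `(λ_{N+1, N} V)(x) < 0`. -/
def AltEven (f g : E → E) (V : E → ℝ) (x : E) (N : ℕ) : Prop :=
  Even N ∧ lieD (lam f g (N + 1) N) V x < 0

/-- Vanishing for total order `N + 1` and every total order in `g` at most `N - 1`. -/
def VanishBelow (f g : E → E) (V : E → ℝ) (x : E) (N : ℕ) : Prop :=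
  ∀ q : ℕ, q ≤ N - 1 → VanishAt f g V x (N + 1) q

/-- Strengthened second alternative: `j = N` instead of `j ≤ N - 2`. -/
def AltOddHighStrong (f g : E → E) (V : E → ℝ) (x : E) (N : ℕ) : Prop :=
  Odd N ∧ 2 < N ∧ lieD (lam f g (N + 1) N) V x ≠ 0 ∧ VanishBelow f g V x N

/-- Strengthened third alternative. -/
def AltEvenStrong (f g : E → E) (V : E → ℝ) (x : E) (N : ℕ) : Prop :=
  AltEven f g V x N ∧ VanishBelow f g V x N

/-- A smooth, positive definite, proper function with values in `[0, ∞)`. -/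
structure IsLyapunovCandidate (V : E → ℝ) : Prop where
  smooth : ContDiff ℝ ∞ V
  zero : V 0 = 0
  pos : ∀ x, x ≠ 0 → 0 < V x
  proper : Tendsto V (cocompact E) atTop

/-- The Lie algebraic sufficient conditions for stabilization of `ẋ = f(x) + u g(x)` by
sampled-data feedback. -/
structure SDFConditions (f g : E → E) (V : E → ℝ) : Prop where
  smooth_f : ContDiff ℝ ∞ f
  smooth_g : ContDiff ℝ ∞ g
  f_zero : f 0 = 0
  candidate : IsLyapunovCandidate V
  lie : ∀ x, x ≠ 0 →
    lieD g V x ≠ 0 ∨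
    (lieD g V x = 0 → lieD f V x < 0) ∨
    ∃ N : ℕ, 1 ≤ N ∧ VanishUpTo f g V x N ∧
      (lieDIter f V (N + 1) x < 0 ∨
        (lieDIter f V (N + 1) x ≤ 0 ∧
          (AltOddLow f g V x N ∨ AltOddHigh f g V x N ∨ AltEven f g V x N)))

/-- The Lie algebraic sufficient conditions for stabilization by bounded sampled-data
feedback: those of `SDFConditions`, the estimate `|f V + θ| ≤ ξ(|z|) |g V|`, and the last two
alternatives replaced by their strengthened forms. -/
structure BSDFConditions (f g : E → E) (V : E → ℝ) : Prop where
  base : SDFConditions f g V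
  bound : ∃ (θ : E → ℝ) (ξ : ℝ → ℝ), Continuous θ ∧ (∀ z, 0 ≤ θ z) ∧
    ContinuousOn ξ (Ici 0) ∧ (∀ r, 0 ≤ r → 0 ≤ ξ r) ∧
    ∀ z, |lieD f V z + θ z| ≤ ξ ‖z‖ * |lieD g V z|
  lie : ∀ x, x ≠ 0 →
    lieD g V x ≠ 0 ∨
    (lieD g V x = 0 → lieD f V x < 0) ∨
    ∃ N : ℕ, 1 ≤ N ∧ VanishUpTo f g V x N ∧
      (lieDIter f V (N + 1) x < 0 ∨
        (lieDIter f V (N + 1) x ≤ 0 ∧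
          (AltOddLow f g V x N ∨ AltOddHighStrong f g V x N ∨ AltEvenStrong f g V x N)))

end Lie

section Stabilization

variable {E : Type*} [NormedAddCommGroup E] [NormedSpace ℝ E]

/-- A partition `0 = T 0 < T 1 < ⋯` of `[0, ∞)` with `T ν → ∞` and bounded steps. -/
structure IsPartition (T : ℕ → ℝ) : Prop where
  zero : T 0 = 0
  mono : StrictMono T
  unbounded : Tendsto T atTop atTop
  steps : ∃ M : ℝ, ∀ ν, T (ν + 1) - T ν ≤ M

/-- `π : [0, ∞) → E` is a (Carathéodory) trajectory of `π̇ = F(π, k(t, π(T i)))`,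
`t ∈ [T i, T (i + 1))`, `i = 0, 1, …`; only the values of `π` on `[0, ∞)` matter. As `k(t, ·)` is
only meaningful on `Ω`, the states at the sampling times are required to lie in `Ω`. -/
def IsClosedLoopTrajectory (F : E → ℝ → E) (T : ℕ → ℝ) (Ω : Set E) (k : ℝ → E → ℝ)
    (π : ℝ → E) : Prop :=
  ContinuousOn π (Ici 0) ∧ ∀ i : ℕ, π (T i) ∈ Ω ∧
    IntervalIntegrable (fun s => F (π s) (k s (π (T i)))) volume (T i) (T (i + 1)) ∧
    ∀ t ∈ Icc (T i) (T (i + 1)),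
      π t = π (T i) + ∫ s in (T i)..t, F (π s) (k s (π (T i)))

/-- `k` is a sampled-data feedback on `Ω` for which every initial state in `Ω` has a closed-loop
trajectory on `[0, ∞)`, and the closed-loop trajectories are stable and attracted to `0`. -/
structure IsStabilizing (F : E → ℝ → E) (T : ℕ → ℝ) (Ω : Set E) (k : ℝ → E → ℝ) : Prop where
  measurable : ∀ x ∈ Ω, Measurable fun t => k t x
  essBounded : ∀ x ∈ Ω, ∃ M : ℝ, ∀ᵐ t ∂(volume.restrict (Ici (0 : ℝ))), |k t x| ≤ M
  complete : ∀ x ∈ Ω, ∃ π, IsClosedLoopTrajectory F T Ω k π ∧ π 0 = x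
  stable : ∀ ε > 0, ∃ δ > 0, ∀ π, IsClosedLoopTrajectory F T Ω k π → ‖π 0‖ ≤ δ →
    ∀ t, 0 ≤ t → ‖π t‖ ≤ ε
  attractive : ∀ π, IsClosedLoopTrajectory F T Ω k π → Tendsto π atTop (𝓝 0)

/-- Semi-global asymptotic stabilizability by bounded sampled-data feedback. -/
def BSDFSGAS (F : E → ℝ → E) : Prop :=
  ∀ R : ℝ, 0 < R → ∀ T : ℕ → ℝ, IsPartition T →
    ∃ Ω ∈ 𝓝 (0 : E), Metric.closedBall 0 R ⊆ Ω ∧ ∃ k : ℝ → E → ℝ,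
      IsStabilizing F T Ω k ∧
      ∃ C > 0, ∃ τ > 0, ∀ x ∈ Ω, ∀ t ∈ Icc (0 : ℝ) τ, |k t x| ≤ C

end Stabilization

section Cascade

/-- `ℝⁿ` with the Euclidean norm. -/
abbrev Rn (n : ℕ) := EuclideanSpace ℝ (Fin n)

/-- `ℝⁿ × ℝ` with the Euclidean norm. -/
abbrev RnR (n : ℕ) := WithLp 2 (Rn n × ℝ)

variable {n : ℕ}

/-- The drift `(a(x) + y β(x) + y² γ(x) + y³ δ(x), 0)`. -/
def drift (a β γ δ : Rn n → Rn n) (z : RnR n) : RnR n :=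
  WithLp.toLp 2
    (a z.fst + z.snd • β z.fst + z.snd ^ 2 • γ z.fst + z.snd ^ 3 • δ z.fst, 0)

/-- The input vector field `(0, 1)`. -/
def input (_ : RnR n) : RnR n := WithLp.toLp 2 (0, 1)

/-- `V(x, y) = W(x) + y²`. -/
def lyap (W : Rn n → ℝ) (z : RnR n) : ℝ := W z.fst + z.snd ^ 2

/-- `{x ≠ 0 : aW < 0}`. -/
def E1 (a : Rn n → Rn n) (W : Rn n → ℝ) : Set (Rn n) :=
  {x | x ≠ 0 ∧ lieD a W x < 0}

/-- `{x ≠ 0 : aW ≤ 0, βW ≠ 0}`. -/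
def E2 (a β : Rn n → Rn n) (W : Rn n → ℝ) : Set (Rn n) :=
  {x | x ≠ 0 ∧ lieD a W x ≤ 0 ∧ lieD β W x ≠ 0}

/-- `{x ≠ 0 : aW = βW = 0, γW < 0}`. -/
def E3 (a β γ : Rn n → Rn n) (W : Rn n → ℝ) : Set (Rn n) :=
  {x | x ≠ 0 ∧ lieD a W x = 0 ∧ lieD β W x = 0 ∧ lieD γ W x < 0}

/-- `{x ≠ 0 : aW = βW = γW = 0, δW ≠ 0}`. -/
def E4 (a β γ δ : Rn n → Rn n) (W : Rn n → ℝ) : Set (Rn n) :=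
  {x | x ≠ 0 ∧ lieD a W x = 0 ∧ lieD β W x = 0 ∧ lieD γ W x = 0 ∧ lieD δ W x ≠ 0}

/-- `{x ≠ 0 : aW = βW = γW = δW = [[a, γ], a]W = 0, [a, δ]W ≠ 0}`. -/
def E5 (a β γ δ : Rn n → Rn n) (W : Rn n → ℝ) : Set (Rn n) :=
  {x | x ≠ 0 ∧ lieD a W x = 0 ∧ lieD β W x = 0 ∧ lieD γ W x = 0 ∧ lieD δ W x = 0 ∧
    lieD (brk (brk a γ) a) W x = 0 ∧ lieD (brk a δ) W x ≠ 0}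

end Cascade

end SampledData

end

namespace SampledData

/-! ### Carathéodory solutions for a constant input field and bounded measurable controls -/

section Arcs

variable {E : Type*} [NormedAddCommGroup E] [NormedSpace ℝ E]

/-! Everything rests on two consequences of the assumptions. The cover gives aW ≤ 0 everywhere
(`lieD_nonpos_of_cover`). Near a point of E₄ ∪ E₅ even aW = βW = 0 and γW ≤ 0, because the boundary
conditions keep such a point out of cl(E₁ ∪ E₂) (`eventually_of_mem_E4_E5`). Points where a sign
condition on aW or γW is attained with equality are local maxima, which kills first derivatives
there and bounds second ones.

For (A) and (B), gV = 2y leaves only the points with y = 0 and x ≠ 0. The field λ_{κ,j} acts on V as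
a combination of words in f and g with κ letters, j of them g (`actsHom_lam`), so the vanishing
conditions follow once the words containing an f vanish (`vanishUpTo_of_words`,
`vanishAt_of_words`). A word applied to V is a polynomial in y, and f and g act on its coefficients
by explicit formulas (`isPoly_wordD`); its value at y = 0 is the zeroth coefficient. On E₁ already
fV < 0. Where aW = 0, the sets E₂, E₃, E₄, E₅ are handled with N = 1, 2, 3, 4, the decisive values
being λ_{2,1}V = -βW, λ_{3,2}V = 2γW (unless f³V < 0 or λ_{3,1}V ≠ 0 already decides), λ_{4,3}V =
-6δW and λ_{5,3}V = 18[a,δ]W. Alternative (ii) is never needed. The estimate in (B) holds with θ =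
-aW, since then fV + θ is y times a continuous function.

Assertion (C) is proved directly and not deduced from (B). Its local part is `CanDecrease`: with one
bound on the controls, V can be lowered from every nonzero state of a sublevel set with arbitrarily
small overshoot. If y ≠ 0, a constant control pushes y towards 0. If y = 0, a short pulse sends y
out and back to 0 with a well-chosen sign, so that the net change of V is that of W; each Eᵢ
supplies the sign (the lemmas on `PulseDecreases`).

To go from local to global, minimize V over the closure of the set reachable inside {V < B}: a
positive minimum could be lowered further (`exists_steers_lt`). Hence from each nonzero state and
sampling time there is an open-loop plan that ends at a sampling time, more than halves V and never
doubles it (`exists_plan`). A feedback may use only the time and the last sampled state, so at each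
sample it follows the plan through that state that has the lowest dyadic level of initial V and,
among those, the earliest end. Along a closed loop the level never rises, and while it stays
constant the end is never postponed (`Plan.IsBest.step`). So a plan is eventually finished or
replaced by one of lower level, which gives attraction; monotonicity of the level gives stability.
-/

/-- Measurable controls bounded by `C`. -/
structure IsControl (C : ℝ) (u : ℝ → ℝ) : Prop where
  measurable : Measurable u
  bound : ∀ t, |u t| ≤ C

theorem IsControl.intervalIntegrable {C : ℝ} {u : ℝ → ℝ} (hu : IsControl C u) (s t : ℝ) :
    IntervalIntegrable u volume s t := by
  refine (intervalIntegrable_const (c := C)).mono_fun hu.measurable.aestronglyMeasurable ?_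
  exact Eventually.of_forall fun r => by
    simpa using (hu.bound r).trans (le_abs_self C)

theorem IsControl.continuous_primitive {C : ℝ} {u : ℝ → ℝ} (hu : IsControl C u) (s : ℝ) :
    Continuous fun r => ∫ τ in s..r, u τ :=
  intervalIntegral.continuous_primitive hu.intervalIntegrable s

theorem IsControl.intervalIntegrable_smul {C : ℝ} {u : ℝ → ℝ} (hu : IsControl C u) (b : E)
    (s t : ℝ) : IntervalIntegrable (fun τ => u τ • b) volume s t :=
  ⟨(hu.intervalIntegrable s t).1.smul_const b, (hu.intervalIntegrable s t).2.smul_const b⟩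

theorem IsControl.zero {C : ℝ} (hC : 0 ≤ C) : IsControl C fun _ => 0 :=
  ⟨measurable_const, fun _ => by simpa using hC⟩

theorem IsControl.shift {C : ℝ} {u : ℝ → ℝ} (hu : IsControl C u) (d : ℝ) :
    IsControl C fun t => u (t + d) :=
  ⟨hu.measurable.comp (measurable_id.add_const d), fun _ => hu.bound _⟩

theorem IsControl.ite {C : ℝ} {u v : ℝ → ℝ} (hu : IsControl C u) (hv : IsControl C v) (m : ℝ) :
    IsControl C fun t => if t < m then u t else v t :=
  ⟨Measurable.ite measurableSet_Iio hu.measurable hv.measurable, fun t => by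
    by_cases h : t < m <;> simp [h, hu.bound, hv.bound]⟩

/-- Carathéodory solutions of `ζ̇ = f(ζ) + u b` on `[s, t]`. -/
structure IsArc (f : E → E) (b : E) (u : ℝ → ℝ) (ζ : ℝ → E) (s t : ℝ) : Prop where
  cont : ContinuousOn ζ (Icc s t)
  eq : ∀ r ∈ Icc s t, ζ r = ζ s + ∫ τ in s..r, (f (ζ τ) + u τ • b)

variable {f : E → E} {b : E} {u : ℝ → ℝ} {ζ : ℝ → E} {s t C : ℝ}

theorem IsArc.intervalIntegrable_drift (h : IsArc f b u ζ s t) (hf : Continuous f) {p q : ℝ}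
    (hp : p ∈ Icc s t) (hq : q ∈ Icc s t) :
    IntervalIntegrable (fun τ => f (ζ τ)) volume p q :=
  ((hf.comp_continuousOn h.cont).mono (uIcc_subset_Icc hp hq)).intervalIntegrable

theorem IsArc.intervalIntegrable (h : IsArc f b u ζ s t) (hf : Continuous f)
    (hu : IsControl C u) {p q : ℝ} (hp : p ∈ Icc s t) (hq : q ∈ Icc s t) :
    IntervalIntegrable (fun τ => f (ζ τ) + u τ • b) volume p q :=
  (h.intervalIntegrable_drift hf hp hq).add (hu.intervalIntegrable_smul b p q)

theorem IsArc.eq_between (h : IsArc f b u ζ s t) (hf : Continuous f) (hu : IsControl C u)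
    {p r : ℝ} (hp : p ∈ Icc s t) (hr : r ∈ Icc s t) :
    ζ r = ζ p + ∫ τ in p..r, (f (ζ τ) + u τ • b) := by
  have hs : s ∈ Icc s t := ⟨le_rfl, hr.1.trans hr.2⟩
  rw [h.eq r hr, h.eq p hp, add_assoc, intervalIntegral.integral_add_adjacent_intervals
    (h.intervalIntegrable hf hu hs hp) (h.intervalIntegrable hf hu hp hr)]

theorem IsArc.mono (h : IsArc f b u ζ s t) (hf : Continuous f) (hu : IsControl C u) {p q : ℝ}
    (hp : s ≤ p) (hq : q ≤ t) : IsArc f b u ζ p q :=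
  ⟨h.cont.mono (Icc_subset_Icc hp hq), fun _ hr => h.eq_between hf hu
    ⟨hp, hr.1.trans (hr.2.trans hq)⟩ ⟨hp.trans hr.1, hr.2.trans hq⟩⟩

theorem IsArc.congr {u' : ℝ → ℝ} {ζ' : ℝ → E} {f' : E → E} (h : IsArc f b u ζ s t)
    (hζ : ∀ r ∈ Icc s t, ζ' r = ζ r) (hu : ∀ r ∈ Ico s t, u' r = u r)
    (hf : ∀ r ∈ Icc s t, f' (ζ r) = f (ζ r)) : IsArc f' b u' ζ' s t := by
  refine ⟨h.cont.congr hζ, fun r hr => ?_⟩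
  rw [hζ r hr, hζ s ⟨le_rfl, hr.1.trans hr.2⟩, h.eq r hr]
  congr 1
  refine intervalIntegral.integral_congr_Ioo_of_le hr.1 fun τ hτ => ?_
  have hτ' : τ ∈ Icc s t := ⟨hτ.1.le, hτ.2.le.trans hr.2⟩
  simp only [hζ τ hτ', hf τ hτ', hu τ ⟨hτ.1.le, hτ.2.trans_le hr.2⟩]

theorem IsArc.shift (h : IsArc f b u ζ s t) (d : ℝ) :
    IsArc f b (fun r => u (r + d)) (fun r => ζ (r + d)) (s - d) (t - d) := by
  refine ⟨h.cont.comp (by fun_prop) fun r hr => ?_, fun r hr => ?_⟩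
  · exact ⟨by linarith [hr.1], by linarith [hr.2]⟩
  · have := intervalIntegral.integral_comp_add_right (a := s - d) (b := r)
      (fun τ => f (ζ τ) + u τ • b) d
    simp only [sub_add_cancel] at this ⊢
    rw [this]
    exact h.eq _ ⟨by linarith [hr.1], by linarith [hr.2]⟩

theorem IsArc.append {m : ℝ} {v : ℝ → ℝ} {η : ℝ → E} (h : IsArc f b u ζ s m)
    (h' : IsArc f b v η m t) (hsm : s ≤ m) (hmt : m ≤ t) (hm : η m = ζ m) (hf : Continuous f)
    (hu : IsControl C u) (hv : IsControl C v) :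
    IsArc f b (fun r => if r < m then u r else v r) (fun r => if r ≤ m then ζ r else η r) s t := by
  have h1 : IsArc f b (fun r => if r < m then u r else v r) (fun r => if r ≤ m then ζ r else η r)
      s m := h.congr (fun _ hr => by simp [hr.2]) (fun _ hr => by simp [hr.2]) (fun _ _ => rfl)
  have h2 : IsArc f b (fun r => if r < m then u r else v r) (fun r => if r ≤ m then ζ r else η r)
      m t := by
    refine h'.congr (fun r hr => ?_) (fun _ hr => by simp [hr.1]) (fun _ _ => rfl)
    rcases hr.1.eq_or_lt with rfl | hlt
    · simp [hm]
    · simp [hlt]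
  have hw := hu.ite hv m
  refine ⟨?_, fun r hr => ?_⟩
  · rw [← Icc_union_Icc_eq_Icc hsm hmt]
    exact h1.cont.union_of_isClosed h2.cont isClosed_Icc isClosed_Icc
  · rcases le_total r m with hrm | hrm
    · exact h1.eq r ⟨hr.1, hrm⟩
    · rw [h2.eq r ⟨hrm, hr.2⟩, h1.eq m ⟨hsm, le_rfl⟩, add_assoc,
        intervalIntegral.integral_add_adjacent_intervals
          (h1.intervalIntegrable hf hw ⟨le_rfl, hsm⟩ ⟨hsm, le_rfl⟩)
          (h2.intervalIntegrable hf hw ⟨le_rfl, hmt⟩ ⟨hrm, hr.2⟩)]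

theorem IsArc.dist_initial_le {M : ℝ} (h : IsArc f b u ζ s t) (hM : ∀ r ∈ Icc s t, ‖f (ζ r)‖ ≤ M)
    (hu : ∀ r, |u r| ≤ C) {r : ℝ} (hr : r ∈ Icc s t) :
    ‖ζ r - ζ s‖ ≤ (M + C * ‖b‖) * (r - s) := by
  rw [h.eq r hr, add_sub_cancel_left]
  have := intervalIntegral.norm_integral_le_of_norm_le_const (a := s) (b := r)
    (f := fun τ => f (ζ τ) + u τ • b) (C := M + C * ‖b‖) fun τ hτ => by
      rw [uIoc_of_le hr.1] at hτ
      refine (norm_add_le _ _).trans (add_le_add (hM τ ⟨hτ.1.le, hτ.2.trans hr.2⟩) ?_)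
      rw [norm_smul]
      exact mul_le_mul_of_nonneg_right (hu τ) (norm_nonneg b)
  rwa [abs_of_nonneg (sub_nonneg.2 hr.1)] at this

/-- Multiplying by a bump function gives a compactly supported C¹ field, which is globally Lipschitz
and bounded; arcs inside the ball do not see the change. -/
theorem exists_lipschitz_cutoff [FiniteDimensional ℝ E] (hf : ContDiff ℝ 1 f) (ρ : ℝ) :
    ∃ (K M : NNReal) (f' : E → E), LipschitzWith K f' ∧ (∀ x, ‖f' x‖ ≤ M) ∧
      ∀ x ∈ Metric.closedBall (0 : E) ρ, f' x = f x := by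
  let χ : ContDiffBump (0 : E) := ⟨max ρ 0 + 1, max ρ 0 + 2, by positivity, by linarith⟩
  have hχ : ContDiff ℝ 1 fun x => χ x • f x := χ.contDiff.smul hf
  have hc : HasCompactSupport fun x => χ x • f x := χ.hasCompactSupport.smul_right
  obtain ⟨K, hK⟩ := hχ.lipschitzWith_of_hasCompactSupport hc one_ne_zero
  obtain ⟨M, hM⟩ := hc.exists_bound_of_continuous hχ.continuous
  refine ⟨K, M.toNNReal, _, hK, fun x => (hM x).trans (Real.le_coe_toNNReal M), fun x hx => ?_⟩
  have : x ∈ Metric.closedBall (0 : E) χ.rIn :=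
    Metric.closedBall_subset_closedBall (by change ρ ≤ max ρ 0 + 1; linarith [le_max_left ρ 0]) hx
  simp [χ.one_of_mem_closedBall this]

variable [CompleteSpace E]

theorem IsArc.eq_add (h : IsArc f b u ζ s t) (hf : Continuous f) (hu : IsControl C u) {r : ℝ}
    (hr : r ∈ Icc s t) :
    ζ r = ζ s + (∫ τ in s..r, f (ζ τ)) + (∫ τ in s..r, u τ) • b := by
  have hs : s ∈ Icc s t := ⟨le_rfl, hr.1.trans hr.2⟩
  rw [h.eq r hr, intervalIntegral.integral_add (h.intervalIntegrable_drift hf hs hr)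
    (hu.intervalIntegrable_smul b s r), intervalIntegral.integral_smul_const, add_assoc]

/-- Since the input field is constant, subtracting the primitive of the control turns a Carathéodory
solution into a classical one of an ODE with continuous right-hand side. This makes Grönwall and
Picard–Lindelöf available. -/
theorem IsArc.hasDerivWithinAt (h : IsArc f b u ζ s t) (hf : Continuous f) (hu : IsControl C u)
    {r : ℝ} (hr : r ∈ Icc s t) :
    HasDerivWithinAt (fun r => ζ r - (∫ τ in s..r, u τ) • b) (f (ζ r)) (Icc s t) r := by
  have hs : s ∈ Icc s t := ⟨le_rfl, hr.1.trans hr.2⟩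
  have key := ODE.hasDerivWithinAt_picard_Icc (f := fun _ x => f x) (u := univ) hs
    (by exact (hf.comp continuous_snd).continuousOn) h.cont (fun _ _ => mem_univ _) (ζ s) hr
  refine key.congr (fun q hq => ?_) ?_
  · rw [h.eq_add hf hu hq]; simp
  · rw [h.eq_add hf hu hr]; simp

theorem IsArc.dist_le {K : NNReal} (hK : LipschitzWith K f) {η : ℝ → E} (hu : IsControl C u)
    (h : IsArc f b u ζ s t) (h' : IsArc f b u η s t) {r : ℝ} (hr : r ∈ Icc s t) :
    dist (ζ r) (η r) ≤ dist (ζ s) (η s) * Real.exp (K * (r - s)) := by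
  have hU := hu.continuous_primitive s
  have hst : s ≤ t := hr.1.trans hr.2
  have key : ∀ θ : ℝ → E, IsArc f b u θ s t → ∀ q ∈ Ico s t,
      HasDerivWithinAt (fun r => θ r - (∫ τ in s..r, u τ) • b)
        ((fun r x => f (x + (∫ τ in s..r, u τ) • b)) q (θ q - (∫ τ in s..q, u τ) • b))
        (Ici q) q := by
    intro θ hθ q hq
    simp only [sub_add_cancel]
    exact (hθ.hasDerivWithinAt hK.continuous hu ⟨hq.1, hq.2.le⟩).mono_of_mem_nhdsWithin
      (mem_of_superset (Icc_mem_nhdsGE hq.2) (Icc_subset_Icc_left hq.1))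
  have main := dist_le_of_trajectories_ODE (K := K)
    (v := fun r x => f (x + (∫ τ in s..r, u τ) • b))
    (fun r => by
      refine LipschitzWith.of_dist_le_mul fun x y => ?_
      simpa using hK.dist_le_mul (x + (∫ τ in s..r, u τ) • b) (y + (∫ τ in s..r, u τ) • b))
    (h.cont.sub (hU.smul continuous_const).continuousOn) (key ζ h)
    (h'.cont.sub (hU.smul continuous_const).continuousOn) (key η h') le_rfl r hr
  simpa using main

theorem exists_isArc_of_lipschitzWith {K M : NNReal} (hK : LipschitzWith K f)
    (hM : ∀ x, ‖f x‖ ≤ M) (b : E) (hu : IsControl C u) (z : E) (hst : s ≤ t) :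
    ∃ ζ, IsArc f b u ζ s t ∧ ζ s = z := by
  have hU := hu.continuous_primitive s
  -- The global speed bound M keeps solutions within distance M (t - s), so existence holds on the
  -- whole interval.
  have hPL : IsPicardLindelof (fun r x => f (x + (∫ τ in s..r, u τ) • b))
      (⟨s, le_rfl, hst⟩ : Icc s t) z (M * (t - s).toNNReal) 0 M K := by
    refine ⟨fun r _ => LipschitzWith.lipschitzOnWith ?_, fun x _ => ?_, fun r _ x _ => hM _, ?_⟩
    · refine LipschitzWith.of_dist_le_mul fun x y => ?_
      simpa using hK.dist_le_mul (x + (∫ τ in s..r, u τ) • b) (y + (∫ τ in s..r, u τ) • b)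
    · exact (hK.continuous.comp (continuous_const.add (hU.smul continuous_const))).continuousOn
    · simp [hst]
  obtain ⟨α, hα, hα'⟩ := hPL.exists_eq_forall_mem_Icc_hasDerivWithinAt₀
  have hα : α s = z := hα
  have hαc : ContinuousOn α (Icc s t) := fun r hr => (hα' r hr).continuousWithinAt
  refine ⟨fun r => α r + (∫ τ in s..r, u τ) • b,
    ⟨hαc.add (hU.smul continuous_const).continuousOn, fun r hr => ?_⟩, by simp [hα]⟩
  have hcont : ContinuousOn (fun τ => f (α τ + (∫ τ in s..τ, u τ) • b)) (Icc s t) :=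
    hK.continuous.comp_continuousOn (hαc.add (hU.smul continuous_const).continuousOn)
  have hint : IntervalIntegrable (fun τ => f (α τ + (∫ τ in s..τ, u τ) • b)) volume s r :=
    (hcont.mono (uIcc_subset_Icc ⟨le_rfl, hst⟩ hr)).intervalIntegrable
  have hftc := intervalIntegral.integral_eq_sub_of_hasDeriv_right_of_le hr.1
    (hαc.mono (Icc_subset_Icc_right hr.2)) (fun q hq =>
      (hα' q ⟨hq.1.le, hq.2.le.trans hr.2⟩).mono_of_mem_nhdsWithin
        (mem_of_superset (Ioo_mem_nhdsGT (hq.2.trans_le hr.2))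
          (fun p hp => ⟨hq.1.le.trans hp.1.le, hp.2.le⟩))) hint
  rw [intervalIntegral.integral_add hint (hu.intervalIntegrable_smul b s r), hftc,
    intervalIntegral.integral_smul_const]
  simp only [intervalIntegral.integral_same, zero_smul, add_zero]
  abel

variable [FiniteDimensional ℝ E]

theorem IsArc.eqOn (hf : ContDiff ℝ 1 f) {η : ℝ → E} (hu : IsControl C u)
    (h : IsArc f b u ζ s t) (h' : IsArc f b u η s t) (hs : ζ s = η s) : EqOn ζ η (Icc s t) := by
  obtain ⟨ρ, hρ⟩ := (isCompact_Icc.image_of_continuousOn h.cont).isBounded.subset_closedBall 0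
  obtain ⟨ρ', hρ'⟩ := (isCompact_Icc.image_of_continuousOn h'.cont).isBounded.subset_closedBall 0
  obtain ⟨K, M, f', hK, -, hff'⟩ := exists_lipschitz_cutoff hf (max ρ ρ')
  have h1 : IsArc f' b u ζ s t := h.congr (fun _ _ => rfl) (fun _ _ => rfl) fun r hr =>
    hff' _ (Metric.closedBall_subset_closedBall (le_max_left _ _) (hρ ⟨r, hr, rfl⟩))
  have h2 : IsArc f' b u η s t := h'.congr (fun _ _ => rfl) (fun _ _ => rfl) fun r hr =>
    hff' _ (Metric.closedBall_subset_closedBall (le_max_right _ _) (hρ' ⟨r, hr, rfl⟩))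
  intro r hr
  have := h1.dist_le hK hu h2 hr
  rw [hs, dist_self, zero_mul] at this
  exact dist_le_zero.1 this

/-- Arcs through nearby initial states stay close. -/
theorem IsArc.eventually_exists (hf : ContDiff ℝ 1 f) (hu : IsControl C u)
    (h : IsArc f b u ζ s t) (hst : s ≤ t) {δ : ℝ} (hδ : 0 < δ) :
    ∀ᶠ w in 𝓝 (ζ s), ∃ η, IsArc f b u η s t ∧ η s = w ∧ ∀ r ∈ Icc s t, dist (η r) (ζ r) < δ := by
  obtain ⟨ρ, hρ⟩ := (isCompact_Icc.image_of_continuousOn h.cont).isBounded.subset_closedBall 0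
  -- The margin δ lets the perturbed arcs stay where the cut-off field agrees with f.
  obtain ⟨K, M, f', hK, hM, hff'⟩ := exists_lipschitz_cutoff hf (ρ + δ)
  have h1 : IsArc f' b u ζ s t := h.congr (fun _ _ => rfl) (fun _ _ => rfl) fun r hr =>
    hff' _ (Metric.closedBall_subset_closedBall (by linarith) (hρ ⟨r, hr, rfl⟩))
  have hpos : 0 < δ * Real.exp (-(K * (t - s))) := by positivity
  filter_upwards [Metric.ball_mem_nhds (ζ s) hpos] with w hw
  obtain ⟨η, hη, hηs⟩ := exists_isArc_of_lipschitzWith hK hM b hu w hst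
  have hd : ∀ r ∈ Icc s t, dist (η r) (ζ r) < δ := fun r hr => by
    refine (hη.dist_le hK hu h1 hr).trans_lt ?_
    have h2 : dist (η s) (ζ s) < δ * Real.exp (-(K * (t - s))) := by rw [hηs]; exact hw
    calc dist (η s) (ζ s) * Real.exp (K * (r - s))
        ≤ dist (η s) (ζ s) * Real.exp (K * (t - s)) := by
          have := hr.2
          gcongr
      _ < δ * Real.exp (-(K * (t - s))) * Real.exp (K * (t - s)) := by gcongr
      _ = δ := by rw [mul_assoc, ← Real.exp_add]; simp
  refine ⟨η, hη.congr (fun _ _ => rfl) (fun _ _ => rfl) fun r hr => (hff' _ ?_).symm, hηs, hd⟩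
  have h3 := hρ ⟨r, hr, rfl⟩
  rw [mem_closedBall_zero_iff] at h3 ⊢
  have h4 := norm_le_norm_add_norm_sub' (η r) (ζ r)
  have h5 := hd r hr
  rw [dist_eq_norm] at h5
  linarith

/-- Short arcs exist, with a uniform speed bound, for all controls with a common bound. -/
theorem exists_isArc_short (hf : ContDiff ℝ 1 f) (b z : E) (hC : 0 ≤ C) :
    ∃ T > 0, ∃ M > 0, ∀ u, IsControl C u → ∃ ζ, IsArc f b u ζ 0 T ∧ ζ 0 = z ∧
      ∀ r ∈ Icc 0 T, ‖ζ r - z‖ ≤ M * r := by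
  obtain ⟨K, M, f', hK, hM, hff'⟩ := exists_lipschitz_cutoff hf (‖z‖ + 1)
  -- At speed at most L, the time 1 / L does not suffice to leave the unit ball about z, where the
  -- cut-off is invisible; the summand 1 makes L positive.
  set L : ℝ := M + C * ‖b‖ + 1 with hL
  have hL0 : 0 < L := by positivity
  refine ⟨1 / L, by positivity, L, hL0, fun u hu => ?_⟩
  have hT : (0 : ℝ) ≤ 1 / L := by positivity
  obtain ⟨ζ, hζ, hζ0⟩ := exists_isArc_of_lipschitzWith hK hM b hu z hT
  have hd : ∀ r ∈ Icc 0 (1 / L), ‖ζ r - z‖ ≤ L * r := fun r hr => by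
    have := hζ.dist_initial_le (fun r _ => hM (ζ r)) hu.bound hr
    rw [hζ0, sub_zero] at this
    refine this.trans (mul_le_mul_of_nonneg_right (by linarith) hr.1)
  refine ⟨ζ, hζ.congr (fun _ _ => rfl) (fun _ _ => rfl) fun r hr => (hff' _ ?_).symm, hζ0, hd⟩
  have h1 : L * r ≤ 1 := by
    calc L * r ≤ L * (1 / L) := by gcongr; exact hr.2
      _ = 1 := by field_simp
  rw [mem_closedBall_zero_iff]
  have h4 := norm_le_norm_add_norm_sub' (ζ r) z
  linarith [hd r hr]

end Arcs

/-! ### Steering to small values of V -/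

section Reachability

variable {E : Type*} [NormedAddCommGroup E] [NormedSpace ℝ E]

/-- `z` can be steered to `z'` by a control bounded by `C` inside the sublevel set `{V < B}`. -/
def Steers (f : E → E) (b : E) (V : E → ℝ) (C B : ℝ) (z z' : E) : Prop :=
  ∃ T, 0 ≤ T ∧ ∃ u ζ, IsControl C u ∧ IsArc f b u ζ 0 T ∧ ζ 0 = z ∧ ζ T = z' ∧
    ∀ t ∈ Icc 0 T, V (ζ t) < B

/-- States of `{V < c}` other than `0` can be steered to strictly smaller values of `V`, with
arbitrarily small overshoot. -/
def CanDecrease (f : E → E) (b : E) (V : E → ℝ) (C c : ℝ) : Prop :=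
  ∀ z, z ≠ 0 → V z < c → ∀ η > 0, ∃ z', V z' < V z ∧ Steers f b V C (V z + η) z z'

variable {f : E → E} {b : E} {V : E → ℝ} {C B c : ℝ}

/-- Concatenation of an arc on `[0, T]` with an arc on `[0, T']`. -/
theorem IsArc.append_shift {T T' : ℝ} {u v : ℝ → ℝ} {ζ η : ℝ → E} (hf : Continuous f)
    (hu : IsControl C u) (hv : IsControl C v) (h : IsArc f b u ζ 0 T) (h' : IsArc f b v η 0 T')
    (hT : 0 ≤ T) (hT' : 0 ≤ T') (he : η 0 = ζ T) :
    ∃ w θ, IsControl C w ∧ IsArc f b w θ 0 (T + T') ∧ (∀ t ≤ T, θ t = ζ t) ∧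
      ∀ t, T ≤ t → θ t = η (t - T) := by
  have h2 := h'.shift (-T)
  simp only [sub_neg_eq_add, zero_add] at h2
  rw [add_comm T' T] at h2
  refine ⟨_, _, hu.ite (hv.shift (-T)) T, h.append h2 hT (by linarith) (by simp [he]) hf hu
    (hv.shift (-T)), fun t ht => by simp [ht], fun t ht => ?_⟩
  rcases ht.eq_or_lt with rfl | hlt
  · simp [he]
  · simp [hlt, sub_eq_add_neg]

theorem Steers.trans (hf : Continuous f) {z z' z'' : E} (h : Steers f b V C B z z')
    (h' : Steers f b V C B z' z'') : Steers f b V C B z z'' := by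
  obtain ⟨T, hT, u, ζ, hu, hζ, rfl, rfl, hB⟩ := h
  obtain ⟨T', hT', v, η, hv, hη, he, rfl, hB'⟩ := h'
  obtain ⟨w, θ, hw, hθ, h1, h2⟩ := IsArc.append_shift hf hu hv hζ hη hT hT' he
  refine ⟨T + T', by positivity, w, θ, hw, hθ, h1 0 hT, ?_, fun t ht => ?_⟩
  · rw [h2 _ (by linarith)]; simp
  · rcases le_total t T with htT | htT
    · rw [h1 t htT]; exact hB t ⟨ht.1, htT⟩
    · rw [h2 t htT]; exact hB' _ ⟨by linarith, by linarith [ht.2]⟩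

variable [CompleteSpace E] [FiniteDimensional ℝ E]

/-- Arcs staying in an open set persist under perturbation of the initial state. -/
theorem IsArc.eventually_exists_mem {u : ℝ → ℝ} {ζ : ℝ → E} {s t : ℝ} (hf : ContDiff ℝ 1 f)
    (hu : IsControl C u) (h : IsArc f b u ζ s t) (hst : s ≤ t) {S S' : Set E} (hS : IsOpen S)
    (hS' : IsOpen S') (hmem : ∀ r ∈ Icc s t, ζ r ∈ S) (hmem' : ζ t ∈ S') :
    ∀ᶠ w in 𝓝 (ζ s), ∃ η, IsArc f b u η s t ∧ η s = w ∧ (∀ r ∈ Icc s t, η r ∈ S) ∧ η t ∈ S' := by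
  obtain ⟨δ, hδ, hδS⟩ := (isCompact_Icc.image_of_continuousOn h.cont).exists_thickening_subset_open
    hS (by rintro _ ⟨r, hr, rfl⟩; exact hmem r hr)
  obtain ⟨δ', hδ', hδS'⟩ := Metric.isOpen_iff.1 hS' _ hmem'
  filter_upwards [h.eventually_exists hf hu hst (lt_min hδ hδ')] with w ⟨η, hη, hw, hd⟩
  refine ⟨η, hη, hw, fun r hr => hδS ?_, hδS' ?_⟩
  · exact Metric.mem_thickening_iff.2 ⟨ζ r, ⟨r, hr, rfl⟩, (hd r hr).trans_le (min_le_left _ _)⟩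
  · exact (hd t ⟨hst, le_rfl⟩).trans_le (min_le_right _ _)

omit [CompleteSpace E] [FiniteDimensional ℝ E] in
theorem IsLyapunovCandidate.nonneg (hL : IsLyapunovCandidate V) (z : E) : 0 ≤ V z := by
  rcases eq_or_ne z 0 with rfl | hz
  · exact hL.zero.ge
  · exact (hL.pos z hz).le

omit [CompleteSpace E] [FiniteDimensional ℝ E] in
theorem IsLyapunovCandidate.isCompact_sublevel (hL : IsLyapunovCandidate V) (B : ℝ) :
    IsCompact {w | V w ≤ B} := by
  obtain ⟨K, hK, hKV⟩ := mem_cocompact.1 (hL.proper.eventually_gt_atTop B)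
  refine hK.of_isClosed_subset (isClosed_le hL.smooth.continuous continuous_const) fun w hw => ?_
  by_contra hwK
  exact (not_lt.2 (show V w ≤ B from hw)) (hKV hwK)

omit [CompleteSpace E] [FiniteDimensional ℝ E] in
theorem IsLyapunovCandidate.exists_sublevel_subset (hL : IsLyapunovCandidate V) {S : Set E}
    (hS : S ∈ 𝓝 (0 : E)) : ∃ ε > 0, {w | V w < ε} ⊆ S := by
  have hc : IsCompact ({w | V w ≤ 1} \ interior S) := (hL.isCompact_sublevel 1).diff isOpen_interior
  rcases ({w | V w ≤ 1} \ interior S).eq_empty_or_nonempty with he | hne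
  · refine ⟨1, one_pos, fun w hw => interior_subset (sdiff_eq_empty.1 he ?_)⟩
    exact (show V w < 1 from hw).le
  · obtain ⟨w, hw, hmin⟩ := hc.exists_isMinOn hne hL.smooth.continuous.continuousOn
    have hw0 : w ≠ 0 := by
      rintro rfl
      exact hw.2 (mem_interior_iff_mem_nhds.2 hS)
    refine ⟨min 1 (V w), lt_min one_pos (hL.pos w hw0), fun x hx => ?_⟩
    by_contra hxS
    have hx' : V x < 1 ∧ V x < V w := lt_min_iff.1 hx
    exact (not_le.2 hx'.2) (hmin ⟨hx'.1.le, fun h => hxS (interior_subset h)⟩)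

/-- A minimizer w of V on the closure of the reachable set would otherwise be nonzero, so V could be
lowered from w. The lowering arc persists from reachable points near w, which yields a reachable
point with V below the minimum. -/
theorem exists_steers_lt (hf : ContDiff ℝ 1 f) (hL : IsLyapunovCandidate V)
    (hC : 0 ≤ C) (hdec : CanDecrease f b V C c) (hBc : B ≤ c) {z : E} (hz : V z < B) {ε : ℝ}
    (hε : 0 < ε) : ∃ z', Steers f b V C B z z' ∧ V z' < ε := by
  by_contra! hcon
  have hV := hL.smooth.continuous
  set R := {z' | Steers f b V C B z z'} with hR
  have hzR : z ∈ R := ⟨0, le_rfl, fun _ => 0, fun _ => z, IsControl.zero hC,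
    ⟨continuousOn_const, fun r hr => by
      have : r = 0 := le_antisymm hr.2 hr.1
      simp [this]⟩, rfl, rfl, fun _ _ => hz⟩
  have hRB : R ⊆ {w | V w ≤ B} := by
    rintro _ ⟨T, hT, u, ζ, -, -, -, rfl, hB⟩
    exact (hB T ⟨hT, le_rfl⟩).le
  have hcl : IsCompact (closure R) :=
    (hL.isCompact_sublevel B).of_isClosed_subset isClosed_closure
      (closure_minimal hRB (isClosed_le hV continuous_const))
  obtain ⟨w, hw, hmin⟩ := hcl.exists_isMinOn ⟨z, subset_closure hzR⟩ hV.continuousOn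
  have hwz : V w ≤ V z := hmin (subset_closure hzR)
  have hwε : ε ≤ V w := by
    have : closure R ⊆ {w | ε ≤ V w} :=
      closure_minimal (fun w hw => hcon w hw) (isClosed_le continuous_const hV)
    exact this hw
  have hw0 : w ≠ 0 := by rintro rfl; linarith [hL.zero]
  -- The allowed overshoot is exactly the room left below B.
  obtain ⟨w', hw', T, hT, u, ζ, hu, hζ, h0, hTw, hB⟩ :=
    hdec w hw0 (by linarith) (B - V w) (by linarith)
  have hev := hζ.eventually_exists_mem hf hu hT (S := {x | V x < B}) (S' := {x | V x < V w})
    (isOpen_lt hV continuous_const) (isOpen_lt hV continuous_const)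
    (fun r hr => by simpa using hB r hr) (by simpa [hTw] using hw')
  rw [h0] at hev
  obtain ⟨x, ⟨η, hη, hηx, hηB, hηT⟩, hxR⟩ := mem_closure_iff_nhds.1 hw _ hev
  have : Steers f b V C B z (η T) :=
    Steers.trans hf.continuous hxR ⟨T, hT, u, η, hu, hη, hηx, rfl, hηB⟩
  exact (not_le.2 (show V (η T) < V w from hηT)) (hmin (subset_closure this))

/-- After a suitable time `V` is small, and it stays small for the time `M` with zero control. -/
theorem exists_arc_small (hf : ContDiff ℝ 1 f) (hf0 : f 0 = 0) (hL : IsLyapunovCandidate V)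
    (hC : 0 ≤ C)
    (hdec : CanDecrease f b V C c) (hBc : B ≤ c) {z : E} (hz : V z < B) {ε M : ℝ}
    (hε : 0 < ε) (hM : 0 ≤ M) :
    ∃ T, 0 ≤ T ∧ ∃ u ζ, IsControl C u ∧ IsArc f b u ζ 0 (T + M) ∧ ζ 0 = z ∧
      (∀ t ∈ Icc 0 (T + M), V (ζ t) < B) ∧ ∀ t ∈ Icc T (T + M), V (ζ t) < ε := by
  -- The equilibrium is an arc with zero control, so arcs starting close enough to it stay small for
  -- the time M.
  have hzero : IsArc f b (fun _ => 0) (fun _ => (0 : E)) 0 M :=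
    ⟨continuousOn_const, fun r _ => by simp [hf0]⟩
  have hB : 0 < B := (hL.nonneg z).trans_lt hz
  have hV := hL.smooth.continuous
  have hev := hzero.eventually_exists_mem hf (IsControl.zero hC) hM
    (S := {x | V x < min B ε}) (S' := univ) (isOpen_lt hV continuous_const) isOpen_univ
    (fun r _ => by simp [hL.zero, hB, hε]) (mem_univ _)
  obtain ⟨ε', hε', hsmall⟩ := hL.exists_sublevel_subset hev
  obtain ⟨z', ⟨T, hT, u, ζ, hu, hζ, h0, hTz, hζB⟩, hz'⟩ :=
    exists_steers_lt hf hL hC hdec hBc hz hε'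
  obtain ⟨η, hη, hη0, hηB, -⟩ := hsmall hz'
  obtain ⟨w, θ, hw, hθ, h1, h2⟩ := IsArc.append_shift hf.continuous hu (IsControl.zero hC) hζ hη
    hT hM (hη0.trans hTz.symm)
  have hlate : ∀ t ∈ Icc T (T + M), V (θ t) < min B ε := fun t ht => by
    rw [h2 t ht.1]; exact hηB _ ⟨by linarith [ht.1], by linarith [ht.2]⟩
  refine ⟨T, hT, w, θ, hw, hθ, (h1 0 hT).trans h0, fun t ht => ?_,
    fun t ht => (hlate t ht).trans_le (min_le_right _ _)⟩
  rcases le_total t T with htT | htT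
  · rw [h1 t htT]; exact hζB t ⟨ht.1, htT⟩
  · exact (hlate t ⟨htT, ht.2⟩).trans_le (min_le_left _ _)

end Reachability

/-! ### Plans between sampling times and the choice of a best one -/

section Selection

variable {E : Type*} [NormedAddCommGroup E] [NormedSpace ℝ E]

/-- An open-loop control on `[T j, T e]` which starts at `z ≠ 0` at the time `T j` and at least
halves `V`, without doubling it or leaving `{V < c}` on the way. -/
structure Plan (f : E → E) (b : E) (V : E → ℝ) (C c : ℝ) (T : ℕ → ℝ) where
  j : ℕ
  e : ℕ
  z : E
  u : ℝ → ℝ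
  ζ : ℝ → E
  lt : j < e
  ne : z ≠ 0
  control : IsControl C u
  arc : IsArc f b u ζ (T j) (T e)
  start : ζ (T j) = z
  bound : ∀ t ∈ Icc (T j) (T e), V (ζ t) < min (2 * V z) c
  finish : V (ζ (T e)) < V z / 2

variable {f : E → E} {b : E} {V : E → ℝ} {C c : ℝ} {T : ℕ → ℝ}

namespace Plan

/-- The dyadic level of the initial value of `V`. -/
noncomputable def level (p : Plan f b V C c T) : ℤ := Int.log 2 (V p.z)

/-- The plan `p` is under way at the time `T i`, in the state `w`. -/
structure Passes (p : Plan f b V C c T) (i : ℕ) (w : E) : Prop where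
  le : p.j ≤ i
  lt : i < p.e
  eq : p.ζ (T i) = w

/-- Among the plans passing through `w` at the time `T i`, the plan `p` has the lowest level and,
subject to that, the earliest end. -/
structure IsBest (p : Plan f b V C c T) (i : ℕ) (w : E) : Prop where
  passes : p.Passes i w
  best : ∀ q : Plan f b V C c T, q.Passes i w →
    p.level < q.level ∨ p.level = q.level ∧ p.e ≤ q.e

theorem lt_level (p : Plan f b V C c T) {t : ℝ}
    (ht : t ∈ Icc (T p.j) (T p.e)) : V (p.ζ t) < 4 * 2 ^ p.level := by
  have h1 : V p.z < 2 ^ (p.level + 1) := by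
    exact_mod_cast Int.lt_zpow_succ_log_self (b := 2) (by norm_num) (V p.z)
  rw [zpow_add_one₀ (by norm_num)] at h1
  have h2 := (p.bound t ht).trans_le (min_le_left _ _)
  linarith

theorem exists_isBest (hL : IsLyapunovCandidate V) (hT : StrictMono T) {i : ℕ} {w : E}
    (hw : w ≠ 0) (h : ∃ p : Plan f b V C c T, p.Passes i w) :
    ∃ p : Plan f b V C c T, p.IsBest i w := by
  classical
  obtain ⟨p₀, hp₀⟩ := h
  obtain ⟨l, ⟨p₁, hp₁, rfl⟩, hl⟩ := Int.exists_least_of_bdd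
    (P := fun l => ∃ p : Plan f b V C c T, p.Passes i w ∧ p.level = l)
    -- Levels are bounded below: a plan through w has not doubled V, so its initial value exceeds V
    -- w / 2.
    ⟨Int.log 2 (V w / 2), by
      rintro _ ⟨p, hp, rfl⟩
      refine Int.log_mono_right (by linarith [hL.pos w hw]) ?_
      have := p.bound (T i) ⟨hT.monotone hp.le, hT.monotone hp.lt.le⟩
      rw [hp.eq] at this
      linarith [this.trans_le (min_le_left _ _)]⟩
    ⟨_, p₀, hp₀, rfl⟩
  have hex : ∃ e, ∃ p : Plan f b V C c T, p.Passes i w ∧ p.level = p₁.level ∧ p.e = e :=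
    ⟨_, p₁, hp₁, rfl, rfl⟩
  obtain ⟨p, hp, hpl, hpe⟩ := Nat.find_spec hex
  refine ⟨p, hp, fun q hq => ?_⟩
  rcases (hl _ ⟨q, hq, rfl⟩).lt_or_eq with hlt | heq
  · exact Or.inl (hpl ▸ hlt)
  · exact Or.inr ⟨hpl.trans heq, hpe ▸ Nat.find_min' hex ⟨q, hq, heq.symm, rfl⟩⟩

/-- A plan freshly started at w competes with p, and its level is the dyadic logarithm of V w. -/
theorem IsBest.level_le (hL : IsLyapunovCandidate V) {p : Plan f b V C c T} {i : ℕ} {w : E}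
    (h : p.IsBest i w) {q : Plan f b V C c T} (hq : q.j = i) (hz : q.z = w) :
    (2 : ℝ) ^ p.level ≤ V w := by
  have hle : p.level ≤ q.level := by
    rcases h.best q ⟨hq.le, hq ▸ q.lt, by rw [← hq, q.start, hz]⟩ with h | h
    · exact h.le
    · exact h.1.le
  have h1 : (2 : ℝ) ^ q.level ≤ V q.z := by
    exact_mod_cast Int.zpow_log_le_self (b := 2) (by norm_num) (hL.pos _ q.ne)
  rw [← hz]
  exact (zpow_le_zpow_right₀ (by norm_num) hle).trans h1

/-- Either p is still under way and is itself a candidate at the next sample, or it has just ended.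
In the latter case V has more than halved, and a fresh plan has strictly lower level. -/
theorem IsBest.step (hL : IsLyapunovCandidate V) {p p' : Plan f b V C c T} {i : ℕ} {w w' : E}
    (h : p.IsBest i w) (hw : p.ζ (T (i + 1)) = w') (h' : p'.IsBest (i + 1) w')
    (hfresh : ∃ q : Plan f b V C c T, q.j = i + 1 ∧ q.z = w') :
    p'.level < p.level ∨ p'.level = p.level ∧ p'.e ≤ p.e := by
  rcases (Nat.succ_le_of_lt h.passes.lt).lt_or_eq with hlt | heq
  · exact h'.best p ⟨h.passes.le.trans i.le_succ, hlt, hw⟩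
  · left
    obtain ⟨q, hq, hz⟩ := hfresh
    have h1 := h'.level_le hL hq hz
    have h2 := p.finish
    rw [← heq, hw] at h2
    have h3 : V p.z < 2 ^ (p.level + 1) := by
      exact_mod_cast Int.lt_zpow_succ_log_self (b := 2) (by norm_num) (V p.z)
    rw [zpow_add_one₀ (by norm_num)] at h3
    have h4 : (2 : ℝ) ^ p'.level < 2 ^ p.level := by linarith
    exact (zpow_lt_zpow_iff_right₀ (by norm_num)).1 h4

end Plan

variable [CompleteSpace E] [FiniteDimensional ℝ E]

/-- The steering time S need not match the partition. The state therefore coasts with zero control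
for up to one maximal step M, until the next sampling time. -/
theorem exists_plan (hf : ContDiff ℝ 1 f) (hf0 : f 0 = 0) (hL : IsLyapunovCandidate V)
    (hC : 0 ≤ C) (hdec : CanDecrease f b V C c) (hT : IsPartition T) (j : ℕ) {z : E} (hz : z ≠ 0)
    (hzc : V z < c) : ∃ p : Plan f b V C c T, p.j = j ∧ p.z = z := by
  obtain ⟨M, hM⟩ := hT.steps
  have hpos := hL.pos z hz
  have hM0 : 0 ≤ M := (sub_nonneg.2 (hT.mono.monotone (Nat.le_succ 0))).trans (hM 0)
  obtain ⟨S, hS, u, ζ, hu, hζ, h0, hB, hsmall⟩ := exists_arc_small hf hf0 hL hC hdec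
    (min_le_right (2 * V z) c) (z := z) (lt_min (by linarith) hzc) (half_pos hpos) hM0
  have hex : ∃ e, j < e ∧ T j + S ≤ T e :=
    ((eventually_gt_atTop j).and (hT.unbounded.eventually_ge_atTop (T j + S))).exists
  classical
  set e := Nat.find hex with he
  obtain ⟨hje, hSe⟩ := Nat.find_spec hex
  rw [← he] at hje hSe
  -- The index before the first admissible e has time at most T j + S, and one step adds at most M.
  have heM : T e ≤ T j + (S + M) := by
    obtain ⟨d, hd⟩ : ∃ d, e = d + 1 := ⟨e - 1, by omega⟩
    have hdT : T d ≤ T j + S := by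
      by_contra hcon
      have h1 : ¬ (j < d ∧ T j + S ≤ T d) := Nat.find_min hex (by omega)
      have h2 : d ≤ j := by
        by_contra hjd
        exact h1 ⟨by omega, (not_le.1 hcon).le⟩
      exact hcon ((hT.mono.monotone h2).trans (by linarith))
    have := hM d
    rw [hd]; linarith
  have harc : IsArc f b (fun t => u (t + -T j)) (fun t => ζ (t + -T j)) (T j) (T e) := by
    have := hζ.shift (-T j)
    exact this.mono hf.continuous (hu.shift _) (by simp) (by linarith)
  refine ⟨⟨j, e, z, _, _, hje, hz, hu.shift _, harc, by simp [h0], fun t ht => ?_, ?_⟩, rfl, rfl⟩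
  · exact hB _ ⟨by linarith [ht.1], by linarith [ht.2]⟩
  · exact hsmall _ ⟨by linarith, by linarith⟩

end Selection

/-! ### From plans to a stabilizing sampled-data feedback -/

section Feedback

variable {E : Type*} [NormedAddCommGroup E] [NormedSpace ℝ E]

/-- `u i w` is a control on `[T i, T (i + 1)]` for the state `w` at the time `T i`, with the arc
`η i w`: it follows a best plan. -/
structure IsSelection (f : E → E) (b : E) (V : E → ℝ) (C c : ℝ) (T : ℕ → ℝ)
    (u : ℕ → E → ℝ → ℝ) (η : ℕ → E → ℝ → E) : Prop where
  control : ∀ i w, IsControl C (u i w)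
  arc : ∀ i w, V w < c → IsArc f b (u i w) (η i w) (T i) (T (i + 1))
  start : ∀ i w, V w < c → η i w (T i) = w
  bound : ∀ i w, V w < c → ∀ t ∈ Icc (T i) (T (i + 1)), V (η i w t) < c
  zero : ∀ i t, η i 0 t = 0
  best : ∀ i w, w ≠ 0 → V w < c → ∃ p : Plan f b V C c T, p.IsBest i w ∧
    ∀ t ∈ Icc (T i) (T (i + 1)), η i w t = p.ζ t

variable {f : E → E} {b : E} {V : E → ℝ} {C c : ℝ} {T : ℕ → ℝ}
  {u : ℕ → E → ℝ → ℝ} {η : ℕ → E → ℝ → E}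

theorem exists_isSelection (hf : Continuous f) (hf0 : f 0 = 0) (hL : IsLyapunovCandidate V)
    (hC : 0 ≤ C) (hc : 0 < c) (hT : StrictMono T)
    (hplan : ∀ i w, w ≠ 0 → V w < c → ∃ p : Plan f b V C c T, p.j = i ∧ p.z = w) :
    ∃ u η, IsSelection f b V C c T u η := by
  have key : ∀ (i : ℕ) (w : E), ∃ (v : ℝ → ℝ) (ζ : ℝ → E), IsControl C v ∧
      (V w < c → IsArc f b v ζ (T i) (T (i + 1))) ∧ (V w < c → ζ (T i) = w) ∧
      (V w < c → ∀ t ∈ Icc (T i) (T (i + 1)), V (ζ t) < c) ∧ (w = 0 → ∀ t, ζ t = 0) ∧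
      (w ≠ 0 → V w < c → ∃ p : Plan f b V C c T, p.IsBest i w ∧
        ∀ t ∈ Icc (T i) (T (i + 1)), ζ t = p.ζ t) := by
    intro i w
    by_cases hw : w ≠ 0 ∧ V w < c
    · obtain ⟨q, hq, hqz⟩ := hplan i w hw.1 hw.2
      obtain ⟨p, hp⟩ := Plan.exists_isBest hL hT hw.1
        ⟨q, hq.le, hq ▸ q.lt, by rw [← hq, q.start, hqz]⟩
      have h1 : T p.j ≤ T i := hT.monotone hp.passes.le
      have h2 : T (i + 1) ≤ T p.e := hT.monotone hp.passes.lt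
      exact ⟨p.u, p.ζ, p.control, fun _ => p.arc.mono hf p.control h1 h2, fun _ => hp.passes.eq,
        fun _ t ht => (p.bound t ⟨h1.trans ht.1, ht.2.trans h2⟩).trans_le (min_le_right _ _),
        fun h => absurd h hw.1, fun _ _ => ⟨p, hp, fun _ _ => rfl⟩⟩
    · have hw0 : V w < c → w = 0 := fun h => by_contra fun h' => hw ⟨h', h⟩
      exact ⟨fun _ => 0, fun _ => 0, IsControl.zero hC,
        fun _ => ⟨continuousOn_const, fun _ _ => by simp [hf0]⟩, fun h => (hw0 h).symm,
        fun _ _ _ => by simpa [hL.zero] using hc, fun _ _ => rfl,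
        fun h h' => absurd (hw0 h') h⟩
  choose u η h1 h2 h3 h4 h5 h6 using key
  exact ⟨u, η, h1, h2, h3, h4, fun i => h5 i 0 rfl, h6⟩

namespace IsSelection

variable (h : IsSelection f b V C c T u η) {w : ℕ → E}
  (hw : ∀ i, w (i + 1) = η i (w i) (T (i + 1))) (hw0 : V (w 0) < c)

include h hw hw0

theorem state_lt (hT : StrictMono T) (i : ℕ) : V (w i) < c := by
  induction i with
  | zero => exact hw0
  | succ i ih => rw [hw]; exact h.bound i _ ih _ ⟨(hT i.lt_succ_self).le, le_rfl⟩

omit hw0 in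
theorem eq_zero_of_le {i j : ℕ} (hij : i ≤ j) (hi : w i = 0) : w j = 0 := by
  induction j, hij using Nat.le_induction with
  | base => exact hi
  | succ j _ ih => rw [hw, ih, h.zero]

/-- This reduces the closed loop to two integer sequences, the level and the end of the plan
followed on each interval. They carry no information once the state is 0, where no plan exists. -/
theorem exists_levels (hL : IsLyapunovCandidate V) (hT : StrictMono T)
    (hplan : ∀ i w, w ≠ 0 → V w < c → ∃ p : Plan f b V C c T, p.j = i ∧ p.z = w) :
    ∃ (l : ℕ → ℤ) (e : ℕ → ℕ), (∀ i, w i ≠ 0 → i < e i) ∧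
      (w 0 ≠ 0 → (2 : ℝ) ^ l 0 ≤ V (w 0)) ∧
      (∀ i, w (i + 1) ≠ 0 → l (i + 1) < l i ∨ l (i + 1) = l i ∧ e (i + 1) ≤ e i) ∧
      ∀ i, w i ≠ 0 → ∀ t ∈ Icc (T i) (T (i + 1)), V (η i (w i) t) < 4 * 2 ^ l i := by
  have hlt := h.state_lt hw hw0 hT
  have : ∀ i, ∃ q : Option (Plan f b V C c T), w i ≠ 0 → ∃ p, q = some p ∧ p.IsBest i (w i) ∧
      ∀ t ∈ Icc (T i) (T (i + 1)), η i (w i) t = p.ζ t := fun i => by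
    by_cases hi : w i = 0
    · exact ⟨none, fun h => absurd hi h⟩
    · obtain ⟨p, hp⟩ := h.best i _ hi (hlt i)
      exact ⟨some p, fun _ => ⟨p, rfl, hp⟩⟩
  choose q hq using this
  refine ⟨fun i => (q i).elim 0 Plan.level, fun i => (q i).elim 0 Plan.e, fun i hi => ?_,
    fun hi => ?_, fun i hi => ?_, fun i hi t ht => ?_⟩
  · obtain ⟨p, hqp, hp, -⟩ := hq i hi
    simpa [hqp] using hp.passes.lt
  · obtain ⟨p, hqp, hp, -⟩ := hq 0 hi
    obtain ⟨r, hr, hrz⟩ := hplan 0 _ hi (hlt 0)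
    simpa [hqp] using hp.level_le hL hr hrz
  · have hi' : w i ≠ 0 := fun h0 => hi (h.eq_zero_of_le hw i.le_succ h0)
    obtain ⟨p, hqp, hp, hpη⟩ := hq i hi'
    obtain ⟨p', hqp', hp', -⟩ := hq (i + 1) hi
    simp only [hqp, hqp', Option.elim_some]
    refine hp.step hL ?_ hp' (hplan (i + 1) _ hi (hlt _))
    rw [hw i]
    exact (hpη _ ⟨(hT i.lt_succ_self).le, le_rfl⟩).symm
  · obtain ⟨p, hqp, hp, hpη⟩ := hq i hi
    simp only [hqp, Option.elim_some]
    rw [hpη t ht]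
    exact p.lt_level ⟨(hT.monotone hp.passes.le).trans ht.1, ht.2.trans (hT.monotone hp.passes.lt)⟩

/-- Stability: levels do not increase. One factor 2 is the permitted doubling of V, the other the
width of a dyadic level. -/
theorem le_four_mul (hL : IsLyapunovCandidate V) (hT : StrictMono T)
    (hplan : ∀ i w, w ≠ 0 → V w < c → ∃ p : Plan f b V C c T, p.j = i ∧ p.z = w) (i : ℕ) {t : ℝ}
    (ht : t ∈ Icc (T i) (T (i + 1))) : V (η i (w i) t) ≤ 4 * V (w 0) := by
  obtain ⟨l, e, -, h0, hstep, hlt⟩ := h.exists_levels hw hw0 hL hT hplan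
  by_cases hi : w i = 0
  · rw [hi, h.zero, hL.zero]
    linarith [hL.nonneg (w 0)]
  have hle : ∀ j, w j ≠ 0 → l j ≤ l 0 := fun j => by
    induction j with
    | zero => exact fun _ => le_rfl
    | succ j ih =>
      intro hj
      have h1 : l (j + 1) ≤ l j := by
        rcases hstep j hj with h' | h'
        · exact h'.le
        · exact h'.1.le
      exact h1.trans (ih fun h0 => hj (h.eq_zero_of_le hw j.le_succ h0))
  have h1 : (2 : ℝ) ^ l i ≤ 2 ^ l 0 := zpow_le_zpow_right₀ (by norm_num) (hle i hi)
  have h2 := h0 fun h0 => hi (h.eq_zero_of_le hw i.zero_le h0)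
  linarith [hlt i hi t ht]

theorem eventually_lt (hL : IsLyapunovCandidate V) (hT : StrictMono T)
    (hplan : ∀ i w, w ≠ 0 → V w < c → ∃ p : Plan f b V C c T, p.j = i ∧ p.z = w) {ε : ℝ}
    (hε : 0 < ε) : ∃ i₀, ∀ i ≥ i₀, ∀ t ∈ Icc (T i) (T (i + 1)), V (η i (w i) t) < ε := by
  by_cases hz : ∃ i, w i = 0
  · obtain ⟨i₀, hi₀⟩ := hz
    refine ⟨i₀, fun i hi t _ => ?_⟩
    rw [h.eq_zero_of_le hw hi hi₀, h.zero, hL.zero]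
    exact hε
  push Not at hz
  obtain ⟨l, e, he, -, hstep, hlt⟩ := h.exists_levels hw hw0 hL hT hplan
  have hanti : Antitone l := antitone_nat_of_succ_le fun i => by
    rcases hstep i (hz _) with h' | h'
    · exact h'.le
    · exact h'.1.le
  -- At a constant level the ends never increase, yet they must exceed the current index; this is
  -- impossible beyond the end e i.
  have hdrop : ∀ i, ∃ i', i ≤ i' ∧ l i' < l i := by
    intro i
    by_contra! hcon
    have heq : ∀ j, i ≤ j → l j = l i := fun j hj => le_antisymm (hanti hj) (hcon j hj)
    have hle : ∀ j, i ≤ j → e j ≤ e i := fun j hj => by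
      induction j, hj using Nat.le_induction with
      | base => exact le_rfl
      | succ j hj ih =>
        rcases hstep j (hz _) with h' | h'
        · rw [heq j hj, heq (j + 1) (hj.trans j.le_succ)] at h'
          exact absurd h' (lt_irrefl _)
        · exact h'.2.trans ih
    exact absurd (he (max i (e i)) (hz _))
      (not_lt.2 ((hle _ (le_max_left _ _)).trans (le_max_right _ _)))
  have hunb : ∀ n : ℕ, ∃ i, l i ≤ l 0 - n := by
    intro n
    induction n with
    | zero => exact ⟨0, by simp⟩
    | succ n ih =>
      obtain ⟨i, hi⟩ := ih
      obtain ⟨i', -, hi'⟩ := hdrop i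
      exact ⟨i', by push_cast; omega⟩
  obtain ⟨n, hn⟩ := exists_pow_lt_of_lt_one (show 0 < ε / (4 * 2 ^ l 0) by positivity)
    (show (1 / 2 : ℝ) < 1 by norm_num)
  obtain ⟨i₀, hi₀⟩ := hunb n
  refine ⟨i₀, fun i hi t ht => (hlt i (hz i) t ht).trans ?_⟩
  have h1 : (2 : ℝ) ^ l i ≤ 2 ^ (l 0 - n) :=
    zpow_le_zpow_right₀ (by norm_num) ((hanti hi).trans hi₀)
  rw [zpow_sub₀ (by norm_num), zpow_natCast] at h1
  rw [one_div, inv_pow, lt_div_iff₀ (by positivity)] at hn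
  calc 4 * (2 : ℝ) ^ l i ≤ 4 * (2 ^ l 0 / 2 ^ n) := by linarith
    _ = (2 ^ n)⁻¹ * (4 * 2 ^ l 0) := by rw [div_eq_mul_inv]; ring
    _ < ε := hn

end IsSelection

namespace IsPartition

theorem exists_lt_succ (hT : IsPartition T) (t : ℝ) : ∃ n, t < T (n + 1) :=
  (((tendsto_add_atTop_iff_nat 1).2 hT.unbounded).eventually_gt_atTop t).exists

open Classical in
/-- The number of the sampling interval containing `t`. -/
noncomputable def index (hT : IsPartition T) (t : ℝ) : ℕ := Nat.find (hT.exists_lt_succ t)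

theorem index_eq (hT : IsPartition T) {i : ℕ} {t : ℝ} (ht : t ∈ Ico (T i) (T (i + 1))) :
    hT.index t = i := by
  classical
  refine (Nat.find_eq_iff _).2 ⟨ht.2, fun n hn hlt => ?_⟩
  exact absurd (hlt.trans_le (hT.mono.monotone hn)) (not_lt.2 ht.1)

theorem mem_index (hT : IsPartition T) {t : ℝ} (ht : 0 ≤ t) :
    t ∈ Ico (T (hT.index t)) (T (hT.index t + 1)) := by
  classical
  refine ⟨?_, Nat.find_spec (hT.exists_lt_succ t)⟩
  rcases Nat.eq_zero_or_pos (hT.index t) with h0 | hpos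
  · rw [h0, hT.zero]; exact ht
  · obtain ⟨m, hm⟩ : ∃ m, hT.index t = m + 1 := ⟨hT.index t - 1, by omega⟩
    have : ¬ t < T (m + 1) := Nat.find_min (hT.exists_lt_succ t) (m := m) (by
      change m < hT.index t; omega)
    rw [hm]; exact not_lt.1 this

theorem measurable_index (hT : IsPartition T) : Measurable hT.index := by
  classical
  exact measurable_find hT.exists_lt_succ fun k => measurableSet_Iio

theorem continuousOn_Ici (hT : IsPartition T) {F : Type*} [TopologicalSpace F] {π : ℝ → F}
    (h : ∀ i, ContinuousOn π (Icc (T i) (T (i + 1)))) : ContinuousOn π (Ici 0) := by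
  have key : ∀ n, ContinuousOn π (Icc 0 (T n)) := fun n => by
    induction n with
    | zero => rw [hT.zero, Icc_self]; exact continuousOn_singleton _ _
    | succ n ih =>
      have h0 : 0 ≤ T n := hT.zero ▸ hT.mono.monotone n.zero_le
      rw [← Icc_union_Icc_eq_Icc h0 (hT.mono n.lt_succ_self).le]
      exact ih.union_of_isClosed (h n) isClosed_Icc isClosed_Icc
  intro t ht
  obtain ⟨n, hn⟩ := hT.exists_lt_succ t
  refine ((key (n + 1)) t ⟨ht, hn.le⟩).mono_of_mem_nhdsWithin ?_
  filter_upwards [self_mem_nhdsWithin, mem_nhdsWithin_of_mem_nhds (Iic_mem_nhds hn)] with r h1 h2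
  exact ⟨h1, h2⟩

end IsPartition

theorem isClosedLoopTrajectory_of_arcs {k : ℝ → E → ℝ} {Ω : Set E} {π : ℝ → E} (hf : Continuous f)
    (hT : IsPartition T) (hu : ∀ i w, IsControl C (u i w))
    (hk : ∀ i w, ∀ t ∈ Ico (T i) (T (i + 1)), k t w = u i w t) (hΩ : ∀ i, π (T i) ∈ Ω)
    (h : ∀ i, IsArc f b (u i (π (T i))) π (T i) (T (i + 1))) :
    IsClosedLoopTrajectory (fun z v => f z + v • b) T Ω k π := by
  refine ⟨hT.continuousOn_Ici fun i => (h i).cont, fun i => ?_⟩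
  have hle : T i ≤ T (i + 1) := (hT.mono i.lt_succ_self).le
  have h' : IsArc f b (fun t => k t (π (T i))) π (T i) (T (i + 1)) :=
    (h i).congr (fun _ _ => rfl) (fun t ht => hk i _ t ht) fun _ _ => rfl
  refine ⟨hΩ i, ?_, h'.eq⟩
  refine ((h i).intervalIntegrable hf (hu i _) ⟨le_rfl, hle⟩ ⟨hle, le_rfl⟩).congr_uIoo
    fun t ht => ?_
  rw [uIoo_of_le hle] at ht
  simp only [hk i _ t ⟨ht.1.le, ht.2⟩]

theorem IsClosedLoopTrajectory.isArc {k : ℝ → E → ℝ} {Ω : Set E} {π : ℝ → E} (hT : IsPartition T)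
    (hk : ∀ i w, ∀ t ∈ Ico (T i) (T (i + 1)), k t w = u i w t)
    (h : IsClosedLoopTrajectory (fun z v => f z + v • b) T Ω k π) (i : ℕ) :
    IsArc f b (u i (π (T i))) π (T i) (T (i + 1)) := by
  have h' : IsArc f b (fun t => k t (π (T i))) π (T i) (T (i + 1)) :=
    ⟨h.1.mono fun t ht => (hT.zero ▸ hT.mono.monotone i.zero_le : (0 : ℝ) ≤ T i).trans ht.1,
      (h.2 i).2.2⟩
  exact h'.congr (fun _ _ => rfl) (fun t ht => (hk i _ t ht).symm) fun _ _ => rfl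

variable [CompleteSpace E] [FiniteDimensional ℝ E]

/-- If `V` can be decreased from every state of `{V < c}` other than `0`, then there is a bounded
stabilizing sampled-data feedback on `{V < c}`. -/
theorem exists_isStabilizing (hf : ContDiff ℝ 1 f) (hf0 : f 0 = 0) (hL : IsLyapunovCandidate V)
    (hC : 0 ≤ C) (hc : 0 < c) (hdec : CanDecrease f b V C c) (hT : IsPartition T) :
    ∃ k, IsStabilizing (fun z v => f z + v • b) T {z | V z < c} k ∧ ∀ t x, |k t x| ≤ C := by
  have hplan : ∀ i w, w ≠ 0 → V w < c → ∃ p : Plan f b V C c T, p.j = i ∧ p.z = w :=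
    fun i w h0 hw => exists_plan hf hf0 hL hC hdec hT i h0 hw
  obtain ⟨u, η, h⟩ := exists_isSelection hf.continuous hf0 hL hC hc hT.mono hplan
  set k : ℝ → E → ℝ := fun t w => u (hT.index t) w t with hkdef
  have hk : ∀ i w, ∀ t ∈ Ico (T i) (T (i + 1)), k t w = u i w t := fun i w t ht => by
    simp only [hkdef, hT.index_eq ht]
  have hkC : ∀ t x, |k t x| ≤ C := fun t x => (h.control _ _).bound t
  have hlt : ∀ i, T i ≤ T (i + 1) := fun i => (hT.mono i.lt_succ_self).le
  -- Uniqueness of arcs: every closed-loop trajectory, not only the constructed one, follows the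
  -- selected arcs.
  have hfollow : ∀ π, IsClosedLoopTrajectory (fun z v => f z + v • b) T {z | V z < c} k π →
      ∀ i, ∀ t ∈ Icc (T i) (T (i + 1)), π t = η i (π (T i)) t := fun π hπ i t ht =>
    (hπ.isArc hT hk i).eqOn hf (h.control _ _) (h.arc i _ (hπ.2 i).1) (h.start i _ (hπ.2 i).1).symm
      ht
  refine ⟨k, ⟨fun x _ => ?_, fun x _ => ⟨C, Eventually.of_forall fun t => hkC t x⟩, fun x hx => ?_,
    fun ε hε => ?_, fun π hπ => ?_⟩, hkC⟩
  · have : Measurable fun p : ℕ × ℝ => u p.1 x p.2 :=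
      measurable_from_prod_countable_right fun i => (h.control i x).measurable
    exact this.comp (hT.measurable_index.prodMk measurable_id)
  · let w : ℕ → E := fun i => Nat.rec x (fun i w => η i w (T (i + 1))) i
    have hw : ∀ i, w (i + 1) = η i (w i) (T (i + 1)) := fun _ => rfl
    have hwc : ∀ i, V (w i) < c := h.state_lt hw hx hT.mono
    set π : ℝ → E := fun t => η (hT.index t) (w (hT.index t)) t with hπdef
    have hπi : ∀ i, ∀ t ∈ Ico (T i) (T (i + 1)), π t = η i (w i) t := fun i t ht => by
      simp only [hπdef, hT.index_eq ht]
    have hπT : ∀ i, π (T i) = w i := fun i => by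
      rw [hπi i _ ⟨le_rfl, hT.mono i.lt_succ_self⟩, h.start i _ (hwc i)]
    have hπ : ∀ i, ∀ t ∈ Icc (T i) (T (i + 1)), π t = η i (w i) t := fun i t ht => by
      rcases ht.2.lt_or_eq with hlt | rfl
      · exact hπi i t ⟨ht.1, hlt⟩
      · rw [hπT, hw]
    refine ⟨π, isClosedLoopTrajectory_of_arcs hf.continuous hT h.control hk
      (fun i => by rw [hπT]; exact hwc i) fun i => ?_, ?_⟩
    · rw [hπT]
      exact (h.arc i _ (hwc i)).congr (hπ i) (fun _ _ => rfl) fun _ _ => rfl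
    · rw [← hT.zero, hπT]; rfl
  · obtain ⟨c', hc', hsub⟩ := hL.exists_sublevel_subset (Metric.closedBall_mem_nhds (0 : E) hε)
    have hnear : ∀ᶠ z in 𝓝 (0 : E), V z < c' / 4 :=
      hL.smooth.continuous.tendsto' 0 0 hL.zero |>.eventually (gt_mem_nhds (by positivity))
    obtain ⟨δ, hδ, hball⟩ := Metric.nhds_basis_closedBall.eventually_iff.1 hnear
    refine ⟨δ, hδ, fun π hπ hπ0 t ht => ?_⟩
    have hi := hT.mem_index ht
    set i := hT.index t
    have h4 := h.le_four_mul (w := fun i => π (T i)) (fun i => hfollow π hπ i _ ⟨hlt i, le_rfl⟩)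
      (hπ.2 0).1 hL hT.mono hplan i (Ico_subset_Icc_self hi)
    rw [← hfollow π hπ i t (Ico_subset_Icc_self hi), hT.zero] at h4
    have h5 : V (π 0) < c' / 4 := hball (by simpa using hπ0)
    have h6 := hsub (show V (π t) < c' by linarith)
    simpa using h6
  · rw [Metric.tendsto_atTop]
    intro ε hε
    obtain ⟨c', hc', hsub⟩ := hL.exists_sublevel_subset (Metric.ball_mem_nhds (0 : E) hε)
    obtain ⟨i₀, hi₀⟩ := h.eventually_lt (w := fun i => π (T i))
      (fun i => hfollow π hπ i _ ⟨hlt i, le_rfl⟩) (hπ.2 0).1 hL hT.mono hplan hc'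
    refine ⟨T i₀, fun t ht => ?_⟩
    have h0 : 0 ≤ t := (hT.zero ▸ hT.mono.monotone i₀.zero_le : (0 : ℝ) ≤ T i₀).trans ht
    have hi := hT.mem_index h0
    have hle : i₀ ≤ hT.index t := by
      have := hT.mono.lt_iff_lt.1 (lt_of_le_of_lt ht hi.2)
      omega
    have := hi₀ _ hle t (Ico_subset_Icc_self hi)
    rw [← hfollow π hπ _ t (Ico_subset_Icc_self hi)] at this
    exact hsub this

end Feedback

/-! ### Words in f and g, and reduction of the vanishing conditions to them -/

section Words

variable {E : Type*} [NormedAddCommGroup E] [NormedSpace ℝ E]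

theorem contDiff_lieD {X : E → E} {h : E → ℝ} (hX : ContDiff ℝ ∞ X) (hh : ContDiff ℝ ∞ h) :
    ContDiff ℝ ∞ (lieD X h) :=
  (hh.fderiv_right (m := ∞) (by simp)).clm_apply hX

theorem contDiff_brk {X Y : E → E} (hX : ContDiff ℝ ∞ X) (hY : ContDiff ℝ ∞ Y) :
    ContDiff ℝ ∞ (brk X Y) :=
  hX.lieBracket_vectorField hY (by simp)

theorem lieD_brk {X Y : E → E} {h : E → ℝ} (hX : ContDiff ℝ ∞ X) (hY : ContDiff ℝ ∞ Y)
    (hh : ContDiff ℝ ∞ h) : lieD (brk X Y) h = lieD X (lieD Y h) - lieD Y (lieD X h) := by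
  funext x
  exact VectorField.fderiv_apply_lieBracket (n := ∞) hh.contDiffAt
    (by rw [minSmoothness_of_isRCLikeNormedField]; exact WithTop.coe_le_coe.2 le_top)
    (hY.differentiable (by simp)).differentiableAt (hX.differentiable (by simp)).differentiableAt

theorem lieD_add_left (X Y : E → E) (h : E → ℝ) : lieD (X + Y) h = lieD X h + lieD Y h := by
  funext x; simp [lieD]

theorem lieD_smul_left (r : ℝ) (X : E → E) (h : E → ℝ) : lieD (r • X) h = r • lieD X h := by
  funext x; simp [lieD]

theorem lieD_zero_left (h : E → ℝ) : lieD 0 h = 0 := by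
  funext x; simp [lieD]

theorem lieD_sum_left {ι : Type*} (s : Finset ι) (X : ι → E → E) (h : E → ℝ) :
    lieD (∑ i ∈ s, X i) h = ∑ i ∈ s, lieD (X i) h := by
  funext x; simp [lieD]

theorem lieD_add_right (X : E → E) {h k : E → ℝ} (hh : ContDiff ℝ ∞ h) (hk : ContDiff ℝ ∞ k) :
    lieD X (h + k) = lieD X h + lieD X k := by
  funext x
  simp [lieD, fderiv_add (hh.differentiable (by simp) x) (hk.differentiable (by simp) x)]

theorem lieD_smul_right (X : E → E) (r : ℝ) {h : E → ℝ} (hh : ContDiff ℝ ∞ h) :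
    lieD X (r • h) = r • lieD X h := by
  funext x
  simp [lieD, fderiv_const_smul (hh.differentiable (by simp) x)]

theorem lieD_zero_right (X : E → E) : lieD X 0 = 0 := by
  funext x
  simp [lieD]

/-- A word in `f` (`false`) and `g` (`true`), as a differential operator applied to `V`. -/
noncomputable def wordD (f g : E → E) (V : E → ℝ) (l : List Bool) : E → ℝ :=
  l.foldr (fun c h => lieD (if c then g else f) h) V

variable {f g : E → E} {V : E → ℝ}

theorem contDiff_wordD (hf : ContDiff ℝ ∞ f) (hg : ContDiff ℝ ∞ g) (hV : ContDiff ℝ ∞ V)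
    (l : List Bool) : ContDiff ℝ ∞ (wordD f g V l) := by
  induction l with
  | nil => exact hV
  | cons c l ih => cases c <;> exact contDiff_lieD (by assumption) ih

/-- The span of the functions `wordD f g V l`, where the length of `l` and the number of letters
`g` satisfy `P`. -/
def wordSpan (f g : E → E) (V : E → ℝ) (P : ℕ → ℕ → Prop) : Submodule ℝ (E → ℝ) :=
  Submodule.span ℝ {h | ∃ l : List Bool, P l.length (l.count true) ∧ h = wordD f g V l}

theorem wordD_mem_wordSpan {P : ℕ → ℕ → Prop} {l : List Bool} (h : P l.length (l.count true)) :
    wordD f g V l ∈ wordSpan f g V P :=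
  Submodule.subset_span ⟨l, h, rfl⟩

theorem wordSpan_mono {P Q : ℕ → ℕ → Prop} (h : ∀ m q, P m q → Q m q) :
    wordSpan f g V P ≤ wordSpan f g V Q :=
  Submodule.span_mono fun _ ⟨l, hl, e⟩ => ⟨l, h _ _ hl, e⟩

theorem contDiff_of_mem_wordSpan (hf : ContDiff ℝ ∞ f) (hg : ContDiff ℝ ∞ g)
    (hV : ContDiff ℝ ∞ V) {P : ℕ → ℕ → Prop} {h : E → ℝ} (hh : h ∈ wordSpan f g V P) :
    ContDiff ℝ ∞ h := by
  induction hh using Submodule.span_induction with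
  | mem h hm => obtain ⟨l, -, rfl⟩ := hm; exact contDiff_wordD hf hg hV l
  | zero => exact contDiff_const
  | add _ _ _ _ h1 h2 => exact h1.add h2
  | smul r _ _ h => exact h.const_smul r

/-- Vector fields acting like Lie polynomials of length `κ` with `j` letters `g`. -/
structure ActsHom (f g : E → E) (V : E → ℝ) (κ j : ℕ) (X : E → E) : Prop where
  smooth : ContDiff ℝ ∞ X
  maps : ∀ m q, ∀ h ∈ wordSpan f g V (fun m' q' => m' = m ∧ q' = q),
    lieD X h ∈ wordSpan f g V fun m' q' => m' = m + κ ∧ q' = q + j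

theorem actsHom_letter (hf : ContDiff ℝ ∞ f) (hg : ContDiff ℝ ∞ g) (hV : ContDiff ℝ ∞ V)
    (c : Bool) : ActsHom f g V 1 c.toNat (if c then g else f) := by
  refine ⟨by cases c <;> assumption, fun m q h hh => ?_⟩
  have hsm : ∀ h, _ → _ := fun h => contDiff_of_mem_wordSpan (h := h) hf hg hV
    (P := fun m' q' => m' = m ∧ q' = q)
  induction hh using Submodule.span_induction with
  | mem h hm =>
    obtain ⟨l, ⟨h1, h2⟩, rfl⟩ := hm
    change wordD f g V (c :: l) ∈ _
    refine wordD_mem_wordSpan ?_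
    cases c <;> simp only [List.length_cons, List.count_cons, h1, h2, Bool.toNat] <;> simp
  | zero => rw [lieD_zero_right]; exact zero_mem _
  | add h k h1 h2 i1 i2 =>
    rw [lieD_add_right _ (hsm _ h1)
      (hsm _ h2)]
    exact add_mem i1 i2
  | smul r h h1 i1 =>
    rw [lieD_smul_right _ _ (hsm _ h1)]
    exact Submodule.smul_mem _ _ i1

theorem actsHom_left (hf : ContDiff ℝ ∞ f) (hg : ContDiff ℝ ∞ g) (hV : ContDiff ℝ ∞ V) :
    ActsHom f g V 1 0 f := actsHom_letter hf hg hV false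

theorem actsHom_right (hf : ContDiff ℝ ∞ f) (hg : ContDiff ℝ ∞ g) (hV : ContDiff ℝ ∞ V) :
    ActsHom f g V 1 1 g := actsHom_letter hf hg hV true

theorem ActsHom.brk (hf : ContDiff ℝ ∞ f) (hg : ContDiff ℝ ∞ g) (hV : ContDiff ℝ ∞ V)
    {κ j κ' j' : ℕ} {X Y : E → E} (hX : ActsHom f g V κ j X) (hY : ActsHom f g V κ' j' Y) :
    ActsHom f g V (κ + κ') (j + j') (brk X Y) := by
  refine ⟨contDiff_brk hX.smooth hY.smooth, fun m q h hh => ?_⟩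
  rw [lieD_brk hX.smooth hY.smooth (contDiff_of_mem_wordSpan hf hg hV hh)]
  refine sub_mem ?_ ?_
  · have := hX.maps _ _ _ (hY.maps _ _ _ hh)
    rwa [add_assoc, add_comm κ', add_assoc, add_comm j'] at this
  · have := hY.maps _ _ _ (hX.maps _ _ _ hh)
    rwa [add_assoc, add_assoc] at this

theorem ActsHom.iterate_brk (hf : ContDiff ℝ ∞ f) (hg : ContDiff ℝ ∞ g) (hV : ContDiff ℝ ∞ V)
    {κ j : ℕ} {X : E → E} (hX : ActsHom f g V κ j X) (r : ℕ) :
    ActsHom f g V (κ + r) j ((fun Z => SampledData.brk Z f)^[r] X) := by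
  induction r with
  | zero => exact hX
  | succ r ih =>
    rw [Function.iterate_succ_apply']
    exact ih.brk hf hg hV (actsHom_left hf hg hV)

theorem ActsHom.nested (hf : ContDiff ℝ ∞ f) (hg : ContDiff ℝ ∞ g) (hV : ContDiff ℝ ∞ V)
    {κ j : ℕ} {X : E → E} (hX : ActsHom f g V κ j X) (r : List ℕ) :
    ActsHom f g V (κ + r.length + r.sum) (j + r.length) (nested f g X r) := by
  induction r generalizing κ j X with
  | nil => exact hX
  | cons r rs ih =>
    have := ih ((hX.brk hf hg hV (actsHom_right hf hg hV)).iterate_brk hf hg hV r)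
    simp only [SampledData.nested, List.length_cons, List.sum_cons]
    convert this using 1 <;> omega

/-- Brackets act as commutators, so letter counts add. Each summand has the initial f, j letters g
and κ - j - 1 further letters f. -/
theorem actsHom_lam (hf : ContDiff ℝ ∞ f) (hg : ContDiff ℝ ∞ g) (hV : ContDiff ℝ ∞ V) {κ j : ℕ}
    (hκ : 1 ≤ κ) (hj : j ≤ κ - 1) : ActsHom f g V κ j (lam f g κ j) := by
  have key : ∀ r ∈ Finset.Nat.antidiagonalTuple j (κ - j - 1),
      ActsHom f g V κ j (nested f g f (List.ofFn r)) := fun r hr => by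
    have h := (actsHom_left hf hg hV).nested hf hg hV (List.ofFn r)
    rw [Finset.Nat.mem_antidiagonalTuple] at hr
    rw [List.sum_ofFn, hr, List.length_ofFn] at h
    rw [zero_add] at h
    convert h using 1
    omega
  refine ⟨?_, fun m q h hh => ?_⟩
  · have : lam f g κ j = fun x => ∑ r ∈ Finset.Nat.antidiagonalTuple j (κ - j - 1),
        nested f g f (List.ofFn r) x := by funext x; simp [lam]
    rw [this]
    exact ContDiff.sum fun r hr => (key r hr).smooth
  · unfold lam
    rw [lieD_sum_left]
    exact sum_mem fun r hr => (key r hr).maps m q h hh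

theorem lieD_mem_wordSpan (hf : ContDiff ℝ ∞ f) (hg : ContDiff ℝ ∞ g) (hV : ContDiff ℝ ∞ V)
    {P Q R : ℕ → ℕ → Prop} (hPQR : ∀ m q i j, P m q → 1 ≤ i → j ≤ i - 1 → Q i j → R (m + i) (q + j))
    {X : E → E} (hX : X ∈ Submodule.span ℝ {X | ∃ i j, 1 ≤ i ∧ j ≤ i - 1 ∧ Q i j ∧ X = lam f g i j})
    {h : E → ℝ} (hh : h ∈ wordSpan f g V P) : lieD X h ∈ wordSpan f g V R := by
  induction hX using Submodule.span_induction with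
  | zero => rw [lieD_zero_left]; exact zero_mem _
  | add X Y _ _ h1 h2 => rw [lieD_add_left]; exact add_mem h1 h2
  | smul r X _ h1 => rw [lieD_smul_left]; exact Submodule.smul_mem _ _ h1
  | mem X hX =>
    obtain ⟨i, j, hi, hj, hQ, rfl⟩ := hX
    have hact := actsHom_lam hf hg hV hi hj
    induction hh using Submodule.span_induction with
    | zero => rw [lieD_zero_right]; exact zero_mem _
    | add h k h1 h2 i1 i2 =>
      rw [lieD_add_right _ (contDiff_of_mem_wordSpan hf hg hV h1)
        (contDiff_of_mem_wordSpan hf hg hV h2)]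
      exact add_mem i1 i2
    | smul r h h1 i1 =>
      rw [lieD_smul_right _ _ (contDiff_of_mem_wordSpan hf hg hV h1)]
      exact Submodule.smul_mem _ _ i1
    | mem h hm =>
      obtain ⟨l, hl, rfl⟩ := hm
      refine wordSpan_mono ?_ (hact.maps l.length (l.count true) _
        (Submodule.subset_span ⟨l, ⟨rfl, rfl⟩, rfl⟩))
      rintro m q ⟨rfl, rfl⟩
      exact hPQR _ _ _ _ hl hi hj hQ

theorem eq_zero_of_mem_wordSpan {P : ℕ → ℕ → Prop} {x : E}
    (hx : ∀ l : List Bool, P l.length (l.count true) → wordD f g V l x = 0) {h : E → ℝ}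
    (hh : h ∈ wordSpan f g V P) : h x = 0 := by
  induction hh using Submodule.span_induction with
  | mem h hm => obtain ⟨l, hl, rfl⟩ := hm; exact hx l hl
  | zero => rfl
  | add _ _ _ _ h1 h2 => simp [h1, h2]
  | smul r _ _ h => simp [h]

theorem HasOrder.mem_span {X : E → E} {κ : ℕ} (h : HasOrder f g X κ) :
    X ∈ Submodule.span ℝ {X | ∃ i j, 1 ≤ i ∧ j ≤ i - 1 ∧ i ≤ κ ∧ X = lam f g i j} := by
  obtain ⟨-, X₁, X₂, rfl, -, h1, h2⟩ := h
  refine add_mem (Submodule.span_mono ?_ h1) (Submodule.span_mono ?_ h2)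
  · rintro _ ⟨j, h1, h2, rfl⟩; exact ⟨κ, j, h1, h2, le_rfl, rfl⟩
  · rintro _ ⟨i, j, h1, h2, h3, rfl⟩; exact ⟨i, j, h1, h3, h2.le, rfl⟩

theorem HasOrders.mem_span {X : E → E} {κ l : ℕ} (h : HasOrders f g X κ l) :
    X ∈ Submodule.span ℝ {X | ∃ i j, 1 ≤ i ∧ j ≤ i - 1 ∧ (i ≤ κ ∧ j = l) ∧ X = lam f g i j} := by
  obtain ⟨-, X₁, X₂, rfl, -, h1, h2⟩ := h
  refine add_mem (Submodule.span_mono ?_ h1) (Submodule.span_mono ?_ h2)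
  · rintro _ ⟨h1, h2, rfl⟩; exact ⟨κ, l, h1, h2, ⟨le_rfl, rfl⟩, rfl⟩
  · rintro _ ⟨i, h1, h2, h3, rfl⟩; exact ⟨i, l, h1, h3, ⟨h2.le, rfl⟩, rfl⟩

theorem lieWord_succ {k : ℕ} (Δ : Fin (k + 1) → E → E) (V : E → ℝ) :
    lieWord Δ V = lieD (Δ 0) (lieWord (fun i => Δ i.succ) V) := by
  simp [lieWord, List.ofFn_succ]

/-- Since λ_{i,j} has j < i, every word that occurs contains an f. Fields of a given order may have
terms of lower order, so shorter words must be covered too. -/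
theorem vanishUpTo_of_words (hf : ContDiff ℝ ∞ f) (hg : ContDiff ℝ ∞ g) (hV : ContDiff ℝ ∞ V)
    {x : E} {N : ℕ} (h : ∀ l : List Bool, l.length ≤ N → l.count true < l.length →
      wordD f g V l x = 0) : VanishUpTo f g V x N := by
  intro _ k Δ o hk hΔ hsum
  have key : ∀ (k : ℕ) (Δ : Fin k → E → E) (o : Fin k → ℕ), (∀ p, HasOrder f g (Δ p) (o p)) →
      lieWord Δ V ∈ wordSpan f g V fun m q => m ≤ ∑ p, o p ∧ q ≤ m ∧ (1 ≤ k → q < m) := by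
    intro k
    induction k with
    | zero => exact fun Δ o _ => Submodule.subset_span ⟨[], by simp, by simp [lieWord, wordD]⟩
    | succ k ih =>
      intro Δ o hΔ
      rw [lieWord_succ]
      refine lieD_mem_wordSpan hf hg hV ?_ (hΔ 0).mem_span (ih _ _ fun p => hΔ p.succ)
      rintro m q i j ⟨h1, h2, -⟩ hi hj hQ
      rw [Fin.sum_univ_succ]
      omega
  exact eq_zero_of_mem_wordSpan (fun l hl => h l (hl.1.trans hsum) (hl.2.2 hk)) (key k Δ o hΔ)

theorem vanishAt_of_words (hf : ContDiff ℝ ∞ f) (hg : ContDiff ℝ ∞ g) (hV : ContDiff ℝ ∞ V)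
    {x : E} {M q : ℕ} (h : ∀ l : List Bool, l.length ≤ M → l.count true < l.length →
      l.count true = q → wordD f g V l x = 0) : VanishAt f g V x M q := by
  intro _ k Δ o s hk hΔ hsum hsum'
  have key : ∀ (k : ℕ) (Δ : Fin k → E → E) (o s : Fin k → ℕ),
      (∀ p, HasOrders f g (Δ p) (o p) (s p)) → lieWord Δ V ∈ wordSpan f g V fun m q =>
        m ≤ ∑ p, o p ∧ q ≤ m ∧ (1 ≤ k → q < m) ∧ q = ∑ p, s p := by
    intro k
    induction k with
    | zero => exact fun Δ o s _ => Submodule.subset_span ⟨[], by simp, by simp [lieWord, wordD]⟩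
    | succ k ih =>
      intro Δ o s hΔ
      rw [lieWord_succ]
      refine lieD_mem_wordSpan hf hg hV ?_ (hΔ 0).mem_span (ih _ _ _ fun p => hΔ p.succ)
      rintro m q i j ⟨h1, h2, -, h3⟩ hi hj hQ
      rw [Fin.sum_univ_succ, Fin.sum_univ_succ]
      omega
  exact eq_zero_of_mem_wordSpan
    (fun l hl => h l (hl.1.trans hsum.le) (hl.2.2.1 hk) (hl.2.2.2.trans hsum')) (key k Δ o s hΔ)

end Words

/-! ### Polynomials in y and the action of f and g on their coefficients -/

section Coefficients

variable {n : ℕ}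

theorem contDiff_fst : ContDiff ℝ ∞ fun z : RnR n => z.fst :=
  (WithLp.fstL 2 ℝ (Rn n) ℝ).contDiff

theorem contDiff_snd : ContDiff ℝ ∞ fun z : RnR n => z.snd :=
  (WithLp.sndL 2 ℝ (Rn n) ℝ).contDiff

theorem contDiff_toLp {E : Type*} [NormedAddCommGroup E] [NormedSpace ℝ E] {F : E → Rn n}
    (hF : ContDiff ℝ ∞ F) : ContDiff ℝ ∞ fun z => (WithLp.toLp 2 (F z, 0) : RnR n) :=
  (WithLp.prodContinuousLinearEquiv 2 ℝ (Rn n) ℝ).symm.contDiff.comp (hF.prodMk contDiff_const)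

theorem contDiff_drift {a β γ δ : Rn n → Rn n} (ha : ContDiff ℝ ∞ a) (hβ : ContDiff ℝ ∞ β)
    (hγ : ContDiff ℝ ∞ γ) (hδ : ContDiff ℝ ∞ δ) : ContDiff ℝ ∞ (drift a β γ δ) :=
  contDiff_toLp ((((ha.comp contDiff_fst).add (contDiff_snd.smul (hβ.comp contDiff_fst))).add
    ((contDiff_snd.pow 2).smul (hγ.comp contDiff_fst))).add
    ((contDiff_snd.pow 3).smul (hδ.comp contDiff_fst)))

theorem contDiff_input : ContDiff ℝ ∞ (input : RnR n → RnR n) := contDiff_const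

theorem contDiff_lyap {W : Rn n → ℝ} (hW : ContDiff ℝ ∞ W) : ContDiff ℝ ∞ (lyap W) :=
  (hW.comp contDiff_fst).add (contDiff_snd.pow 2)

/-- `h(x, y)` is the polynomial `∑ y ^ k p_k(x)` with smooth coefficients. -/
structure IsPoly (h : RnR n → ℝ) (p : ℕ → Rn n → ℝ) : Prop where
  smooth : ∀ k, ContDiff ℝ ∞ (p k)
  eq : ∃ d, ∀ D, d ≤ D → ∀ z, h z = ∑ k ∈ Finset.range D, z.snd ^ k * p k z.fst

/-- Multiplication of a coefficient sequence by `y`. -/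
def shift (p : ℕ → Rn n → ℝ) : ℕ → Rn n → ℝ
  | 0 => 0
  | k + 1 => p k

/-- The derivative along the horizontal lift of `X`. -/
noncomputable def horizD (X : Rn n → Rn n) (h : RnR n → ℝ) (z : RnR n) : ℝ :=
  fderiv ℝ h z (WithLp.toLp 2 (X z.fst, 0))

theorem hasFDerivAt_monomial {p : Rn n → ℝ} (hp : ContDiff ℝ ∞ p) (k : ℕ) (z v : RnR n) :
    ∃ L : RnR n →L[ℝ] ℝ, HasFDerivAt (fun z : RnR n => z.snd ^ k * p z.fst) L z ∧
      L v = k * z.snd ^ (k - 1) * v.snd * p z.fst + z.snd ^ k * fderiv ℝ p z.fst v.fst := by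
  have h1 : HasFDerivAt (fun z : RnR n => z.snd) (WithLp.sndL 2 ℝ (Rn n) ℝ) z :=
    (WithLp.sndL 2 ℝ (Rn n) ℝ).hasFDerivAt
  have h2 : HasFDerivAt (fun z : RnR n => z.fst) (WithLp.fstL 2 ℝ (Rn n) ℝ) z :=
    (WithLp.fstL 2 ℝ (Rn n) ℝ).hasFDerivAt
  have h3 := ((hp.differentiable (by simp)) z.fst).hasFDerivAt.comp z h2
  refine ⟨_, (h1.pow k).mul h3, ?_⟩
  simp [WithLp.sndL, WithLp.fstL]
  ring

theorem fderiv_sum_apply {E : Type*} [NormedAddCommGroup E] [NormedSpace ℝ E] {h : E → ℝ}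
    {φ : ℕ → E → ℝ} {D : ℕ} (hh : ∀ z, h z = ∑ k ∈ Finset.range D, φ k z) {z v : E} {r : ℕ → ℝ}
    (hφ : ∀ k, ∃ L : E →L[ℝ] ℝ, HasFDerivAt (φ k) L z ∧ L v = r k) :
    fderiv ℝ h z v = ∑ k ∈ Finset.range D, r k := by
  choose L hL hLv using hφ
  have hsum : HasFDerivAt h (∑ k ∈ Finset.range D, L k) z := by
    rw [show h = _ from funext hh]
    exact HasFDerivAt.fun_sum fun k _ => hL k
  rw [hsum.fderiv, _root_.sum_apply]
  exact Finset.sum_congr rfl fun k _ => hLv k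

namespace IsPoly

variable {h h' : RnR n → ℝ} {p p' : ℕ → Rn n → ℝ}

theorem eval (hp : IsPoly h p) {z : RnR n} (hz : z.snd = 0) : h z = p 0 z.fst := by
  obtain ⟨d, hd⟩ := hp.eq
  rw [hd (d + 1) d.le_succ z, Finset.sum_range_succ', hz]
  simp

theorem add (hp : IsPoly h p) (hp' : IsPoly h' p') :
    IsPoly (fun z => h z + h' z) fun k => p k + p' k := by
  obtain ⟨d, hd⟩ := hp.eq
  obtain ⟨d', hd'⟩ := hp'.eq
  -- The expansions hold for all sufficiently large lengths, so both sums can be taken with the same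
  -- length and degrees need no bookkeeping.
  refine ⟨fun k => (hp.smooth k).add (hp'.smooth k), max d d', fun D hD z => ?_⟩
  rw [hd D ((le_max_left _ _).trans hD), hd' D ((le_max_right _ _).trans hD),
    ← Finset.sum_add_distrib]
  simp only [Pi.add_apply, mul_add]

theorem snd_mul (hp : IsPoly h p) : IsPoly (fun z => z.snd * h z) (shift p) := by
  obtain ⟨d, hd⟩ := hp.eq
  refine ⟨fun k => ?_, d + 1, fun D hD z => ?_⟩
  · cases k
    · exact contDiff_const
    · exact hp.smooth _
  · obtain ⟨D, rfl⟩ : ∃ D', D = D' + 1 := ⟨D - 1, by omega⟩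
    rw [Finset.sum_range_succ', hd D (by omega), Finset.mul_sum]
    simp only [shift, Pi.zero_apply, mul_zero, add_zero]
    exact Finset.sum_congr rfl fun k _ => by ring

theorem exists_fderiv (hp : IsPoly h p) : ∃ d, ∀ D, d ≤ D → ∀ z v : RnR n, fderiv ℝ h z v =
    ∑ k ∈ Finset.range D, (k * z.snd ^ (k - 1) * v.snd * p k z.fst +
      z.snd ^ k * fderiv ℝ (p k) z.fst v.fst) := by
  obtain ⟨d, hd⟩ := hp.eq
  refine ⟨d, fun D hD z v => ?_⟩
  exact fderiv_sum_apply (hd D hD) fun k => hasFDerivAt_monomial (hp.smooth k) k z v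

theorem horizD (hp : IsPoly h p) {X : Rn n → Rn n} (hX : ContDiff ℝ ∞ X) :
    IsPoly (horizD X h) fun k => lieD X (p k) := by
  obtain ⟨d, hd⟩ := hp.exists_fderiv
  refine ⟨fun k => contDiff_lieD hX (hp.smooth k), d, fun D hD z => ?_⟩
  rw [SampledData.horizD, hd D hD]
  simp [lieD]

theorem lieD_input (hp : IsPoly h p) :
    IsPoly (lieD input h) fun k => ((k : ℝ) + 1) • p (k + 1) := by
  obtain ⟨d, hd⟩ := hp.exists_fderiv
  refine ⟨fun k => contDiff_const.smul (hp.smooth (k + 1)), d, fun D hD z => ?_⟩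
  rw [lieD, hd (D + 1) (by omega), Finset.sum_range_succ']
  have h1 : (input z).fst = 0 := rfl
  have h2 : (input z).snd = 1 := rfl
  simp only [h1, h2, map_zero, mul_zero, add_zero, mul_one, Pi.smul_apply, smul_eq_mul,
    CharP.cast_eq_zero, zero_mul, Nat.add_sub_cancel]
  exact Finset.sum_congr rfl fun k _ => by push_cast; ring

end IsPoly

/-- The action of the drift on coefficient sequences. -/
noncomputable def stepF (a β γ δ : Rn n → Rn n) (p : ℕ → Rn n → ℝ) : ℕ → Rn n → ℝ := fun k =>
  lieD a (p k) + shift (fun k => lieD β (p k)) k + shift (shift fun k => lieD γ (p k)) k +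
    shift (shift (shift fun k => lieD δ (p k))) k

/-- The action of the input on coefficient sequences. -/
noncomputable def stepG (p : ℕ → Rn n → ℝ) : ℕ → Rn n → ℝ := fun k => ((k : ℝ) + 1) • p (k + 1)

/-- The coefficient sequence of `V(x, y) = W(x) + y²`. -/
def seqV (W : Rn n → ℝ) : ℕ → Rn n → ℝ
  | 0 => W
  | 1 => 0
  | 2 => fun _ => 1
  | _ + 3 => 0

variable {a β γ δ : Rn n → Rn n} {W : Rn n → ℝ}

theorem isPoly_lyap (hW : ContDiff ℝ ∞ W) : IsPoly (lyap W) (seqV W) := by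
  refine ⟨fun k => ?_, 3, fun D hD z => ?_⟩
  · match k with
    | 0 => exact hW
    | 1 => exact contDiff_const
    | 2 => exact contDiff_const
    | _ + 3 => exact contDiff_const
  · obtain ⟨D, rfl⟩ : ∃ D', D = D' + 3 := ⟨D - 3, by omega⟩
    rw [Finset.sum_range_succ', Finset.sum_range_succ', Finset.sum_range_succ']
    simp [seqV, lyap, add_comm]

theorem IsPoly.lieD_drift (ha : ContDiff ℝ ∞ a) (hβ : ContDiff ℝ ∞ β) (hγ : ContDiff ℝ ∞ γ)
    (hδ : ContDiff ℝ ∞ δ) {h : RnR n → ℝ} {p : ℕ → Rn n → ℝ} (hp : IsPoly h p) :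
    IsPoly (lieD (drift a β γ δ) h) (stepF a β γ δ p) := by
  have := (((hp.horizD ha).add (hp.horizD hβ).snd_mul).add (hp.horizD hγ).snd_mul.snd_mul).add
    (hp.horizD hδ).snd_mul.snd_mul.snd_mul
  refine (congrArg (IsPoly · _) (funext fun z => ?_)).mp this
  have hz : drift a β γ δ z = WithLp.toLp 2 (a z.fst, 0) + z.snd • WithLp.toLp 2 (β z.fst, 0) +
      z.snd ^ 2 • WithLp.toLp 2 (γ z.fst, 0) + z.snd ^ 3 • WithLp.toLp 2 (δ z.fst, 0) := by
    simp only [drift, ← WithLp.toLp_smul, ← WithLp.toLp_add, Prod.smul_mk, Prod.mk_add_mk,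
      smul_zero, add_zero]
  simp only [lieD, hz, map_add, map_smul, SampledData.horizD, smul_eq_mul]
  ring

/-- The coefficient sequence of a word applied to `V`. -/
noncomputable def wordSeq (a β γ δ : Rn n → Rn n) (W : Rn n → ℝ) (l : List Bool) :
    ℕ → Rn n → ℝ :=
  l.foldr (fun c p => if c then stepG p else stepF a β γ δ p) (seqV W)

theorem isPoly_wordD (ha : ContDiff ℝ ∞ a) (hβ : ContDiff ℝ ∞ β) (hγ : ContDiff ℝ ∞ γ)
    (hδ : ContDiff ℝ ∞ δ) (hW : ContDiff ℝ ∞ W) (l : List Bool) :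
    IsPoly (wordD (drift a β γ δ) input (lyap W) l) (wordSeq a β γ δ W l) := by
  induction l with
  | nil => exact isPoly_lyap hW
  | cons c l ih =>
    cases c
    · exact ih.lieD_drift ha hβ hγ hδ
    · exact ih.lieD_input

@[simp] theorem shift_zero (p : ℕ → Rn n → ℝ) : shift p 0 = 0 := rfl

@[simp] theorem shift_succ (p : ℕ → Rn n → ℝ) (k : ℕ) : shift p (k + 1) = p k := rfl

theorem lieD_const_right {E : Type*} [NormedAddCommGroup E] [NormedSpace ℝ E] (X : E → E) (r : ℝ) :
    lieD X (fun _ => r) = 0 := by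
  funext x; simp [lieD]

/-- A word in `g` alone, if it is not empty, makes `V` independent of `x`. -/
theorem wordSeq_const_of_count_eq_zero {l : List Bool} (hl : l ≠ []) (h : l.count false = 0)
    (k : ℕ) : ∃ r : ℝ, wordSeq a β γ δ W l k = fun _ => r := by
  induction l generalizing k with
  | nil => exact absurd rfl hl
  | cons c l ih =>
    cases c
    · simp at h
    rcases eq_or_ne l [] with rfl | hl'
    · change ∃ r : ℝ, ((k : ℝ) + 1) • seqV W (k + 1) = fun _ => r
      match k with
      | 0 => exact ⟨0, by funext; simp [seqV]⟩
      | 1 => exact ⟨2, by funext; simp [seqV]; norm_num⟩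
      | _ + 2 => exact ⟨0, by funext; simp [seqV]⟩
    · obtain ⟨r, hr⟩ := ih hl' (by simpa using h) (k + 1)
      exact ⟨((k : ℝ) + 1) * r, by
        change ((k : ℝ) + 1) • wordSeq a β γ δ W l (k + 1) = _
        rw [hr]; rfl⟩

/-- The drift has no y-component, so it annihilates functions of y alone. -/
theorem stepF_eq_zero_of_const {p : ℕ → Rn n → ℝ} (h : ∀ k, ∃ r : ℝ, p k = fun _ => r) (k : ℕ) :
    stepF a β γ δ p k = 0 := by
  have h0 : ∀ (X : Rn n → Rn n), (fun k => lieD X (p k)) = fun _ => 0 := fun X => by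
    funext k
    obtain ⟨r, hr⟩ := h k
    rw [hr, lieD_const_right]
  have hs : shift (fun _ => (0 : Rn n → ℝ)) = fun _ => 0 := by
    funext k; cases k <;> rfl
  have := congrFun (h0 a) k
  simp only [stepF, h0, hs, this, add_zero]

end Coefficients

/-! ### The needed fields λ_{κ,j} expanded in words -/

section Generators

variable {E : Type*} [NormedAddCommGroup E] [NormedSpace ℝ E]

theorem contDiff_sub_pi {h k : E → ℝ} (hh : ContDiff ℝ ∞ h) (hk : ContDiff ℝ ∞ k) :
    ContDiff ℝ ∞ (h - k) := hh.sub hk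

theorem lieD_sub_right (X : E → E) {h k : E → ℝ} (hh : ContDiff ℝ ∞ h) (hk : ContDiff ℝ ∞ k) :
    lieD X (h - k) = lieD X h - lieD X k := by
  funext x
  simp [lieD, fderiv_sub (hh.differentiable (by simp) x) (hk.differentiable (by simp) x)]

variable {f g : E → E} {V : E → ℝ}

theorem lam_two_one : lam f g 2 1 = brk f g := by
  have : Finset.Nat.antidiagonalTuple 1 (2 - 1 - 1) = {![0]} := by decide
  rw [lam, this, Finset.sum_singleton]
  simp [nested]

theorem lam_three_one : lam f g 3 1 = brk (brk f g) f := by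
  have : Finset.Nat.antidiagonalTuple 1 (3 - 1 - 1) = {![1]} := by decide
  rw [lam, this, Finset.sum_singleton]
  simp [nested]

theorem lam_three_two : lam f g 3 2 = brk (brk f g) g := by
  have : Finset.Nat.antidiagonalTuple 2 (3 - 2 - 1) = {![0, 0]} := by decide
  rw [lam, this, Finset.sum_singleton]
  simp [nested]

theorem lam_four_three : lam f g 4 3 = brk (brk (brk f g) g) g := by
  have : Finset.Nat.antidiagonalTuple 3 (4 - 3 - 1) = {![0, 0, 0]} := by decide
  rw [lam, this, Finset.sum_singleton]
  simp [nested]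

theorem lam_five_three : lam f g 5 3 = brk (brk (brk (brk f g) f) g) g +
    (brk (brk (brk (brk f g) g) f) g + brk (brk (brk (brk f g) g) g) f) := by
  have : Finset.Nat.antidiagonalTuple 3 (5 - 3 - 1) = {![1, 0, 0], ![0, 1, 0], ![0, 0, 1]} := by
    decide
  have h1 : (![1, 0, 0] : Fin 3 → ℕ) ∉ ({![0, 1, 0], ![0, 0, 1]} : Finset (Fin 3 → ℕ)) := by decide
  have h2 : (![0, 1, 0] : Fin 3 → ℕ) ∉ ({![0, 0, 1]} : Finset (Fin 3 → ℕ)) := by decide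
  rw [lam, this, Finset.sum_insert h1, Finset.sum_insert h2, Finset.sum_singleton]
  simp [nested]

variable (hf : ContDiff ℝ ∞ f) (hg : ContDiff ℝ ∞ g) (hV : ContDiff ℝ ∞ V)
include hf hg hV

theorem lieD_lam_two_one (z : E) :
    lieD (lam f g 2 1) V z = wordD f g V [false, true] z - wordD f g V [true, false] z := by
  rw [lam_two_one, lieD_brk hf hg hV]; rfl

theorem lieD_lam_three_one (z : E) :
    lieD (lam f g 3 1) V z = 2 * wordD f g V [false, true, false] z -
      wordD f g V [true, false, false] z - wordD f g V [false, false, true] z := by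
  rw [lam_three_one]
  simp (maxDischargeDepth := 12) only [lieD_brk, contDiff_brk,
    contDiff_lieD, lieD_sub_right, hf, hg, hV, wordD,
    List.foldr_cons, List.foldr_nil, if_true, Pi.sub_apply, Bool.false_eq_true, if_false]
  ring

theorem lieD_lam_three_two (z : E) :
    lieD (lam f g 3 2) V z = wordD f g V [false, true, true] z -
      2 * wordD f g V [true, false, true] z + wordD f g V [true, true, false] z := by
  rw [lam_three_two]
  simp (maxDischargeDepth := 12) only [lieD_brk, contDiff_brk,
    contDiff_lieD, lieD_sub_right, hf, hg, hV, wordD,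
    List.foldr_cons, List.foldr_nil, if_true, Pi.sub_apply, Bool.false_eq_true, if_false]
  ring

theorem lieD_lam_four_three (z : E) :
    lieD (lam f g 4 3) V z = wordD f g V [false, true, true, true] z -
      3 * wordD f g V [true, false, true, true] z + 3 * wordD f g V [true, true, false, true] z -
      wordD f g V [true, true, true, false] z := by
  rw [lam_four_three]
  simp (maxDischargeDepth := 12) only [lieD_brk, contDiff_brk,
    contDiff_lieD, lieD_sub_right, contDiff_sub_pi, hf, hg, hV, wordD,
    List.foldr_cons, List.foldr_nil, if_true, Pi.sub_apply, Bool.false_eq_true, if_false]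
  ring

/-- Bracketing on the right with a letter changes the sign of the coefficient sum over words ending
in f. After four brackets this sum is 1 for each of the three summands, and words ending in g do not
contribute. -/
theorem lieD_lam_five_three {z : E} {r : ℝ} (h0 : ∀ l : List Bool, l.length = 4 → l.count true = 2 →
      wordD f g V (l ++ [true]) z = 0)
    (hr : ∀ l : List Bool, l.length = 4 → l.count true = 3 →
      wordD f g V (l ++ [false]) z = r) : lieD (lam f g 5 3) V z = 3 * r := by
  have a1 := h0 [false, false, true, true] rfl rfl
  have a2 := h0 [false, true, false, true] rfl rfl
  have a3 := h0 [false, true, true, false] rfl rfl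
  have a4 := h0 [true, false, false, true] rfl rfl
  have a5 := h0 [true, false, true, false] rfl rfl
  have a6 := h0 [true, true, false, false] rfl rfl
  have b1 := hr [false, true, true, true] rfl rfl
  have b2 := hr [true, false, true, true] rfl rfl
  have b3 := hr [true, true, false, true] rfl rfl
  have b4 := hr [true, true, true, false] rfl rfl
  simp only [wordD, List.cons_append, List.nil_append, List.foldr_cons, List.foldr_nil, if_true,
    Bool.false_eq_true, if_false] at a1 a2 a3 a4 a5 a6 b1 b2 b3 b4
  rw [lam_five_three]
  simp (maxDischargeDepth := 12) only [lieD_add_left, lieD_brk, contDiff_brk,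
    contDiff_lieD, lieD_sub_right, contDiff_sub_pi, hf, hg, hV,
    Pi.sub_apply, Pi.add_apply, a1, a2, a3, a4, a5, a6, b1, b2, b3, b4]
  ring

end Generators

/-! ### First and second order conditions at a maximum -/

section Calculus

variable {E : Type*} [NormedAddCommGroup E] [NormedSpace ℝ E]

theorem lieD_congr {h k : E → ℝ} {x : E} (X : E → E) (hk : h =ᶠ[𝓝 x] k) :
    lieD X h =ᶠ[𝓝 x] lieD X k := by
  filter_upwards [hk.fderiv (𝕜 := ℝ)] with y hy
  rw [lieD, hy, lieD]

theorem lieD_eventuallyEq_zero {h : E → ℝ} {x : E} (X : E → E) (hk : h =ᶠ[𝓝 x] 0) :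
    lieD X h =ᶠ[𝓝 x] 0 := by
  have := lieD_congr X hk
  rwa [lieD_zero_right] at this

theorem lieD_eq_zero_of_eventually_le {h : E → ℝ} {x : E} (X : E → E) (hle : ∀ᶠ y in 𝓝 x, h y ≤ 0)
    (hx : h x = 0) : lieD X h x = 0 := by
  have : IsLocalMax h x := by
    filter_upwards [hle] with y hy
    rwa [hx]
  simp [lieD, this.fderiv_eq_zero]

/-- The gradient vanishes at the maximum, so only the Hessian in the direction X x survives. Were it
positive, the restriction of h to that line would have both a local minimum and a maximum, hence be
locally constant. -/
theorem lieD_lieD_nonpos {h : E → ℝ} {X : E → E} {x : E} (hX : ContDiff ℝ ∞ X)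
    (hh : ContDiff ℝ ∞ h) (hle : ∀ y, h y ≤ 0) (hx : h x = 0) : lieD X (lieD X h) x ≤ 0 := by
  by_contra! hpos
  set v := X x with hv
  have hD : fderiv ℝ h x = 0 := by
    have : IsLocalMax h x := Eventually.of_forall fun y => by rw [hx]; exact hle y
    exact this.fderiv_eq_zero
  have hd : Differentiable ℝ h := hh.differentiable (by simp)
  have hdd : Differentiable ℝ (fderiv ℝ h) :=
    (hh.fderiv_right (m := ∞) (by simp)).differentiable (by simp)
  set ψ : ℝ → ℝ := fun t => h (x + t • v)
  have hline : ∀ t : ℝ, HasDerivAt (fun t : ℝ => x + t • v) v t := fun t => by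
    simpa using ((hasDerivAt_id t).smul_const v).const_add x
  have h1 : ∀ t, HasDerivAt ψ (fderiv ℝ h (x + t • v) v) t := fun t =>
    (hd _).hasFDerivAt.comp_hasDerivAt t (hline t)
  have h1' : deriv ψ = fun t => fderiv ℝ h (x + t • v) v := funext fun t => (h1 t).deriv
  have h2 : HasDerivAt (deriv ψ) (fderiv ℝ (fderiv ℝ h) x v v) 0 := by
    rw [h1']
    have := (hdd (x + (0 : ℝ) • v)).hasFDerivAt.comp_hasDerivAt (0 : ℝ) (hline 0)
    have := (ContinuousLinearMap.apply ℝ ℝ v).hasFDerivAt.comp_hasDerivAt (0 : ℝ) this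
    rw [zero_smul, add_zero] at this
    exact this
  have h3 : lieD X (lieD X h) x = fderiv ℝ (fderiv ℝ h) x v v := by
    change fderiv ℝ (fun y => fderiv ℝ h y (X y)) x (X x) = _
    rw [fderiv_clm_apply (hdd x) (hX.differentiable (by simp) x)]
    simp [hD, hv]
  have hmin : IsLocalMin ψ 0 := by
    refine isLocalMin_of_deriv_deriv_pos ?_ ?_ (h1 0).continuousAt
    · rw [h2.deriv, ← h3]; exact hpos
    · rw [h1']; simp [hD]
  have hzero : ψ =ᶠ[𝓝 0] fun _ => 0 := by
    filter_upwards [hmin] with t ht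
    refine le_antisymm (hle _) ?_
    simpa [ψ, hx] using ht
  have : deriv (deriv ψ) 0 = 0 := by
    rw [hzero.deriv.deriv_eq]
    simp
  rw [h2.deriv, ← h3] at this
  exact hpos.ne' this

end Calculus

/-! ### Coefficients of words for the cascade -/

section CascadeLie

theorem fderiv_add_apply_of_hasFDerivAt {E : Type*} [NormedAddCommGroup E] [NormedSpace ℝ E]
    {h φ ψ : E → ℝ} {z v : E} {r s : ℝ} (hh : ∀ w, h w = φ w + ψ w)
    (hφ : ∃ L : E →L[ℝ] ℝ, HasFDerivAt φ L z ∧ L v = r)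
    (hψ : ∃ L : E →L[ℝ] ℝ, HasFDerivAt ψ L z ∧ L v = s) : fderiv ℝ h z v = r + s := by
  obtain ⟨L, hL, rfl⟩ := hφ
  obtain ⟨M, hM, rfl⟩ := hψ
  rw [show h = fun w => φ w + ψ w from funext hh, (hL.fun_add hM).fderiv]
  rfl

variable {n : ℕ} {a β γ δ : Rn n → Rn n} {W : Rn n → ℝ}

theorem fderiv_lyap_apply (hW : ContDiff ℝ ∞ W) (z v : RnR n) :
    fderiv ℝ (lyap W) z v = fderiv ℝ W z.fst v.fst + 2 * z.snd * v.snd := by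
  rw [fderiv_add_apply_of_hasFDerivAt (h := lyap W) (fun w => by simp [lyap])
    (hasFDerivAt_monomial hW 0 z v) (hasFDerivAt_monomial (contDiff_const (c := (1 : ℝ))) 2 z v)]
  simp

theorem lieD_input_lyap (hW : ContDiff ℝ ∞ W) (z : RnR n) :
    lieD input (lyap W) z = 2 * z.snd := by
  have h1 : (input z).fst = 0 := rfl
  have h2 : (input z).snd = 1 := rfl
  rw [lieD, fderiv_lyap_apply hW, h1, h2]
  simp

theorem lieD_drift_lyap (hW : ContDiff ℝ ∞ W) (z : RnR n) :
    lieD (drift a β γ δ) (lyap W) z = lieD a W z.fst + z.snd * lieD β W z.fst +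
      z.snd ^ 2 * lieD γ W z.fst + z.snd ^ 3 * lieD δ W z.fst := by
  have h1 : (drift a β γ δ z).fst =
    a z.fst + z.snd • β z.fst + z.snd ^ 2 • γ z.fst + z.snd ^ 3 • δ z.fst := rfl
  have h2 : (drift a β γ δ z).snd = 0 := rfl
  rw [lieD, fderiv_lyap_apply hW, h1, h2]
  simp [lieD]

theorem wordSeq_true (l : List Bool) (k : ℕ) :
    wordSeq a β γ δ W (true :: l) k = ((k : ℝ) + 1) • wordSeq a β γ δ W l (k + 1) := rfl

theorem wordSeq_false (l : List Bool) (k : ℕ) :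
    wordSeq a β γ δ W (false :: l) k = stepF a β γ δ (wordSeq a β γ δ W l) k := rfl

theorem wordSeq_f_zero (l : List Bool) :
    wordSeq a β γ δ W (false :: l) 0 = lieD a (wordSeq a β γ δ W l 0) := by
  simp [wordSeq_false, stepF]

theorem wordSeq_f_one (l : List Bool) : wordSeq a β γ δ W (false :: l) 1 =
    lieD a (wordSeq a β γ δ W l 1) + lieD β (wordSeq a β γ δ W l 0) := by
  simp [wordSeq_false, stepF, shift]

theorem wordSeq_f_two (l : List Bool) : wordSeq a β γ δ W (false :: l) 2 =
    lieD a (wordSeq a β γ δ W l 2) + lieD β (wordSeq a β γ δ W l 1) +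
      lieD γ (wordSeq a β γ δ W l 0) := by
  simp [wordSeq_false, stepF, shift]

theorem wordSeq_f_three (l : List Bool) : wordSeq a β γ δ W (false :: l) 3 =
    lieD a (wordSeq a β γ δ W l 3) + lieD β (wordSeq a β γ δ W l 2) +
      lieD γ (wordSeq a β γ δ W l 1) + lieD δ (wordSeq a β γ δ W l 0) := by
  simp [wordSeq_false, stepF, shift]

theorem wordSeq_single_zero : wordSeq a β γ δ W [false] 0 = lieD a W := wordSeq_f_zero _

theorem wordSeq_single_one : wordSeq a β γ δ W [false] 1 = lieD β W := by
  rw [wordSeq_f_one]; simp [wordSeq, seqV, lieD_zero_right]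

theorem wordSeq_single_two : wordSeq a β γ δ W [false] 2 = lieD γ W := by
  rw [wordSeq_f_two]; simp [wordSeq, seqV, lieD_zero_right, lieD_const_right]

theorem wordSeq_single_three : wordSeq a β γ δ W [false] 3 = lieD δ W := by
  rw [wordSeq_f_three]; simp [wordSeq, seqV, lieD_zero_right, lieD_const_right]

/-- Words that contain `f` and end with `g` annihilate `V`. -/
theorem wordSeq_append_true {l : List Bool} (h : false ∈ l) :
    wordSeq a β γ δ W (l ++ [true]) = fun _ => 0 := by
  induction l with
  | nil => simp at h
  | cons c l ih =>
    by_cases hl : false ∈ l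
    · have hi := ih hl
      funext k
      cases c
      · rw [List.cons_append, wordSeq_false, hi]
        exact stepF_eq_zero_of_const (fun _ => ⟨0, rfl⟩) k
      · rw [List.cons_append, wordSeq_true, hi, smul_zero]
    · obtain rfl : c = false := by
        cases c
        · rfl
        · simp [hl] at h
      funext k
      rw [List.cons_append, wordSeq_false]
      exact stepF_eq_zero_of_const
        (wordSeq_const_of_count_eq_zero (by simp) (by simpa [List.count_eq_zero] using hl)) k

theorem stepF_eventually_zero {p : ℕ → Rn n → ℝ} {x : Rn n} {s : ℕ}
    -- The terms with β, γ, δ enter coefficient k only from coefficients below k, so the lowest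
    -- surviving one sees a alone.
    (h : ∀ k < s, p k =ᶠ[𝓝 x] 0) :
    (∀ k < s, stepF a β γ δ p k =ᶠ[𝓝 x] 0) ∧ stepF a β γ δ p s =ᶠ[𝓝 x] lieD a (p s) := by
  have hs : ∀ {q : ℕ → Rn n → ℝ} {s : ℕ}, (∀ k < s, q k =ᶠ[𝓝 x] 0) →
      ∀ k < s + 1, shift q k =ᶠ[𝓝 x] 0 := by
    intro q s hq k hk
    cases k with
    | zero => exact EventuallyEq.rfl
    | succ k => exact hq k (by omega)
  have hX : ∀ (X : Rn n → Rn n), ∀ k < s, lieD X (p k) =ᶠ[𝓝 x] 0 := fun X k hk =>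
    lieD_eventuallyEq_zero X (h k hk)
  have h1 := hs (hX β)
  have h2 := hs (hs (hX γ))
  have h3 := hs (hs (hs (hX δ)))
  refine ⟨fun k hk => ?_, ?_⟩
  · have := (((hX a k hk).add (h1 k (by omega))).add (h2 k (by omega))).add (h3 k (by omega))
    simpa [stepF] using this
  · have := (((EventuallyEq.refl (𝓝 x) (lieD a (p s))).add (h1 s (by omega))).add
      (h2 s (by omega))).add (h3 s (by omega))
    simpa [stepF] using this

theorem contDiff_iterate_lieD (ha : ContDiff ℝ ∞ a) {h : Rn n → ℝ} (hh : ContDiff ℝ ∞ h) (r : ℕ) :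
    ContDiff ℝ ∞ ((lieD a)^[r] h) := by
  induction r with
  | zero => exact hh
  | succ r ih => rw [Function.iterate_succ_apply']; exact contDiff_lieD ha ih

/-- Where `aW` and `βW` vanish identically, words with at most two letters `g` see `γW` only. -/
theorem wordSeq_local (ha : ContDiff ℝ ∞ a) (hγ : ContDiff ℝ ∞ γ) (hW : ContDiff ℝ ∞ W) {x : Rn n}
    (h0 : lieD a W =ᶠ[𝓝 x] 0) (h1 : lieD β W =ᶠ[𝓝 x] 0) (l : List Bool) (hq : l.count true ≤ 2) :
    l.count false = 0 ∨ ((∀ k < 2 - l.count true, wordSeq a β γ δ W l k =ᶠ[𝓝 x] 0) ∧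
      ∃ c : ℝ, wordSeq a β γ δ W l (2 - l.count true) =ᶠ[𝓝 x]
        c • (lieD a)^[l.count false - 1] (lieD γ W)) := by
  induction l with
  | nil => left; rfl
  | cons c l ih =>
    cases c
    · right
      simp only [List.count_cons_self, Nat.add_sub_cancel]
      rw [List.count_cons_of_ne (by simp)] at hq ⊢
      by_cases hc0 : l.count false = 0
      · rw [hc0]
        rcases eq_or_ne l [] with rfl | hl
        · refine ⟨fun k hk => ?_, 1, ?_⟩
          · have hk' : k < 2 := hk
            interval_cases k
            · rw [wordSeq_single_zero]; exact h0
            · rw [wordSeq_single_one]; exact h1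
          · simp [wordSeq_single_two]
        · have := stepF_eq_zero_of_const (a := a) (β := β) (γ := γ) (δ := δ)
            (wordSeq_const_of_count_eq_zero (a := a) (β := β) (γ := γ) (δ := δ) (W := W) hl hc0)
          exact ⟨fun k _ => by rw [wordSeq_false, this], 0, by rw [wordSeq_false, this, zero_smul]⟩
      · obtain ⟨hz, c, hc⟩ := (ih hq).resolve_left hc0
        obtain ⟨hz', hs⟩ := stepF_eventually_zero (a := a) (β := β) (γ := γ) (δ := δ) hz
        refine ⟨hz', c, hs.trans ?_⟩
        have := lieD_congr a hc
        rw [lieD_smul_right _ _ (contDiff_iterate_lieD ha (contDiff_lieD hγ hW) _),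
          ← Function.iterate_succ_apply' (lieD a)] at this
        rwa [Nat.succ_eq_add_one, Nat.sub_add_cancel (Nat.pos_of_ne_zero hc0)] at this
    · rw [List.count_cons_self] at hq
      simp only [List.count_cons_self]
      rw [List.count_cons_of_ne (by simp)]
      rcases ih (by omega) with hc | ⟨hz, c, hc⟩
      · exact Or.inl hc
      · right
        have he : 2 - (l.count true + 1) + 1 = 2 - l.count true := by omega
        refine ⟨fun k hk => ?_, (((2 - (l.count true + 1) : ℕ) : ℝ) + 1) * c, ?_⟩
        · rw [wordSeq_true]
          have := (hz (k + 1) (by omega)).const_smul ((k : ℝ) + 1)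
          simpa using this
        · rw [wordSeq_true, he, mul_smul]
          exact hc.const_smul _

end CascadeLie

theorem eq_of_length_four {l : List Bool} (h : l.length = 4) (hc : l.count true = 3) :
    l = [true, true, true, false] ∨ l = [true, true, false, true] ∨
      l = [true, false, true, true] ∨ l = [false, true, true, true] := by
  match l, h with
  | [a, b, c, d], _ => revert a b c d; decide

/-! ### The Lie algebraic alternatives on E₂, E₃, E₄ and E₅ -/

section Alternatives

variable {n : ℕ} {a β γ δ : Rn n → Rn n} {W : Rn n → ℝ}
  (ha : ContDiff ℝ ∞ a) (hβ : ContDiff ℝ ∞ β) (hγ : ContDiff ℝ ∞ γ) (hδ : ContDiff ℝ ∞ δ)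
  (hW : ContDiff ℝ ∞ W)

/-- The third case of the Lie algebraic conditions, in a form that implies both versions. -/
def LieAlternative (f g : RnR n → RnR n) (V : RnR n → ℝ) (z : RnR n) : Prop :=
  ∃ N : ℕ, 1 ≤ N ∧ VanishUpTo f g V z N ∧ (lieDIter f V (N + 1) z < 0 ∨
    (lieDIter f V (N + 1) z ≤ 0 ∧ (AltOddLow f g V z N ∨ AltEvenStrong f g V z N)))

include ha hβ hγ hδ hW

theorem wordD_eval (l : List Bool) {z : RnR n} (hz : z.snd = 0) :
    wordD (drift a β γ δ) input (lyap W) l z = wordSeq a β γ δ W l 0 z.fst :=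
  (isPoly_wordD ha hβ hγ hδ hW l).eval hz

theorem lieAlternative_of_beta_ne (hle : ∀ x, lieD a W x ≤ 0) {z : RnR n} (hz : z.snd = 0)
    (h0 : lieD a W z.fst = 0) (h1 : lieD β W z.fst ≠ 0) :
    LieAlternative (drift a β γ δ) input (lyap W) z := by
  have hf := contDiff_drift ha hβ hγ hδ
  have hV := contDiff_lyap hW
  have ew := wordD_eval ha hβ hγ hδ hW (z := z) (hz := hz)
  refine ⟨1, le_rfl, vanishUpTo_of_words hf contDiff_input hV fun l hl hc => ?_,
    Or.inr ⟨?_, Or.inl ⟨1, odd_one, le_rfl, le_rfl, ?_, fun q _ h h' => by omega⟩⟩⟩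
  · match l, hl with
    | [], _ => simp at hc
    | [true], _ => simp at hc
    | [false], _ => rw [ew, wordSeq_single_zero, h0]
  · change wordD (drift a β γ δ) input (lyap W) [false, false] z ≤ 0
    rw [ew, wordSeq_f_zero, wordSeq_single_zero,
      lieD_eq_zero_of_eventually_le a (Eventually.of_forall hle) h0]
  · rw [lieD_lam_two_one hf contDiff_input hV, ew, ew, wordSeq_true, wordSeq_single_one,
      show [false, true] = [false] ++ [true] from rfl, wordSeq_append_true (by simp)]
    simpa using h1

theorem lieAlternative_of_gamma_neg (hle : ∀ x, lieD a W x ≤ 0) {z : RnR n} (hz : z.snd = 0)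
    (h0 : lieD a W z.fst = 0) (h1 : lieD β W z.fst = 0) (h2 : lieD γ W z.fst < 0) :
    LieAlternative (drift a β γ δ) input (lyap W) z := by
  have hf := contDiff_drift ha hβ hγ hδ
  have hV := contDiff_lyap hW
  have ew := wordD_eval ha hβ hγ hδ hW (z := z) (hz := hz)
  have hX : ∀ X : Rn n → Rn n, lieD X (lieD a W) z.fst = 0 := fun X =>
    lieD_eq_zero_of_eventually_le X (Eventually.of_forall hle) h0
  have eg : ∀ l : List Bool, false ∈ l → wordD (drift a β γ δ) input (lyap W) (l ++ [true]) z = 0 :=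
    fun l hl => by rw [ew, wordSeq_append_true hl]; rfl
  have ef : wordD (drift a β γ δ) input (lyap W) [false] z = 0 := by
    rw [ew, wordSeq_single_zero, h0]
  have eff : wordD (drift a β γ δ) input (lyap W) [false, false] z = 0 := by
    rw [ew, wordSeq_f_zero, wordSeq_single_zero, hX]
  have egf : wordD (drift a β γ δ) input (lyap W) [true, false] z = 0 := by
    rw [ew, wordSeq_true, wordSeq_single_one]; simp [h1]
  have efff : wordD (drift a β γ δ) input (lyap W) [false, false, false] z =
      lieD a (lieD a (lieD a W)) z.fst := by
    rw [ew, wordSeq_f_zero, wordSeq_f_zero, wordSeq_single_zero]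
  have egff : wordD (drift a β γ δ) input (lyap W) [true, false, false] z =
      lieD a (lieD β W) z.fst := by
    rw [ew, wordSeq_true, wordSeq_f_one, wordSeq_single_one, wordSeq_single_zero]; simp [hX]
  have efgf : wordD (drift a β γ δ) input (lyap W) [false, true, false] z =
      lieD a (lieD β W) z.fst := by
    rw [ew, wordSeq_f_zero, wordSeq_true, wordSeq_single_one]; simp
  have eggf : wordD (drift a β γ δ) input (lyap W) [true, true, false] z =
      2 * lieD γ W z.fst := by
    rw [ew, wordSeq_true, wordSeq_true, wordSeq_single_two]; simp; norm_num
  have hnonpos : lieD a (lieD a (lieD a W)) z.fst ≤ 0 :=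
    lieD_lieD_nonpos ha (contDiff_lieD ha hW) hle h0
  refine ⟨2, one_le_two, vanishUpTo_of_words hf contDiff_input hV fun l hl hc => ?_, ?_⟩
  · match l, hl with
    | [], _ => simp at hc
    | [true], _ => simp at hc
    | [false], _ => exact ef
    | [false, false], _ => exact eff
    | [true, false], _ => exact egf
    | [false, true], _ => exact eg [false] (by simp)
    | [true, true], _ => simp at hc
  have hiter : lieDIter (drift a β γ δ) (lyap W) (2 + 1) z = lieD a (lieD a (lieD a W)) z.fst :=
    efff
  rw [hiter]
  rcases hnonpos.lt_or_eq with hlt | heq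
  · exact Or.inl hlt
  refine Or.inr ⟨hnonpos, ?_⟩
  have e31 : lieD (lam (drift a β γ δ) input (2 + 1) 1) (lyap W) z = lieD a (lieD β W) z.fst := by
    have e1 : wordD (drift a β γ δ) input (lyap W) [false, false, true] z = 0 :=
      eg [false, false] (by simp)
    rw [lieD_lam_three_one hf contDiff_input hV, efgf, egff, e1]; ring
  -- With f³V = 0, the value a(βW) = λ_{3,1}V decides: if nonzero, j = 1 works; if zero, all words
  -- with at most one g vanish and λ_{3,2}V = 2γW < 0 applies.
  by_cases h3 : lieD a (lieD β W) z.fst = 0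
  · refine Or.inr ⟨⟨even_two, ?_⟩, fun q hq => vanishAt_of_words hf contDiff_input hV
      fun l hl hc hlq => ?_⟩
    · have e1 : wordD (drift a β γ δ) input (lyap W) [false, true, true] z = 0 :=
        eg [false, true] (by simp)
      have e2 : wordD (drift a β γ δ) input (lyap W) [true, false, true] z = 0 :=
        eg [true, false] (by simp)
      rw [lieD_lam_three_two hf contDiff_input hV, eggf, e1, e2]
      linarith
    · rw [heq] at efff
      rw [h3] at egff efgf
      match l, hl with
      | [], _ => simp at hc
      | [true], _ => simp at hc
      | [false], _ => exact ef
      | [false, false], _ => exact eff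
      | [true, false], _ => exact egf
      | [false, true], _ => exact eg [false] (by simp)
      | [true, true], _ => simp at hc
      | [false, false, false], _ => exact efff
      | [true, false, false], _ => exact egff
      | [false, true, false], _ => exact efgf
      | [c, false, true], _ => exact eg [c, false] (by simp)
      | [false, true, true], _ => exact eg [false, true] (by simp)
      | [true, true, c], _ => simp at hlq; omega
  · exact Or.inl ⟨1, odd_one, le_rfl, one_le_two, e31 ▸ h3, fun q _ h h' => by omega⟩

section Local

variable {z : RnR n} (hz : z.snd = 0) (h0 : lieD a W =ᶠ[𝓝 z.fst] 0)
  (h1 : lieD β W =ᶠ[𝓝 z.fst] 0) (h2 : ∀ᶠ x in 𝓝 z.fst, lieD γ W x ≤ 0) (h2' : lieD γ W z.fst = 0)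

include hz h0 h1

/-- With fewer than two letters g the zeroth coefficient lies below the first surviving one; with
exactly two it is a multiple of an iterated derivative of γW along a. -/
theorem wordD_eq_zero_of_count_le (l : List Bool) (hc : l.count true < l.length)
    (hq : l.count true ≤ 2)
    (hG : l.count true = 2 → (lieD a)^[l.length - 3] (lieD γ W) z.fst = 0) :
    wordD (drift a β γ δ) input (lyap W) l z = 0 := by
  rw [wordD_eval ha hβ hγ hδ hW l hz]
  have hlen : l.count true + l.count false = l.length := List.count_true_add_count_false l
  rcases wordSeq_local (δ := δ) ha hγ hW h0 h1 l hq with h | ⟨hlow, c, hc'⟩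
  · omega
  · rcases hq.lt_or_eq with hlt | heq
    · exact (hlow 0 (by omega)).self_of_nhds
    · rw [heq] at hc'
      rw [hc'.self_of_nhds, show l.count false - 1 = l.length - 3 by omega]
      simp [hG heq]

include h2 h2'

/-- Take N = j = 3, so that q = 2 is the only q to check. The words then involve γW and a(γW), both
zero because γW has a local maximum at the point. -/
theorem lieAlternative_of_delta_ne (h3 : lieD δ W z.fst ≠ 0) :
    LieAlternative (drift a β γ δ) input (lyap W) z := by
  have hf := contDiff_drift ha hβ hγ hδ
  have hV := contDiff_lyap hW
  have ew := wordD_eval ha hβ hγ hδ hW (z := z) (hz := hz)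
  have key := wordD_eq_zero_of_count_le ha hβ hγ hδ hW hz h0 h1
  have hG : ∀ m ≤ 4, (lieD a)^[m - 3] (lieD γ W) z.fst = 0 := fun m hm => by
    rcases Nat.lt_or_ge 3 m with h | h
    · rw [show m - 3 = 1 by omega]
      exact lieD_eq_zero_of_eventually_le a h2 h2'
    · rw [show m - 3 = 0 by omega]; exact h2'
  have eg : ∀ l : List Bool, false ∈ l → wordD (drift a β γ δ) input (lyap W) (l ++ [true]) z = 0 :=
    fun l hl => by rw [ew, wordSeq_append_true hl]; rfl
  refine ⟨3, by norm_num, vanishUpTo_of_words hf contDiff_input hV fun l hl hc =>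
    key l hc (by omega) fun _ => hG _ (by omega), Or.inr ⟨?_, Or.inl ⟨3, ⟨1, rfl⟩, by norm_num,
      le_rfl,
      ?_, fun q hq hq0 hq3 => vanishAt_of_words hf contDiff_input hV fun l hl hc hlq =>
        key l hc (by omega) fun _ => hG _ hl⟩⟩⟩
  · exact (key [false, false, false, false] (by simp) (by simp) (by simp)).le
  · have e1 : wordD (drift a β γ δ) input (lyap W) [false, true, true, true] z = 0 :=
      eg [false, true, true] (by simp)
    have e2 : wordD (drift a β γ δ) input (lyap W) [true, false, true, true] z = 0 :=
      eg [true, false, true] (by simp)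
    have e3 : wordD (drift a β γ δ) input (lyap W) [true, true, false, true] z = 0 :=
      eg [true, true, false] (by simp)
    rw [lieD_lam_four_three hf contDiff_input hV, e1, e2, e3, ew, wordSeq_true, wordSeq_true,
      wordSeq_true, wordSeq_single_three]
    simpa [add_eq_zero_iff_of_nonneg] using h3

theorem lieAlternative_of_bracket_ne (h3 : lieD δ W z.fst = 0)
    (h4 : lieD (brk (brk a γ) a) W z.fst = 0) (h5 : lieD (brk a δ) W z.fst ≠ 0) :
    LieAlternative (drift a β γ δ) input (lyap W) z := by
  have hf := contDiff_drift ha hβ hγ hδ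
  have hV := contDiff_lyap hW
  have hA := contDiff_lieD ha hW
  have hG' := contDiff_lieD hγ hW
  have hD := contDiff_lieD hδ hW
  have ew := wordD_eval ha hβ hγ hδ hW (z := z) (hz := hz)
  have key := wordD_eq_zero_of_count_le ha hβ hγ hδ hW hz h0 h1
  have hsD := fun (c : ℝ) (X : Rn n → Rn n) => lieD_smul_right X c hD
  have hsG := fun (c : ℝ) (X : Rn n → Rn n) => lieD_smul_right X c hG'
  have hsB := fun (c : ℝ) (X : Rn n → Rn n) => lieD_smul_right X c (contDiff_lieD hβ hW)
  have hXA : ∀ X : Rn n → Rn n, lieD X (lieD a W) =ᶠ[𝓝 z.fst] 0 := fun X =>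
    lieD_eventuallyEq_zero X h0
  have hXA0 : ∀ X : Rn n → Rn n, lieD X (lieD a W) z.fst = 0 := fun X => (hXA X).self_of_nhds
  have hXB : ∀ X : Rn n → Rn n, lieD X (lieD β W) z.fst = 0 := fun X =>
    (lieD_eventuallyEq_zero X h1).self_of_nhds
  have hXG : ∀ X : Rn n → Rn n, lieD X (lieD γ W) z.fst = 0 := fun X =>
    lieD_eq_zero_of_eventually_le X h2 h2'
  -- Near the point aW = 0, so [[a,γ],a]W reduces to -a(a(γW)). Words with two letters g and length
  -- five need exactly this value.
  have haaG : lieD a (lieD a (lieD γ W)) z.fst = 0 := by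
    rw [lieD_brk (contDiff_brk ha hγ) ha hW, Pi.sub_apply, (hXA _).self_of_nhds] at h4
    have hcongr : lieD (brk a γ) W =ᶠ[𝓝 z.fst] lieD a (lieD γ W) := by
      rw [lieD_brk ha hγ hW]
      simpa using (EventuallyEq.refl _ (lieD a (lieD γ W))).sub (hXA γ)
    rw [(lieD_congr a hcongr).self_of_nhds] at h4
    simpa using h4
  have haD : lieD a (lieD δ W) z.fst ≠ 0 := by
    rw [lieD_brk ha hδ hW, Pi.sub_apply, (hXA δ).self_of_nhds] at h5
    simpa using h5
  have hG : ∀ m ≤ 5, (lieD a)^[m - 3] (lieD γ W) z.fst = 0 := fun m hm => by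
    rcases Nat.lt_or_ge 3 m with h | h
    · rcases Nat.lt_or_ge 4 m with h' | h'
      · rw [show m - 3 = 2 by omega]; exact haaG
      · rw [show m - 3 = 1 by omega]; exact hXG a
    · rw [show m - 3 = 0 by omega]; exact h2'
  have eg : ∀ l : List Bool, false ∈ l → wordD (drift a β γ δ) input (lyap W) (l ++ [true]) z = 0 :=
    fun l hl => by rw [ew, wordSeq_append_true hl]; rfl
  refine ⟨4, by norm_num, vanishUpTo_of_words hf contDiff_input hV fun l hl hc => ?_,
    Or.inr ⟨?_, Or.inl ⟨3, ⟨1, rfl⟩, by norm_num, by norm_num,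
      ?_, fun q hq hq0 hq3 => vanishAt_of_words hf contDiff_input hV fun l hl hc hlq =>
        key l hc (by omega) fun _ => hG _ hl⟩⟩⟩
  · by_cases hq : l.count true ≤ 2
    · exact key l hc hq fun _ => hG _ (by omega)
    -- Words with three letters g and one f are beyond `key`: gggf gives 6 δW = 0, the others end
    -- with g.
    rcases eq_of_length_four (l := l) (by omega) (by omega) with rfl | rfl | rfl | rfl
    · rw [ew, wordSeq_true, wordSeq_true, wordSeq_true, wordSeq_single_three]
      simp [h3]
    · exact eg [true, true, false] (by simp)
    · exact eg [true, false, true] (by simp)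
    · exact eg [false, true, true] (by simp)
  · exact (key [false, false, false, false, false] (by simp) (by simp) (by simp)).le
  · have hval : lieD (lam (drift a β γ δ) input (4 + 1) 3) (lyap W) z =
        3 * (6 * lieD a (lieD δ W) z.fst) := by
      refine lieD_lam_five_three hf contDiff_input hV (fun l h4 hc => eg l ?_) fun l h4 hc => ?_
      · by_contra hl
        have hlen : l.count true + l.count false = l.length := List.count_true_add_count_false l
        rw [List.count_eq_zero.2 hl] at hlen
        omega
      · rw [ew]
        rcases eq_of_length_four h4 hc with rfl | rfl | rfl | rfl <;>
          simp only [List.cons_append, List.nil_append, wordSeq_true, zero_add,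
            one_add_one_eq_two, Nat.reduceAdd]
        · rw [wordSeq_f_three]
          simp only [wordSeq_single_zero, wordSeq_single_one, wordSeq_single_two,
            wordSeq_single_three, Pi.add_apply, Pi.smul_apply, smul_eq_mul, hXG, hXB, hXA0]
          push_cast
          ring
        · rw [wordSeq_f_two]
          simp only [wordSeq_true, wordSeq_single_one, wordSeq_single_two,
            wordSeq_single_three, zero_add, one_add_one_eq_two, Nat.reduceAdd, hsD, hsG, hsB,
            Pi.add_apply, Pi.smul_apply, smul_eq_mul, hXG, hXB]
          push_cast
          ring
        · rw [wordSeq_f_one]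
          simp only [wordSeq_true, wordSeq_single_two, wordSeq_single_three, zero_add,
            one_add_one_eq_two, Nat.reduceAdd, smul_smul, hsD, hsG, Pi.add_apply, Pi.smul_apply,
            smul_eq_mul, hXG]
          push_cast
          ring
        · rw [wordSeq_f_zero]
          simp only [wordSeq_true, wordSeq_single_three, zero_add, one_add_one_eq_two,
            Nat.reduceAdd, smul_smul, hsD, Pi.smul_apply, smul_eq_mul]
          push_cast
          ring
    rw [hval]
    simpa using haD

end Local

end Alternatives

/-! ### Conditions (A) and (B) -/

section Conditions

variable {n : ℕ} {a β γ δ : Rn n → Rn n} {W : Rn n → ℝ}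

theorem isLyapunovCandidate_lyap (hW : IsLyapunovCandidate W) :
    IsLyapunovCandidate (lyap W : RnR n → ℝ) where
  smooth := contDiff_lyap hW.smooth
  zero := by simp [lyap, hW.zero]
  pos z hz := by
    rcases eq_or_ne z.fst 0 with h | h
    · have hs : z.snd ≠ 0 := fun hs => hz (WithLp.ofLp_injective 2 (Prod.ext h hs))
      have := hW.nonneg z.fst
      have := sq_pos_of_ne_zero hs
      simp only [lyap]
      linarith
    · have := hW.pos _ h
      have := sq_nonneg z.snd
      simp only [lyap]
      linarith
  proper := by
    refine tendsto_atTop.2 fun B => mem_cocompact'.2 ⟨(fun p => WithLp.toLp 2 p) ''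
      ({x | W x ≤ B} ×ˢ Icc (-(B + 1)) (B + 1)), ?_, fun z hz => ?_⟩
    · exact ((hW.isCompact_sublevel B).prod isCompact_Icc).image
        (WithLp.prodContinuousLinearEquiv 2 ℝ (Rn n) ℝ).symm.continuous
    · have hz' : W z.fst + z.snd ^ 2 < B := not_le.1 hz
      have := hW.nonneg z.fst
      have := sq_nonneg z.snd
      exact ⟨(z.fst, z.snd), ⟨show W z.fst ≤ B by linarith,
        ⟨by nlinarith [sq_nonneg (z.snd + 1)], by nlinarith [sq_nonneg (z.snd - 1)]⟩⟩, rfl⟩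

theorem lieD_nonpos_of_cover (ha0 : a 0 = 0)
    (hcover : E1 a W ∪ E2 a β W ∪ E3 a β γ W ∪ E4 a β γ δ W ∪ E5 a β γ δ W = {0}ᶜ) (x : Rn n) :
    lieD a W x ≤ 0 := by
  rcases eq_or_ne x 0 with rfl | hx
  · simp [lieD, ha0]
  · rcases hcover.ge hx with (((h | h) | h) | h) | h
    · exact h.2.le
    · exact h.2.1
    · exact h.2.1.le
    · exact h.2.1.le
    · exact h.2.1.le

/-- Near the points of `E₄ ∪ E₅` the derivatives `aW` and `βW` vanish and `γW` is nonpositive. -/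
theorem eventually_of_mem_E4_E5
    (hcover : E1 a W ∪ E2 a β W ∪ E3 a β γ W ∪ E4 a β γ δ W ∪ E5 a β γ δ W = {0}ᶜ)
    (hbdry : closure (E1 a W ∪ E2 a β W) ∩ closure (E3 a β γ W ∪ E4 a β γ δ W ∪ E5 a β γ δ W) ⊆
      frontier (E1 a W))
    (hdisj : Disjoint (E4 a β γ δ W ∪ E5 a β γ δ W) (frontier (E1 a W))) {x : Rn n} (hx0 : x ≠ 0)
    (hx : x ∈ E4 a β γ δ W ∪ E5 a β γ δ W) :
    lieD a W =ᶠ[𝓝 x] 0 ∧ lieD β W =ᶠ[𝓝 x] 0 ∧ ∀ᶠ w in 𝓝 x, lieD γ W w ≤ 0 := by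
  -- Otherwise x would lie in both closures, hence on ∂E₁, which E₄ ∪ E₅ avoids.
  have hcl : x ∉ closure (E1 a W ∪ E2 a β W) := fun h => disjoint_left.1 hdisj hx
    (hbdry ⟨h, subset_closure (by rw [union_assoc]; exact Or.inr hx)⟩)
  have hev : ∀ᶠ w in 𝓝 x, lieD a W w = 0 ∧ lieD β W w = 0 ∧ lieD γ W w ≤ 0 := by
    filter_upwards [isClosed_closure.isOpen_compl.mem_nhds hcl, isOpen_ne.mem_nhds hx0]
      with w hw hw0
    rcases hcover.ge hw0 with (((h | h) | h) | h) | h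
    · exact (hw (subset_closure (Or.inl h))).elim
    · exact (hw (subset_closure (Or.inr h))).elim
    · exact ⟨h.2.1, h.2.2.1, h.2.2.2.le⟩
    · exact ⟨h.2.1, h.2.2.1, h.2.2.2.1.le⟩
    · exact ⟨h.2.1, h.2.2.1, h.2.2.2.1.le⟩
  exact ⟨hev.mono fun w h => h.1, hev.mono fun w h => h.2.1, hev.mono fun w h => h.2.2⟩

theorem lieAlternative_of_cover (ha : ContDiff ℝ ∞ a) (hβ : ContDiff ℝ ∞ β)
    (hγ : ContDiff ℝ ∞ γ) (hδ : ContDiff ℝ ∞ δ) (ha0 : a 0 = 0) (hW : IsLyapunovCandidate W)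
    (hcover : E1 a W ∪ E2 a β W ∪ E3 a β γ W ∪ E4 a β γ δ W ∪ E5 a β γ δ W = {0}ᶜ)
    (hbdry : closure (E1 a W ∪ E2 a β W) ∩ closure (E3 a β γ W ∪ E4 a β γ δ W ∪ E5 a β γ δ W) ⊆
      frontier (E1 a W))
    (hdisj : Disjoint (E4 a β γ δ W ∪ E5 a β γ δ W) (frontier (E1 a W))) {z : RnR n}
    (hz : z ≠ 0) :
    lieD input (lyap W) z ≠ 0 ∨
      (lieD input (lyap W) z = 0 → lieD (drift a β γ δ) (lyap W) z < 0) ∨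
      LieAlternative (drift a β γ δ) input (lyap W) z := by
  have hs := hW.smooth
  by_cases hy : z.snd = 0
  swap
  · exact Or.inl (by rw [lieD_input_lyap hs]; simpa using hy)
  right
  have hx : z.fst ≠ 0 := fun h => hz (WithLp.ofLp_injective 2 (Prod.ext h hy))
  have hle := lieD_nonpos_of_cover ha0 hcover
  have hloc := eventually_of_mem_E4_E5 hcover hbdry hdisj hx
  rcases hcover.ge hx with (((h | h) | h) | h) | h
  · refine Or.inl fun _ => ?_
    rw [lieD_drift_lyap hs, hy]
    simpa using h.2
  · rcases h.2.1.lt_or_eq with hlt | heq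
    · refine Or.inl fun _ => ?_
      rw [lieD_drift_lyap hs, hy]
      simpa using hlt
    · exact Or.inr (lieAlternative_of_beta_ne ha hβ hγ hδ hs hle hy heq h.2.2)
  · exact Or.inr (lieAlternative_of_gamma_neg ha hβ hγ hδ hs hle hy h.2.1 h.2.2.1 h.2.2.2)
  · obtain ⟨h0, h1, h2⟩ := hloc (Or.inl h)
    exact Or.inr (lieAlternative_of_delta_ne ha hβ hγ hδ hs hy h0 h1 h2 h.2.2.2.1 h.2.2.2.2)
  · obtain ⟨h0, h1, h2⟩ := hloc (Or.inr h)
    exact Or.inr (lieAlternative_of_bracket_ne ha hβ hγ hδ hs hy h0 h1 h2 h.2.2.2.1 h.2.2.2.2.1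
      h.2.2.2.2.2.1 h.2.2.2.2.2.2)

/-- The derivative of `V` along the drift is `aW + y R` with `R = βW + y γW + y² δW`. -/
noncomputable def remainder (β γ δ : Rn n → Rn n) (W : Rn n → ℝ) (z : RnR n) : ℝ :=
  lieD β W z.fst + z.snd * lieD γ W z.fst + z.snd ^ 2 * lieD δ W z.fst

theorem continuous_remainder (hβ : ContDiff ℝ ∞ β) (hγ : ContDiff ℝ ∞ γ) (hδ : ContDiff ℝ ∞ δ)
    (hW : ContDiff ℝ ∞ W) : Continuous (remainder β γ δ W) :=
  (((contDiff_lieD hβ hW).continuous.comp contDiff_fst.continuous).add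
    (contDiff_snd.continuous.mul
      ((contDiff_lieD hγ hW).continuous.comp contDiff_fst.continuous))).add
    ((contDiff_snd.continuous.pow 2).mul
      ((contDiff_lieD hδ hW).continuous.comp contDiff_fst.continuous))

theorem lieD_drift_lyap_eq (hW : ContDiff ℝ ∞ W) (z : RnR n) :
    lieD (drift a β γ δ) (lyap W) z = lieD a W z.fst + z.snd * remainder β γ δ W z := by
  rw [lieD_drift_lyap hW, remainder]
  ring

theorem exists_radial_bound {E : Type*} [NormedAddCommGroup E] [NormedSpace ℝ E] [ProperSpace E]
    {p : E → ℝ} (hp : Continuous p) :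
    ∃ ξ : ℝ → ℝ, Continuous ξ ∧ (∀ r, 0 ≤ ξ r) ∧ ∀ z, |p z| ≤ ξ ‖z‖ := by
  have hK := isCompact_closedBall (0 : E) 1
  have hc : Continuous fun q : ℝ × E => |p (q.1 • q.2)| := by fun_prop
  -- Scaling the unit ball instead of varying the radius makes the supremum run over a fixed compact
  -- set, so it is continuous in r.
  refine ⟨fun r => sSup ((fun w => |p (r • w)|) '' Metric.closedBall 0 1),
    hK.continuous_sSup (f := fun r w => |p (r • w)|) hc, fun r => ?_, fun z => ?_⟩
  · exact Real.sSup_nonneg (by rintro _ ⟨w, -, rfl⟩; exact abs_nonneg _)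
  · have hb : BddAbove ((fun w => |p (‖z‖ • w)|) '' Metric.closedBall 0 1) :=
      (hK.image (by fun_prop)).bddAbove
    refine le_csSup hb ⟨‖z‖⁻¹ • z, ?_, ?_⟩
    · rw [mem_closedBall_zero_iff, norm_smul, norm_inv, norm_norm]
      exact inv_mul_le_one
    · rcases eq_or_ne z 0 with rfl | hz
      · simp
      · simp only
        rw [smul_smul, mul_inv_cancel₀ (norm_ne_zero_iff.2 hz), one_smul]

theorem sdfConditions_of_lieAlternative (ha : ContDiff ℝ ∞ a) (hβ : ContDiff ℝ ∞ β)
    (hγ : ContDiff ℝ ∞ γ) (hδ : ContDiff ℝ ∞ δ) (ha0 : a 0 = 0) (hW : IsLyapunovCandidate W)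
    (h : ∀ z : RnR n, z ≠ 0 → lieD input (lyap W) z ≠ 0 ∨
      (lieD input (lyap W) z = 0 → lieD (drift a β γ δ) (lyap W) z < 0) ∨
      LieAlternative (drift a β γ δ) input (lyap W) z) :
    SDFConditions (drift a β γ δ) input (lyap W) where
  smooth_f := contDiff_drift ha hβ hγ hδ
  smooth_g := contDiff_input
  f_zero := by simp [drift, ha0]
  candidate := isLyapunovCandidate_lyap hW
  lie z hz := (h z hz).imp id (Or.imp id fun ⟨N, hN, hv, h⟩ => ⟨N, hN, hv,
    h.imp id fun ⟨h0, h⟩ => ⟨h0, h.imp id fun h => Or.inr h.1⟩⟩)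

theorem bsdfConditions_of_lieAlternative (ha : ContDiff ℝ ∞ a) (hβ : ContDiff ℝ ∞ β)
    (hγ : ContDiff ℝ ∞ γ) (hδ : ContDiff ℝ ∞ δ) (ha0 : a 0 = 0) (hW : IsLyapunovCandidate W)
    (hle : ∀ x, lieD a W x ≤ 0)
    (h : ∀ z : RnR n, z ≠ 0 → lieD input (lyap W) z ≠ 0 ∨
      (lieD input (lyap W) z = 0 → lieD (drift a β γ δ) (lyap W) z < 0) ∨
      LieAlternative (drift a β γ δ) input (lyap W) z) :
    BSDFConditions (drift a β γ δ) input (lyap W) where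
  base := sdfConditions_of_lieAlternative ha hβ hγ hδ ha0 hW h
  bound := by
    obtain ⟨ξ, hξ, hξ0, hb⟩ := exists_radial_bound (continuous_remainder hβ hγ hδ hW.smooth)
    refine ⟨fun z => -lieD a W z.fst, ξ, ?_, fun z => neg_nonneg.2 (hle _), hξ.continuousOn,
      fun r _ => hξ0 r, fun z => ?_⟩
    · exact ((contDiff_lieD ha hW.smooth).continuous.comp contDiff_fst.continuous).neg
    · rw [lieD_drift_lyap_eq hW.smooth, lieD_input_lyap hW.smooth, add_neg_cancel_comm, abs_mul,
        mul_comm, abs_mul, abs_two]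
      have h1 := mul_le_mul_of_nonneg_right (hb z) (abs_nonneg z.snd)
      have h2 := mul_nonneg (hξ0 ‖z‖) (abs_nonneg z.snd)
      linarith
  lie z hz := (h z hz).imp id (Or.imp id fun ⟨N, hN, hv, h⟩ => ⟨N, hN, hv,
    h.imp id fun ⟨h0, h⟩ => ⟨h0, h.imp id Or.inr⟩⟩)

end Conditions

/-! ### Monotonicity and short arcs near a point -/

section ShortArcs

theorem lt_of_hasDerivWithinAt_neg {φ φ' : ℝ → ℝ} {s t : ℝ} (hst : s < t)
    (hφ : ∀ r ∈ Icc s t, HasDerivWithinAt φ (φ' r) (Icc s t) r) (hneg : ∀ r ∈ Ioo s t, φ' r < 0) :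
    φ t < φ s := by
  refine strictAntiOn_of_deriv_neg (convex_Icc s t) (fun r hr => (hφ r hr).continuousWithinAt)
    (fun r hr => ?_) (left_mem_Icc.2 hst.le) (right_mem_Icc.2 hst.le) hst
  rw [interior_Icc] at hr
  rw [((hφ r (Ioo_subset_Icc_self hr)).hasDerivAt (Icc_mem_nhds hr.1 hr.2)).deriv]
  exact hneg r hr

theorem exists_sign (r : ℝ) : ∃ σ : ℝ, σ ^ 2 = 1 ∧ σ * r = -|r| := by
  rcases le_total 0 r with h | h
  · exact ⟨-1, by norm_num, by rw [abs_of_nonneg h]; ring⟩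
  · exact ⟨1, by norm_num, by rw [abs_of_nonpos h]; ring⟩

/-- The time h is found before the control, as a pulse depends on its own duration. -/
theorem exists_isArc_mem {E : Type*} [NormedAddCommGroup E] [NormedSpace ℝ E]
    [FiniteDimensional ℝ E] {f : E → E} {C : ℝ} (hf : ContDiff ℝ 1 f) (b : E) {z : E} (hC : 0 ≤ C)
    {N : Set E} (hN : N ∈ 𝓝 z) :
    ∃ h > 0, ∀ u, IsControl C u → ∃ ζ, IsArc f b u ζ 0 h ∧ ζ 0 = z ∧ ∀ r ∈ Icc 0 h, ζ r ∈ N := by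
  have := FiniteDimensional.complete ℝ E
  obtain ⟨T, hT, M, hM, harc⟩ := exists_isArc_short hf b z hC
  obtain ⟨ε, hε, hεN⟩ := Metric.mem_nhds_iff.1 hN
  have hh : 0 < min T (ε / (2 * M)) := lt_min hT (by positivity)
  refine ⟨min T (ε / (2 * M)), hh, fun u hu => ?_⟩
  obtain ⟨ζ, hζ, h0, hζM⟩ := harc u hu
  refine ⟨ζ, hζ.mono hf.continuous hu le_rfl (min_le_left _ _), h0, fun r hr => hεN ?_⟩
  have h1 := hζM r ⟨hr.1, hr.2.trans (min_le_left _ _)⟩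
  have h2 := mul_le_mul_of_nonneg_left (hr.2.trans (min_le_right _ _)) hM.le
  rw [mul_div_assoc', mul_comm 2 M, mul_div_mul_left _ _ hM.ne'] at h2
  rw [Metric.mem_ball, dist_eq_norm]
  linarith

end ShortArcs

/-! ### Derivatives along arcs of the cascade -/

section CascadeArcs

variable {n : ℕ} {a β γ δ : Rn n → Rn n} {W : Rn n → ℝ}

/-- The derivative of `(x, y) ↦ G(x)` along the drift. -/
noncomputable def alongD (a β γ δ : Rn n → Rn n) (G : Rn n → ℝ) (z : RnR n) : ℝ :=
  lieD a G z.fst + z.snd * lieD β G z.fst + z.snd ^ 2 * lieD γ G z.fst +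
    z.snd ^ 3 * lieD δ G z.fst

theorem continuous_alongD (ha : ContDiff ℝ ∞ a) (hβ : ContDiff ℝ ∞ β) (hγ : ContDiff ℝ ∞ γ)
    (hδ : ContDiff ℝ ∞ δ) {G : Rn n → ℝ} (hG : ContDiff ℝ ∞ G) :
    Continuous (alongD a β γ δ G) := by
  have hfst := (contDiff_fst (n := n)).continuous
  have hsnd := (contDiff_snd (n := n)).continuous
  have h0 := (contDiff_lieD ha hG).continuous.comp hfst
  have h1 := (contDiff_lieD hβ hG).continuous.comp hfst
  have h2 := (contDiff_lieD hγ hG).continuous.comp hfst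
  have h3 := (contDiff_lieD hδ hG).continuous.comp hfst
  exact ((h0.add (hsnd.mul h1)).add ((hsnd.pow 2).mul h2)).add ((hsnd.pow 3).mul h3)

variable {u : ℝ → ℝ} {ζ : ℝ → RnR n} {s t C : ℝ}

theorem IsArc.hasDerivWithinAt_comp_fst
    (h : IsArc (drift a β γ δ) (WithLp.toLp 2 (0, 1)) u ζ s t)
    (hf : Continuous (drift a β γ δ)) (hu : IsControl C u) {G : Rn n → ℝ} (hG : ContDiff ℝ ∞ G)
    {r : ℝ} (hr : r ∈ Icc s t) :
    HasDerivWithinAt (fun r => G (ζ r).fst) (alongD a β γ δ G (ζ r)) (Icc s t) r := by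
  have h1 := (WithLp.fstL 2 ℝ (Rn n) ℝ).hasFDerivAt.comp_hasDerivWithinAt r
    (h.hasDerivWithinAt hf hu hr)
  have h2 : (WithLp.fstL 2 ℝ (Rn n) ℝ) ∘ (fun r => ζ r - (∫ τ in s..r, u τ) •
      (WithLp.toLp 2 (0, 1) : RnR n)) = fun r => (ζ r).fst := by
    funext r
    simp [WithLp.fstL]
  rw [h2] at h1
  have h3 := (hG.differentiable (by simp) (ζ r).fst).hasFDerivAt.comp_hasDerivWithinAt r h1
  refine h3.congr_deriv ?_
  have h4 : (WithLp.fstL 2 ℝ (Rn n) ℝ) (drift a β γ δ (ζ r)) = a (ζ r).fst +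
    (ζ r).snd • β (ζ r).fst + (ζ r).snd ^ 2 • γ (ζ r).fst + (ζ r).snd ^ 3 • δ (ζ r).fst := rfl
  rw [h4]
  simp [alongD, lieD]

theorem IsArc.snd_eq (h : IsArc (drift a β γ δ) (WithLp.toLp 2 (0, 1)) u ζ s t)
    (hf : Continuous (drift a β γ δ)) (hu : IsControl C u) {r : ℝ} (hr : r ∈ Icc s t) :
    (ζ r).snd = (ζ s).snd + ∫ τ in s..r, u τ := by
  have h1 := congrArg (WithLp.sndL 2 ℝ (Rn n) ℝ) (h.eq_add hf hu hr)
  rw [map_add, map_add, ← ContinuousLinearMap.intervalIntegral_comp_comm _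
    (h.intervalIntegrable_drift hf (left_mem_Icc.2 (hr.1.trans hr.2)) hr)] at h1
  have h2 : ∀ τ, (WithLp.sndL 2 ℝ (Rn n) ℝ) (drift a β γ δ (ζ τ)) = 0 := fun τ => rfl
  simp only [h2, intervalIntegral.integral_zero, add_zero] at h1
  rw [map_smul] at h1
  simpa [WithLp.sndL] using h1

end CascadeArcs

/-! ### Lowering V by pulses, and the stabilizability assertion -/

section Decrease

variable {n : ℕ} {a β γ δ : Rn n → Rn n} {W : Rn n → ℝ}

theorem abs_eq_one_of_sq {σ : ℝ} (hσ : σ ^ 2 = 1) : |σ| = 1 :=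
  (sq_eq_sq₀ (abs_nonneg σ) zero_le_one).1 (by rw [sq_abs, hσ, one_pow])

/-- The input that drives `y` along `σ (t - t ² / h)` on `[0, h]`. -/
noncomputable def pulse (σ h t : ℝ) : ℝ := σ * max (-1) (min 1 (1 - 2 * t / h))

theorem isControl_pulse {σ C : ℝ} (hσ : σ ^ 2 = 1) (hC : 1 ≤ C) (h : ℝ) :
    IsControl C (pulse σ h) := by
  refine ⟨?_, fun t => ?_⟩
  · unfold pulse
    fun_prop
  · have h1 : |σ| = 1 := abs_eq_one_of_sq hσ
    rw [pulse, abs_mul, h1, one_mul]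
    exact (abs_le.2 ⟨le_max_left _ _, max_le (by norm_num) (min_le_left _ _)⟩).trans hC

theorem integral_pulse (σ : ℝ) {h t : ℝ} (hh : 0 < h) (ht : t ∈ Icc 0 h) :
    ∫ τ in (0 : ℝ)..t, pulse σ h τ = σ * (t - t ^ 2 / h) := by
  have h1 : ∀ τ ∈ uIcc 0 t, pulse σ h τ = σ * (1 - 2 * τ / h) := fun τ hτ => by
    rw [uIcc_of_le ht.1] at hτ
    have h0 : 0 ≤ 2 * τ / h := div_nonneg (by linarith [hτ.1]) hh.le
    have h2 : 2 * τ / h ≤ 2 := by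
      rw [div_le_iff₀ hh]; linarith [hτ.2, ht.2]
    rw [pulse, min_eq_right (by linarith), max_eq_right (by linarith)]
  rw [intervalIntegral.integral_congr h1]
  have h2 : ∀ τ ∈ uIcc 0 t, HasDerivAt (fun τ => σ * (τ - τ ^ 2 / h)) (σ * (1 - 2 * τ / h)) τ :=
    fun τ _ => by
      have := (((hasDerivAt_id τ).sub (((hasDerivAt_id τ).pow 2).div_const h)).const_mul σ)
      simpa using this
  rw [intervalIntegral.integral_eq_sub_of_hasDerivAt h2
    (Continuous.intervalIntegrable (by fun_prop) _ _)]
  simp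

/-- `ζ` starts at `z` and follows the cascade on `[0, h]` while `y = σ (t - t ² / h)`. -/
structure IsPulseArc (a β γ δ : Rn n → Rn n) (z : RnR n) (σ h : ℝ) (ζ : ℝ → RnR n) : Prop where
  init : ζ 0 = z
  snd : ∀ t ∈ Icc 0 h, (ζ t).snd = σ * (t - t ^ 2 / h)
  deriv : ∀ G : Rn n → ℝ, ContDiff ℝ ∞ G → ∀ t ∈ Icc 0 h,
    HasDerivWithinAt (fun t => G (ζ t).fst) (alongD a β γ δ G (ζ t)) (Icc 0 h) t

/-- Short pulses of a suitable sign that stay close to `z` decrease `W`. -/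
def PulseDecreases (a β γ δ : Rn n → Rn n) (W : Rn n → ℝ) (z : RnR n) : Prop :=
  ∃ σ : ℝ, σ ^ 2 = 1 ∧ ∃ N ∈ 𝓝 z, ∀ h ζ, 0 < h → IsPulseArc a β γ δ z σ h ζ →
    (∀ t ∈ Icc 0 h, ζ t ∈ N) → W (ζ h).fst < W z.fst

/-- The pulse returns y to 0, so V changes by the change of W. -/
theorem PulseDecreases.exists_steers (hf : ContDiff ℝ ∞ (drift a β γ δ))
    (hV : Continuous (lyap W : RnR n → ℝ)) {z : RnR n} (hz : z.snd = 0)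
    (hp : PulseDecreases a β γ δ W z) {C η : ℝ} (hC : 1 ≤ C) (hη : 0 < η) :
    ∃ z', lyap W z' < lyap W z ∧
      Steers (drift a β γ δ) (WithLp.toLp 2 (0, 1)) (lyap W) C (lyap W z + η) z z' := by
  obtain ⟨σ, hσ, N, hN, hdec⟩ := hp
  have hN' : N ∩ {w | lyap W w < lyap W z + η} ∈ 𝓝 z :=
    inter_mem hN ((isOpen_lt hV continuous_const).mem_nhds (by simpa using hη))
  obtain ⟨h, hh, harc⟩ := exists_isArc_mem (hf.of_le (by simp)) (WithLp.toLp 2 (0, 1))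
    (zero_le_one.trans hC) hN'
  obtain ⟨ζ, hζ, h0, hmem⟩ := harc _ (isControl_pulse hσ hC h)
  have hpa : IsPulseArc a β γ δ z σ h ζ := by
    refine ⟨h0, fun t ht => ?_, fun G hG t ht =>
      hζ.hasDerivWithinAt_comp_fst hf.continuous (isControl_pulse hσ hC h) hG ht⟩
    rw [hζ.snd_eq hf.continuous (isControl_pulse hσ hC h) ht, h0, hz, zero_add,
      integral_pulse σ hh ht]
  refine ⟨ζ h, ?_, h, hh.le, _, ζ, isControl_pulse hσ hC h, hζ, h0, rfl, fun t ht => (hmem t ht).2⟩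
  have h1 := hdec h ζ hh hpa fun t ht => (hmem t ht).1
  have h2 : (ζ h).snd = 0 := by
    rw [hpa.snd h (right_mem_Icc.2 hh.le), sq, mul_div_cancel_right₀ _ hh.ne']
    ring
  simpa [lyap, h2, hz] using h1

section Pulses

variable {z : RnR n} {σ h : ℝ} {ζ : ℝ → RnR n}

theorem IsPulseArc.lt_of_alongD_neg (hζ : IsPulseArc a β γ δ z σ h ζ) (hh : 0 < h)
    (hW : ContDiff ℝ ∞ W) (hneg : ∀ t ∈ Ioo 0 h, alongD a β γ δ W (ζ t) < 0) :
    W (ζ h).fst < W z.fst := by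
  have := lt_of_hasDerivWithinAt_neg hh (hζ.deriv W hW) hneg
  rwa [hζ.init] at this

theorem IsPulseArc.mul_lt (hζ : IsPulseArc a β γ δ z σ h ζ) {G : Rn n → ℝ} (hG : ContDiff ℝ ∞ G)
    (h0 : G z.fst = 0) {μ : ℝ} (hμ : ∀ t ∈ Icc 0 h, σ * alongD a β γ δ G (ζ t) < μ) {t : ℝ}
    (ht : t ∈ Ioo 0 h) : σ * G (ζ t).fst < μ * t := by
  have := lt_of_hasDerivWithinAt_neg ht.1 (φ := fun r => σ * G (ζ r).fst - μ * r)
    (φ' := fun r => σ * alongD a β γ δ G (ζ r) - μ) (fun r hr => ?_) fun r hr => ?_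
  · simpa [hζ.init, h0] using this
  · have h1 := (hζ.deriv G hG r ⟨hr.1, hr.2.trans ht.2.le⟩).mono (Icc_subset_Icc_right ht.2.le)
    exact (h1.const_mul σ).sub (((hasDerivWithinAt_id r _).const_mul μ).congr_deriv (mul_one μ))
  · linarith [hμ r ⟨hr.1.le, hr.2.le.trans ht.2.le⟩]

theorem pulse_profile_pos {h t : ℝ} (ht : t ∈ Ioo 0 h) : 0 < t - t ^ 2 / h := by
  have hh : 0 < h := ht.1.trans ht.2
  rw [sub_pos, div_lt_iff₀ hh]
  nlinarith [mul_pos ht.1 (sub_pos.2 ht.2)]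

variable (ha : ContDiff ℝ ∞ a) (hβ : ContDiff ℝ ∞ β) (hγ : ContDiff ℝ ∞ γ) (hδ : ContDiff ℝ ∞ δ)
  (hW : ContDiff ℝ ∞ W)

include ha hβ hγ hδ hW

theorem pulseDecreases_of_a_neg (hz : z.snd = 0) (h0 : lieD a W z.fst < 0) :
    PulseDecreases a β γ δ W z := by
  refine ⟨1, one_pow 2, {w | alongD a β γ δ W w < 0},
    (isOpen_lt (continuous_alongD ha hβ hγ hδ hW) continuous_const).mem_nhds ?_,
    fun h ζ hh hζ hN => hζ.lt_of_alongD_neg hh hW fun t ht => hN t (Ioo_subset_Icc_self ht)⟩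
  simpa [alongD, hz] using h0

omit ha in
theorem pulseDecreases_of_beta_ne (hle : ∀ x, lieD a W x ≤ 0) (hz : z.snd = 0)
    (h1 : lieD β W z.fst ≠ 0) : PulseDecreases a β γ δ W z := by
  obtain ⟨σ, hσ, hs⟩ := exists_sign (lieD β W z.fst)
  refine ⟨σ, hσ, {w | σ * remainder β γ δ W w < 0},
    (isOpen_lt (continuous_const.mul (continuous_remainder hβ hγ hδ hW)) continuous_const).mem_nhds
    ?_, fun h ζ hh hζ hN => hζ.lt_of_alongD_neg hh hW fun t ht => ?_⟩
  · have : remainder β γ δ W z = lieD β W z.fst := by simp [remainder, hz]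
    change σ * _ < 0
    rw [this, hs]
    exact neg_neg_of_pos (abs_pos.2 h1)
  · have h2 : σ * remainder β γ δ W (ζ t) < 0 := hN t (Ioo_subset_Icc_self ht)
    have h3 := mul_neg_of_pos_of_neg (pulse_profile_pos ht) h2
    have h4 : alongD a β γ δ W (ζ t) = lieD a W (ζ t).fst + (t - t ^ 2 / h) *
        (σ * remainder β γ δ W (ζ t)) := by
      have : alongD a β γ δ W (ζ t) = lieD a W (ζ t).fst +
        (ζ t).snd * remainder β γ δ W (ζ t) := by rw [alongD, remainder]; ring
      rw [this, hζ.snd t (Ioo_subset_Icc_self ht)]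
      ring
    rw [h4]
    linarith [hle (ζ t).fst]

/-- With s = t - t²/h, the γ-term contributes less than -κ s². The sign σ makes σ a(βW) ≤ 0 at the
start, so the β-term is less than κ t s / 5. Near t = h the latter bound dominates pointwise; only
the integral is negative. -/
theorem pulseDecreases_of_gamma_neg (hle : ∀ x, lieD a W x ≤ 0) (hz : z.snd = 0)
    (h1 : lieD β W z.fst = 0) (h2 : lieD γ W z.fst < 0) : PulseDecreases a β γ δ W z := by
  obtain ⟨σ, hσ, hs⟩ := exists_sign (lieD a (lieD β W) z.fst)
  set κ := -lieD γ W z.fst / 2 with hκ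
  have hκ0 : 0 < κ := by rw [hκ]; linarith
  have hB := contDiff_lieD hβ hW
  have hfst := (contDiff_fst (n := n)).continuous
  have hcont : Continuous fun w : RnR n => lieD γ W w.fst + w.snd * lieD δ W w.fst :=
    ((contDiff_lieD hγ hW).continuous.comp hfst).add (contDiff_snd.continuous.mul
      ((contDiff_lieD hδ hW).continuous.comp hfst))
  refine ⟨σ, hσ, {w | σ * alongD a β γ δ (lieD β W) w < κ / 5} ∩
    {w | lieD γ W w.fst + w.snd * lieD δ W w.fst < -κ}, inter_mem
    ((isOpen_lt (continuous_const.mul (continuous_alongD ha hβ hγ hδ hB))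
      continuous_const).mem_nhds ?_) ((isOpen_lt hcont continuous_const).mem_nhds ?_),
    fun h ζ hh hζ hN => ?_⟩
  · have : alongD a β γ δ (lieD β W) z = lieD a (lieD β W) z.fst := by simp [alongD, hz]
    change σ * _ < κ / 5
    rw [this, hs]
    linarith [abs_nonneg (lieD a (lieD β W) z.fst)]
  · change _ + z.snd * _ < -κ
    rw [hz, zero_mul]
    linarith
  -- A primitive of κ t s / 5 - κ s². The integrals of t s and s² over [0, h] are h³/12 and h³/30,
  -- so p h = -κ h³/60.
  · set p : ℝ → ℝ := fun t => κ / 5 * (t ^ 3 / 3 - t ^ 4 / (4 * h)) -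
      κ * (t ^ 3 / 3 - t ^ 4 / (2 * h) + t ^ 5 / (5 * h ^ 2)) with hp
    have hpd : ∀ t, HasDerivAt p (κ / 5 * (t * (t - t ^ 2 / h)) - κ * (t - t ^ 2 / h) ^ 2) t := by
      intro t
      have h3 := hasDerivAt_pow 3 t
      have h4 := hasDerivAt_pow 4 t
      have h5 := hasDerivAt_pow 5 t
      refine ((((h3.div_const 3).sub (h4.div_const (4 * h))).const_mul (κ / 5)).sub
        ((((h3.div_const 3).sub (h4.div_const (2 * h))).add
          (h5.div_const (5 * h ^ 2))).const_mul κ)).congr_deriv ?_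
      push_cast
      field_simp
      ring
    have hlt := lt_of_hasDerivWithinAt_neg hh (φ := fun t => W (ζ t).fst - p t)
      (fun t ht => (hζ.deriv W hW t ht).sub (hpd t).hasDerivWithinAt) fun t ht => ?_
    · have hph : p h = -κ * h ^ 3 / 60 := by
        rw [hp]; field_simp; ring
      have hp0 : p 0 = 0 := by simp [hp]
      have : 0 < κ * h ^ 3 := by positivity
      simp only [hph, hp0, hζ.init] at hlt
      linarith
    · have hb := hζ.mul_lt hB h1 (fun r hr => (hN r hr).1) ht
      have hg : lieD γ W (ζ t).fst + (ζ t).snd * lieD δ W (ζ t).fst < -κ :=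
        (hN t (Ioo_subset_Icc_self ht)).2
      have hs0 := pulse_profile_pos ht
      have hb' := mul_lt_mul_of_pos_left hb hs0
      have hg' := mul_lt_mul_of_pos_left hg (pow_pos hs0 2)
      have hsnd := hζ.snd t (Ioo_subset_Icc_self ht)
      have he : alongD a β γ δ W (ζ t) = lieD a W (ζ t).fst +
          (t - t ^ 2 / h) * (σ * lieD β W (ζ t).fst) + (t - t ^ 2 / h) ^ 2 *
            (lieD γ W (ζ t).fst + (ζ t).snd * lieD δ W (ζ t).fst) := by
        have : (ζ t).snd ^ 2 = (t - t ^ 2 / h) ^ 2 := by rw [hsnd, mul_pow, hσ, one_mul]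
        rw [← this, alongD]
        linear_combination lieD β W (ζ t).fst * hsnd
      rw [he]
      linarith [hle (ζ t).fst]

omit ha hβ hγ hδ in
theorem IsPulseArc.lt_of_delta (hζ : IsPulseArc a β γ δ z σ h ζ) (hσ : σ ^ 2 = 1) (hh : 0 < h)
    (hloc : ∀ t ∈ Icc 0 h, lieD a W (ζ t).fst = 0 ∧ lieD β W (ζ t).fst = 0 ∧
      lieD γ W (ζ t).fst ≤ 0) (hneg : ∀ t ∈ Ioo 0 h, σ * lieD δ W (ζ t).fst < 0) :
    W (ζ h).fst < W z.fst := by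
  refine hζ.lt_of_alongD_neg hh hW fun t ht => ?_
  obtain ⟨h0, h1, h2⟩ := hloc t (Ioo_subset_Icc_self ht)
  have h3 := mul_neg_of_pos_of_neg (pow_pos (pulse_profile_pos ht) 3) (hneg t ht)
  have h4 := mul_nonpos_of_nonneg_of_nonpos (sq_nonneg (ζ t).snd) h2
  have h5 : (ζ t).snd ^ 3 = (t - t ^ 2 / h) ^ 3 * σ := by
    rw [hζ.snd t (Ioo_subset_Icc_self ht), mul_pow, pow_succ σ 2, hσ]
    ring
  rw [alongD, h0, h1, h5]
  linarith

omit ha hβ hγ in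
theorem pulseDecreases_of_delta_ne
    (hloc : ∀ᶠ x in 𝓝 z.fst, lieD a W x = 0 ∧ lieD β W x = 0 ∧ lieD γ W x ≤ 0)
    (h3 : lieD δ W z.fst ≠ 0) : PulseDecreases a β γ δ W z := by
  obtain ⟨σ, hσ, hs⟩ := exists_sign (lieD δ W z.fst)
  have hev : ∀ᶠ x in 𝓝 z.fst, σ * lieD δ W x < 0 :=
    (isOpen_lt (continuous_const.mul (contDiff_lieD hδ hW).continuous) continuous_const).mem_nhds
      (by change σ * _ < 0; rw [hs]; exact neg_neg_of_pos (abs_pos.2 h3))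
  exact ⟨σ, hσ, _, (contDiff_fst (n := n)).continuous.continuousAt.eventually (hloc.and hev),
    fun h ζ hh hζ hN => hζ.lt_of_delta hW hσ hh (fun t ht => (hN t ht).1)
      fun t ht => (hN t (Ioo_subset_Icc_self ht)).2⟩

/-- Although δW vanishes at the start, its derivative along the arc is initially a(δW) = [a,δ]W ≠ 0.
The right σ makes σ δW negative as soon as t > 0. -/
theorem pulseDecreases_of_bracket_ne (hz : z.snd = 0)
    (hloc : ∀ᶠ x in 𝓝 z.fst, lieD a W x = 0 ∧ lieD β W x = 0 ∧ lieD γ W x ≤ 0)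
    (h3 : lieD δ W z.fst = 0) (h5 : lieD (brk a δ) W z.fst ≠ 0) :
    PulseDecreases a β γ δ W z := by
  have hD := contDiff_lieD hδ hW
  have haD : lieD a (lieD δ W) z.fst ≠ 0 := by
    have h0 : lieD a W =ᶠ[𝓝 z.fst] 0 := hloc.mono fun x h => h.1
    rw [lieD_brk ha hδ hW, Pi.sub_apply, (lieD_eventuallyEq_zero δ h0).self_of_nhds] at h5
    simpa using h5
  obtain ⟨σ, hσ, hs⟩ := exists_sign (lieD a (lieD δ W) z.fst)
  have hev : ∀ᶠ w in 𝓝 z, σ * alongD a β γ δ (lieD δ W) w < 0 := by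
    refine (isOpen_lt (continuous_const.mul (continuous_alongD ha hβ hγ hδ hD))
      continuous_const).mem_nhds ?_
    have : alongD a β γ δ (lieD δ W) z = lieD a (lieD δ W) z.fst := by simp [alongD, hz]
    change σ * _ < 0
    rw [this, hs]
    exact neg_neg_of_pos (abs_pos.2 haD)
  exact ⟨σ, hσ, _, ((contDiff_fst (n := n)).continuous.continuousAt.eventually hloc).and hev,
      fun h ζ hh hζ hN => hζ.lt_of_delta hW hσ hh (fun t ht => (hN t ht).1) fun t ht => by
        simpa using hζ.mul_lt hD h3 (fun r hr => (hN r hr).2) ht⟩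

end Pulses

/-- Under the control Cσ with σy = -|y|, the derivative of V is aW + σy (σR + 2C), where R is
`remainder`; it is negative as long as |R| < 2C and σy < 0. -/
theorem exists_steers_of_snd_ne_zero (hf : ContDiff ℝ ∞ (drift a β γ δ)) (hβ : ContDiff ℝ ∞ β)
    (hγ : ContDiff ℝ ∞ γ) (hδ : ContDiff ℝ ∞ δ) (hW : ContDiff ℝ ∞ W)
    (hle : ∀ x, lieD a W x ≤ 0) {z : RnR n} (hz : z.snd ≠ 0) {C η : ℝ}
    (hC : |remainder β γ δ W z| < 2 * C) (hη : 0 < η) :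
    ∃ z', lyap W z' < lyap W z ∧
      Steers (drift a β γ δ) (WithLp.toLp 2 (0, 1)) (lyap W) C (lyap W z + η) z z' := by
  obtain ⟨σ, hσ, hs⟩ := exists_sign z.snd
  have hC0 : 0 ≤ C := by linarith [abs_nonneg (remainder β γ δ W z)]
  have hu : IsControl C fun _ => C * σ := ⟨measurable_const, fun _ => by
    rw [abs_mul, abs_of_nonneg hC0, abs_eq_one_of_sq hσ, mul_one]⟩
  have hN : {w | |remainder β γ δ W w| < 2 * C} ∩ ({w | lyap W w < lyap W z + η} ∩
      {w | σ * w.snd < 0}) ∈ 𝓝 z := by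
    refine inter_mem ((isOpen_lt (continuous_remainder hβ hγ hδ hW).abs
      continuous_const).mem_nhds hC) (inter_mem ((isOpen_lt (contDiff_lyap hW).continuous
        continuous_const).mem_nhds ?_) ((isOpen_lt (continuous_const.mul contDiff_snd.continuous)
          continuous_const).mem_nhds ?_))
    · simpa using hη
    · change σ * _ < 0
      rw [hs]
      exact neg_neg_of_pos (abs_pos.2 hz)
  obtain ⟨h, hh, harc⟩ := exists_isArc_mem (hf.of_le (by simp)) (WithLp.toLp 2 (0, 1)) hC0 hN
  obtain ⟨ζ, hζ, h0, hmem⟩ := harc _ hu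
  refine ⟨ζ h, ?_, h, hh.le, _, ζ, hu, hζ, h0, rfl, fun t ht => (hmem t ht).2.1⟩
  have hsnd : ∀ t ∈ Icc 0 h, (ζ t).snd = z.snd + t * (C * σ) := fun t ht => by
    rw [hζ.snd_eq hf.continuous hu ht, h0, intervalIntegral.integral_const, sub_zero, smul_eq_mul]
  have hlt := lt_of_hasDerivWithinAt_neg hh
    (φ := fun t => W (ζ t).fst + (z.snd + t * (C * σ)) ^ 2)
    (φ' := fun t => alongD a β γ δ W (ζ t) + 2 * (z.snd + t * (C * σ)) * (C * σ))
    (fun t ht => ?_) fun t ht => ?_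
  · simpa [lyap, hsnd h (right_mem_Icc.2 hh.le), h0] using hlt
  · have h1 := (((hasDerivAt_id t).mul_const (C * σ)).const_add z.snd).pow 2
    refine (hζ.hasDerivWithinAt_comp_fst hf.continuous hu hW ht).add
      (h1.hasDerivWithinAt.congr_deriv ?_)
    simp
  · have ht' := Ioo_subset_Icc_self ht
    rw [← hsnd t ht']
    obtain ⟨hr, -, hneg⟩ := hmem t ht'
    have hneg : σ * (ζ t).snd < 0 := hneg
    have hr : |remainder β γ δ W (ζ t)| < 2 * C := hr
    have h1 : 0 < σ * remainder β γ δ W (ζ t) + 2 * C := by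
      have : |σ * remainder β γ δ W (ζ t)| < 2 * C := by
        rwa [abs_mul, abs_eq_one_of_sq hσ, one_mul]
      linarith [(abs_lt.1 this).1]
    have h2 := mul_neg_of_neg_of_pos hneg h1
    have h3 : alongD a β γ δ W (ζ t) + 2 * (ζ t).snd * (C * σ) = lieD a W (ζ t).fst +
        σ * (ζ t).snd * (σ * remainder β γ δ W (ζ t) + 2 * C) := by
      rw [alongD, remainder]
      linear_combination -((ζ t).snd * (lieD β W (ζ t).fst + (ζ t).snd * lieD γ W (ζ t).fst +
        (ζ t).snd ^ 2 * lieD δ W (ζ t).fst)) * hσ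
    rw [h3]
    linarith [hle (ζ t).fst]

theorem bsdfsgas_of_cover (ha : ContDiff ℝ ∞ a) (hβ : ContDiff ℝ ∞ β)
    (hγ : ContDiff ℝ ∞ γ) (hδ : ContDiff ℝ ∞ δ) (ha0 : a 0 = 0) (hW : IsLyapunovCandidate W)
    (hcover : E1 a W ∪ E2 a β W ∪ E3 a β γ W ∪ E4 a β γ δ W ∪ E5 a β γ δ W = {0}ᶜ)
    (hbdry : closure (E1 a W ∪ E2 a β W) ∩ closure (E3 a β γ W ∪ E4 a β γ δ W ∪ E5 a β γ δ W) ⊆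
      frontier (E1 a W))
    (hdisj : Disjoint (E4 a β γ δ W ∪ E5 a β γ δ W) (frontier (E1 a W))) :
    BSDFSGAS fun (z : RnR n) (u : ℝ) => drift a β γ δ z + u • input z := by
  intro R hR T hT
  have hs := hW.smooth
  have hf := contDiff_drift ha hβ hγ hδ
  have hL := isLyapunovCandidate_lyap hW
  have hle := lieD_nonpos_of_cover ha0 hcover
  obtain ⟨c, hc⟩ := (isCompact_closedBall (0 : RnR n) R).bddAbove_image
    hL.smooth.continuous.continuousOn
  obtain ⟨B, hB⟩ := (hL.isCompact_sublevel (c + 1)).bddAbove_image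
    (continuous_remainder hβ hγ hδ hs).abs.continuousOn
  have hball : ∀ w ∈ Metric.closedBall (0 : RnR n) R, lyap W w ≤ c := fun w hw =>
    hc (mem_image_of_mem _ hw)
  have hc0 : 0 ≤ c := hL.zero ▸ hball 0 (Metric.mem_closedBall_self hR.le)
  -- The single control bound |B| + 1 serves both cases: pulses need 1, and constant controls need
  -- more than half of `remainder` on the sublevel set.
  have hC : 1 ≤ |B| + 1 := by linarith [abs_nonneg B]
  have hdec : CanDecrease (drift a β γ δ) (WithLp.toLp 2 (0, 1)) (lyap W) (|B| + 1) (c + 1) := by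
    intro z hz hzc η hη
    by_cases hy : z.snd = 0
    swap
    · refine exists_steers_of_snd_ne_zero hf hβ hγ hδ hs hle hy ?_ hη
      have : |remainder β γ δ W z| ≤ B := hB (mem_image_of_mem _ hzc.le)
      linarith [le_abs_self B, abs_nonneg B]
    have hx : z.fst ≠ 0 := fun h => hz (WithLp.ofLp_injective 2 (Prod.ext h hy))
    refine PulseDecreases.exists_steers hf hL.smooth.continuous hy ?_ hC hη
    have hloc := eventually_of_mem_E4_E5 hcover hbdry hdisj hx
    rcases hcover.ge hx with (((h | h) | h) | h) | h
    · exact pulseDecreases_of_a_neg ha hβ hγ hδ hs hy h.2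
    · exact pulseDecreases_of_beta_ne hβ hγ hδ hs hle hy h.2.2
    · exact pulseDecreases_of_gamma_neg ha hβ hγ hδ hs hle hy h.2.2.1 h.2.2.2
    · obtain ⟨h0, h1, h2⟩ := hloc (Or.inl h)
      exact pulseDecreases_of_delta_ne hδ hs (h0.and (h1.and h2)) h.2.2.2.2
    · obtain ⟨h0, h1, h2⟩ := hloc (Or.inr h)
      exact pulseDecreases_of_bracket_ne ha hβ hγ hδ hs hy (h0.and (h1.and h2)) h.2.2.2.2.1
        h.2.2.2.2.2.2
  obtain ⟨k, hk, hkC⟩ := exists_isStabilizing (hf.of_le (by simp)) (by simp [drift, ha0]) hL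
    (zero_le_one.trans hC) (by linarith) hdec hT
  refine ⟨{z | lyap W z < c + 1}, (isOpen_lt hL.smooth.continuous continuous_const).mem_nhds ?_,
    fun w hw => ?_, k, hk, |B| + 1, by linarith, 1, one_pos, fun z _ t _ => hkC t z⟩
  · change lyap W 0 < c + 1
    rw [hL.zero]
    linarith
  · have := hball w hw
    change lyap W w < c + 1
    linarith

end Decrease
end SampledData

theorem mainTheorem3 {n : ℕ}
    (a β γ δ : SampledData.Rn n → SampledData.Rn n) (W : SampledData.Rn n → ℝ)
    (ha : ContDiff ℝ ∞ a) (hβ : ContDiff ℝ ∞ β) (hγ : ContDiff ℝ ∞ γ) (hδ : ContDiff ℝ ∞ δ)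
    (ha0 : a 0 = 0) (hW : SampledData.IsLyapunovCandidate W)
    (A₁ A₂ A₃ A₄ A₅ : Set (SampledData.Rn n))
    (hA₁ : A₁ = SampledData.E1 a W) (hA₂ : A₂ = SampledData.E2 a β W)
    (hA₃ : A₃ = SampledData.E3 a β γ W) (hA₄ : A₄ = SampledData.E4 a β γ δ W)
    (hA₅ : A₅ = SampledData.E5 a β γ δ W)
    (hcover : A₁ ∪ A₂ ∪ A₃ ∪ A₄ ∪ A₅ = {0}ᶜ)
    (hne : A₁.Nonempty ∧ A₂.Nonempty ∧ A₃.Nonempty ∧ A₄.Nonempty ∧ A₅.Nonempty)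
    (hcl : 0 ∈ closure A₁ ∧ 0 ∈ closure A₂ ∧ 0 ∈ closure A₃ ∧ 0 ∈ closure A₄ ∧ 0 ∈ closure A₅)
    (hbdry : closure (A₁ ∪ A₂) ∩ closure (A₃ ∪ A₄ ∪ A₅) = frontier A₁)
    (hint₃ : (interior A₃).Nonempty)
    (hcl₄₅ : closure (A₄ ∪ A₅) ⊆ frontier A₃)
    (hint₄₅ : interior (A₄ ∪ A₅) = ∅)
    (hdisj : Disjoint (A₄ ∪ A₅) (frontier A₁)) :
    SampledData.SDFConditions (SampledData.drift a β γ δ) SampledData.input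
        (SampledData.lyap W) ∧
      SampledData.BSDFConditions (SampledData.drift a β γ δ) SampledData.input
        (SampledData.lyap W) ∧
      SampledData.BSDFSGAS (fun (z : SampledData.RnR n) (u : ℝ) =>
        SampledData.drift a β γ δ z + u • SampledData.input z) := by
  subst hA₁ hA₂ hA₃ hA₄ hA₅
  have h := fun z hz => SampledData.lieAlternative_of_cover ha hβ hγ hδ ha0 hW hcover hbdry.le hdisj
    (z := z) hz
  exact ⟨SampledData.sdfConditions_of_lieAlternative ha hβ hγ hδ ha0 hW h,
    SampledData.bsdfConditions_of_lieAlternative ha hβ hγ hδ ha0 hW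
      (SampledData.lieD_nonpos_of_cover ha0 hcover) h,
    SampledData.bsdfsgas_of_cover ha hβ hγ hδ ha0 hW hcover hbdry.le hdisj⟩
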